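/- Theorem. Let $\lambda$ be a ballot path of length $N$, i.e. a lattice path from $(0,0)$ with $N$ steps $U=(1,1)$ and $D=(1,-1)$ that does not go below $y=0$. Write $A(\lambda)$ for its plane tree (defined below), and let $P^{I}_{\lambda,\ast}=\sum_{\mu}\sum_{B\in\mathcal B^{I}(\lambda/\mu)}q^{\mathrm{art}(B)}$ be the generating function of type BI of $T=A(\lambda)$, where $\mu$ runs over the paths of length $N$ from $(0,0)$ that are nowhere below $\lambda$. Then $$P^{I}_{\lambda,\ast}=\Bigl(\sum_{L}q^{\deg_7(L)}\prod_{e\in B(T)\cap\mathcal E_\circ(L)}\bigl(1+q^{S(e)-1}\bigr)\Bigr)\cdot\prod_{e\in A(T)}\bigl(1+q^{S(e)}\bigr),$$ where $L$ runs over the natural labellings of $T$. The notation is as follows. Tilings. The shape $\lambda/\mu$ consists of the unit squares (boxes), rotated by $45^\circ$, whose centers lie in a column $1\le x\le N$ strictly between $\lambda$ and $\mu$ (in column $x$: heights $\lambda(x)+1,\lambda(x)+3,\dots,\mu(x)-1$); boxes in column $N$ are anchor boxes. A ballot tile of length $(2n,n')$ is a ribbon whose box centers form a ballot path (starting at its own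 origin) with $n$ steps $D$ and $n+n'$ steps $U$; it has $\mathrm{area}=2n+n'+1$ boxes, $\mathrm{tiles}=1$ if $n'=0$ and $\mathrm{tiles}=0$ if $n'\ge1$, and $\mathrm{art}=(\mathrm{area}+\mathrm{tiles})/2$. $\mathcal B^{I}(\lambda/\mu)$ is the set of tilings $B$ of $\lambda/\mu$ by ballot tiles such that (i) each tile, translated downward by one box, is strictly below $\lambda$ or is contained in another tile of $B$; (ii) the rightmost box of each tile with $n'\ge1$ is an anchor box; (iii) for each $(2n,n')$ with $n'$ odd the number of tiles of length $(2n,n')$ is even, and there is no tile with $n'$ even and positive. $\mathrm{art}(B)$ is the sum of $\mathrm{art}$ over the tiles. Tree. Write $\lambda=z_kUz_{k-1}U\cdots Uz_1Uz_0$ with Dyck words $z_i$. For a Dyck word $z$, $A(z)$ is the plane tree with one edge for each matched pair $UD$: $A(\emptyset)$ is a single vertex, $A(UzD)$ is $A(z)$ with an edge put above its root, and $A(zz')$ is $A(z)$ and $A(z')$ (in this order) joined at their roots. Let $R_0=A(z_0)$; for $1\le j\le k$ let $R_j$ be obtained by joining at the roots $A(z_j)$ and, to its right, the tree $R_{j-1}$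 with a dotted ($\bullet$) edge put above its root if $j$ is odd, and $R_{j-1}$ itself if $j$ is even. Then $A(\lambda)=R_k$. Moreover, when $j$ is odd, each root edge of $A(z_j)$ in $R_j$ receives an arrow ($\leftarrow$) from the next edge to its right at the same vertex (the last one from the dotted edge). There are no other arrows. Labellings. Let $\mathcal E$ be the set of edges of $T$, $\mathcal E_\bullet$ the set of dotted edges and $|T|=|\mathcal E|$. A natural labelling $L=(n_e)_{e\in\mathcal E}$ uses each of $1,\dots,|T|$ once and increases from the root to the leaves. An edge $e'$ is strictly right to $e$ if it lies to the right of $e$ and neither is an ancestor of the other, and $\deg_7(L)=\sum_{e\in\mathcal E}\#\{e'\mid n_{e'}<n_e,\ e'\text{ strictly right to }e\}$. Let $n^{\mathrm{ref}}_e\in\{1,\dots,|T|\}$ be the position of $e$ in the modified post-order from left to right, in which an edge without a dot is visited after, and a dotted edge before, all the edges below it; put $S(e)=|T|+1-n^{\mathrm{ref}}_e$. $A(T)$ is the set of $e\in\mathcal E\setminus\mathcal E_\bullet$ such that neither $e$ nor any ancestor of $e$ has an incoming arrow, and $B(T)=\mathcal E\setminus(\mathcal E_\bullet\cup A(T))$.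 The set $\mathcal E_\circ(L)$ of circled edges consists of the edges $e\notin\mathcal E_\bullet$ which have no incoming arrow or which occur among $e(1),\dots,e(p)$ for some sequence of edges with arrows $e(1)\leftarrow\cdots\leftarrow e(p)\leftarrow e^*$ such that $n_{e(i)}>n_{e^*}$ for $1\le i\le p$. -/

import Mathlib

namespace BallotBI

open DyckStep

/-! ### Paths, boxes, ballot tiles and ballot tilings of type BI -/

/-- The height of a lattice path, given by its word in `U = (1,1)` and `D = (1,-1)`, above the
abscissa `x`. The path starts at the origin. -/
def height (w : List DyckStep) (x : ℕ) : ℤ :=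
  ((w.take x).count U : ℤ) - ((w.take x).count D : ℤ)

/-- A ballot path: a path from the origin that does not go below the line `y = 0`. -/
def IsBallot (w : List DyckStep) : Prop :=
  ∀ x, 0 ≤ height w x

/-- The boxes of the shifted skew shape `lam / mu` between the lower path `lam` and the upper path
`mu`. A box is a unit square rotated by 45 degrees, given by its center. The boxes of the column
`x` have heights `height lam x + 1, height lam x + 3, …, height mu x - 1`; those in the last column
`x = lam.length` are the anchor boxes. -/
def region (lam mu : List DyckStep) : Set (ℕ × ℤ) :=
  {b | b.1 ≤ lam.length ∧ height lam b.1 < b.2 ∧ b.2 < height mu b.1 ∧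
    Odd (b.2 - height lam b.1)}

/-- A ribbon of boxes: the centers of its boxes are the lattice points of the path that starts at
`(x, y)` and has the step word `word`. -/
structure Tile where
  x : ℕ
  y : ℤ
  word : List DyckStep
deriving DecidableEq

namespace Tile

/-- The boxes of a tile (one more than the number of steps). -/
def boxes (t : Tile) : Finset (ℕ × ℤ) :=
  (Finset.range (t.word.length + 1)).image fun i => (t.x + i, t.y + height t.word i)

/-- The path of centers ends at height `n'` over its start and has `2 * n + n'` steps. -/
def HasLength (t : Tile) (n n' : ℕ) : Prop :=
  t.word.count D = n ∧ t.word.count U = n + n'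

/-- The number of boxes, `2 * n + 1 + n'` for a tile of length `(2n, n')`. -/
def area (t : Tile) : ℕ := t.word.length + 1

/-- `1` for Dyck tiles and `0` for ballot tiles of length `(2n, n')` with `n' ≥ 1`. -/
def tiles (t : Tile) : ℕ := if t.word.count U = t.word.count D then 1 else 0

/-- The sum `area + tiles` is even for all tiles that occur in a tiling of type BI. -/
def art (t : Tile) : ℕ := (t.area + t.tiles) / 2

end Tile

/-- `S` is a cover-inclusive ballot tiling of type BI of the skew shape `lam / mu`. -/
structure IsTiling (lam mu : List DyckStep) (S : Finset Tile) : Prop where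
  /-- the skew shape `lam / mu` exists -/
  length_eq : mu.length = lam.length
  le : ∀ x, height lam x ≤ height mu x
  /-- the tiles are ballot tiles -/
  ballot : ∀ t ∈ S, IsBallot t.word
  /-- the tiles tile the skew shape -/
  cover : ∀ b : ℕ × ℤ, b ∈ region lam mu ↔ ∃ t ∈ S, b ∈ t.boxes
  disjoint : ∀ t ∈ S, ∀ t' ∈ S, t ≠ t' → Disjoint t.boxes t'.boxes
  /-- a tile translated downward by one box is strictly below `lam` or contained in another tile -/
  coverInclusive : ∀ t ∈ S,
    (∀ b ∈ t.boxes, b.2 - 2 < height lam b.1) ∨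
      ∃ t' ∈ S, ∀ b ∈ t.boxes, (b.1, b.2 - 2) ∈ t'.boxes
  /-- the rightmost box of a tile of length `(2n, n')` with `n' ≥ 1` is an anchor box -/
  anchor : ∀ t ∈ S, ∀ n n', 1 ≤ n' → t.HasLength n n' → t.x + t.word.length = lam.length
  /-- the number of tiles of length `(2n, n')` is even if `n'` is odd -/
  even_card : ∀ n n', Odd n' → Even {t : Tile | t ∈ S ∧ t.HasLength n n'}.ncard
  /-- there is no tile of length `(2n, n')` with `n'` even and positive -/
  no_even : ∀ t ∈ S, ∀ n n', Even n' → 0 < n' → ¬ t.HasLength n n'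

theorem finite_dyckStep : Finite DyckStep :=
  Finite.of_injective (fun s : DyckStep => decide (s = U)) (by
    intro a b h
    cases a <;> cases b <;> simp_all)

theorem finite_paths (N : ℕ) : {mu : List DyckStep | mu.length = N}.Finite :=
  have := finite_dyckStep
  List.finite_length_eq DyckStep N

theorem abs_height_le (w : List DyckStep) (x : ℕ) :
    -(w.length : ℤ) ≤ height w x ∧ height w x ≤ w.length := by
  have h1 : (w.take x).count U ≤ w.length :=
    List.count_le_length.trans (by simp [List.length_take])
  have h2 : (w.take x).count D ≤ w.length :=
    List.count_le_length.trans (by simp [List.length_take])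
  unfold height
  omega

theorem finite_tilings (lam mu : List DyckStep) : {S | IsTiling lam mu S}.Finite := by
  have := finite_dyckStep
  set N := lam.length with hN
  have hF : {t : Tile | t.x ≤ N ∧ (-(N : ℤ) ≤ t.y ∧ t.y ≤ N) ∧ t.word.length ≤ N}.Finite := by
    refine Set.Finite.subset
      (((Set.finite_Iic N).prod ((Set.finite_Icc (-(N : ℤ)) N).prod
        (List.finite_length_le DyckStep N))).image
        (fun p : ℕ × ℤ × List DyckStep => Tile.mk p.1 p.2.1 p.2.2)) ?_
    rintro ⟨x, y, w⟩ ⟨h1, h2, h3⟩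
    exact ⟨(x, y, w), ⟨h1, h2, h3⟩, rfl⟩
  refine Set.Finite.subset (hF.toFinset.powerset.finite_toSet) ?_
  intro S hS
  simp only [Finset.coe_powerset, Set.mem_preimage, Set.mem_powerset_iff]
  intro t ht
  have key : ∀ i ≤ t.word.length, (t.x + i, t.y + height t.word i) ∈ region lam mu := by
    intro i hi
    refine (hS.cover _).2 ⟨t, ht, ?_⟩
    exact Finset.mem_image.2 ⟨i, Finset.mem_range.2 (by omega), rfl⟩
  have k0 := key 0 (Nat.zero_le _)
  have k1 := key t.word.length le_rfl
  have hh : height t.word 0 = 0 := by simp [height]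
  have b1 := abs_height_le lam (t.x + 0)
  have b2 := abs_height_le mu (t.x + 0)
  have hl := hS.length_eq
  simp only [region, Set.mem_ofPred_eq, hh] at k0 k1
  obtain ⟨k00, k01, k02, -⟩ := k0
  have k10 := k1.1
  simp only [Set.Finite.coe_toFinset, Set.mem_ofPred_eq]
  refine ⟨by omega, ⟨by omega, by omega⟩, by omega⟩

/-- The generating function of the ballot tilings of type BI of the shape `lam / mu`. -/
noncomputable def genFun (lam mu : List DyckStep) : Polynomial ℤ :=
  ∑ S ∈ (finite_tilings lam mu).toFinset, Polynomial.X ^ (∑ t ∈ S, t.art)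

/-- The generating function of the ballot tilings of type BI with fixed lower path `lam`. -/
noncomputable def genFunLower (lam : List DyckStep) : Polynomial ℤ :=
  ∑ mu ∈ (finite_paths lam.length).toFinset, genFun lam mu

/-! ### Plane trees with dots and arrows -/

/-- A plane tree, given by the edges at its root from left to right. In `node dot arrow c r`, the
leftmost edge at the root carries a dot if `dot` is true, has an incoming arrow from the next edge
to the right at the same vertex if `arrow` is true, and has the tree `c` below it; `r` is the tree
formed by the remaining edges at the root and what is below them. -/
inductive PlaneTree where
  | nil : PlaneTree
  | node (dot arrow : Bool) (c r : PlaneTree) : PlaneTree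

/-- The trees obtained by reading a word `w = y_0 D y_1 D ⋯ y_{m-1} D z_k U z_{k-1} U ⋯ U z_0`, with
Dyck words `y_i` and `z_i`, from right to left. -/
structure Parse where
  /-- the trees of `y_0, …, y_{m-1}` -/
  pending : List PlaneTree
  /-- the number `k` of unpaired `U` -/
  unpaired : ℕ
  /-- the tree of `z_k U z_{k-1} U ⋯ U z_0` -/
  base : PlaneTree

/-- A `U` that is paired with a `D` gives an edge without a dot above the tree of the Dyck word
between them. If this edge is put directly to the left of the tree of `z_k U ⋯ U z_0` with `k` odd,
it has an incoming arrow from the next edge to the right. If `k` is even and the `U` is unpaired, it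
is the terminal `U` (for `k = 0`) or the left one of a `UU`-pair, and gives an edge with a dot. If
`k` is odd and the `U` is unpaired, it is the right one of a `UU`-pair or an extra `U`, and gives
no edge. -/
def parse : List DyckStep → Parse
  | [] => ⟨[], 0, .nil⟩
  | .D :: w => ⟨.nil :: (parse w).pending, (parse w).unpaired, (parse w).base⟩
  | .U :: w =>
    match (parse w).pending with
    | [] =>
      if Even (parse w).unpaired then
        ⟨[], (parse w).unpaired + 1, .node true false (parse w).base .nil⟩
      else ⟨[], (parse w).unpaired + 1, (parse w).base⟩
    | [F] => ⟨[], (parse w).unpaired, .node false (decide (Odd (parse w).unpaired)) F (parse w).base⟩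
    | F :: G :: l => ⟨.node false false F G :: l, (parse w).unpaired, (parse w).base⟩

/-- The plane tree `A(lam)` of a ballot path `lam`. -/
def tree (lam : List DyckStep) : PlaneTree := (parse lam).base

/-- The edges of a plane tree. -/
inductive Edge : PlaneTree → Type where
  /-- the leftmost edge at the root -/
  | top {d a : Bool} {c r : PlaneTree} : Edge (.node d a c r)
  /-- an edge below the leftmost edge at the root -/
  | under {d a : Bool} {c r : PlaneTree} (e : Edge c) : Edge (.node d a c r)
  /-- any other edge -/
  | later {d a : Bool} {c r : PlaneTree} (e : Edge r) : Edge (.node d a c r)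
deriving DecidableEq

namespace Edge

/-- The edge `e` carries a dot. -/
def Dotted : {T : PlaneTree} → Edge T → Prop
  | .node d _ _ _, .top => d = true
  | .node _ _ _ _, .under e => Dotted e
  | .node _ _ _ _, .later e => Dotted e

/-- `Above e e'`: the edge `e` is an ancestor of `e'`, different from `e'`. -/
def Above : {T : PlaneTree} → Edge T → Edge T → Prop
  | .node _ _ _ _, .top, .under _ => True
  | .node _ _ _ _, .under e, .under e' => Above e e'
  | .node _ _ _ _, .later e, .later e' => Above e e'
  | .node _ _ _ _, .top, .top => False
  | .node _ _ _ _, .top, .later _ => False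
  | .node _ _ _ _, .under _, .top => False
  | .node _ _ _ _, .under _, .later _ => False
  | .node _ _ _ _, .later _, .top => False
  | .node _ _ _ _, .later _, .under _ => False

/-- `StrictlyRight e e'`: the edge `e'` is to the right of `e`, and none of the two is an ancestor
of the other. -/
def StrictlyRight : {T : PlaneTree} → Edge T → Edge T → Prop
  | .node _ _ _ _, .top, .later _ => True
  | .node _ _ _ _, .under _, .later _ => True
  | .node _ _ _ _, .under e, .under e' => StrictlyRight e e'
  | .node _ _ _ _, .later e, .later e' => StrictlyRight e e'
  | .node _ _ _ _, .top, .top => False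
  | .node _ _ _ _, .top, .under _ => False
  | .node _ _ _ _, .under _, .top => False
  | .node _ _ _ _, .later _, .top => False
  | .node _ _ _ _, .later _, .under _ => False

/-- The edge `e` is the leftmost edge at the root. -/
def IsTop : {T : PlaneTree} → Edge T → Prop
  | .node _ _ _ _, .top => True
  | .node _ _ _ _, .under _ => False
  | .node _ _ _ _, .later _ => False

/-- `Arrow e e'`: there is a dashed arrow from `e'` to `e`. -/
def Arrow : {T : PlaneTree} → Edge T → Edge T → Prop
  | .node _ a _ _, .top, .later e' => a = true ∧ IsTop e'
  | .node _ _ _ _, .under e, .under e' => Arrow e e'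
  | .node _ _ _ _, .later e, .later e' => Arrow e e'
  | .node _ _ _ _, .top, .top => False
  | .node _ _ _ _, .top, .under _ => False
  | .node _ _ _ _, .under _, .top => False
  | .node _ _ _ _, .under _, .later _ => False
  | .node _ _ _ _, .later _, .top => False
  | .node _ _ _ _, .later _, .under _ => False

/-- The edge `e` has an incoming arrow. -/
def HasIncoming {T : PlaneTree} (e : Edge T) : Prop := ∃ e', Arrow e e'

/-- The edges in the modified post-order: an edge without a dot is visited after, and an edge with
a dot is visited before, the edges below it. -/
def modPost : (T : PlaneTree) → List (Edge T)
  | .nil => []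
  | .node true _ c r => .top :: (modPost c).map .under ++ (modPost r).map .later
  | .node false _ c r => (modPost c).map .under ++ .top :: (modPost r).map .later

theorem mem_modPost : {T : PlaneTree} → (e : Edge T) → e ∈ modPost T
  | .node true _ _ _, .top => by simp [modPost]
  | .node false _ _ _, .top => by simp [modPost]
  | .node true _ _ _, .under e => by simp [modPost, mem_modPost e]
  | .node false _ _ _, .under e => by simp [modPost, mem_modPost e]
  | .node true _ _ _, .later e => by simp [modPost, mem_modPost e]
  | .node false _ _ _, .later e => by simp [modPost, mem_modPost e]

instance (T : PlaneTree) : Fintype (Edge T) :=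
  ⟨(modPost T).toFinset, fun e => List.mem_toFinset.2 (mem_modPost e)⟩

/-- The label of `e` in the reference labelling, i.e. the position of `e` (from `1` to the number of
edges) in the modified post-order. -/
def refLabel {T : PlaneTree} (e : Edge T) : ℕ := (modPost T).idxOf e + 1

/-- `S(e) = |T| + 1 - refLabel e`, a number from `1` to `|T|`. -/
def S {T : PlaneTree} (e : Edge T) : ℕ := Fintype.card (Edge T) + 1 - refLabel e

/-- `A(T)`: edges without a dot such that neither they nor any of their ancestors has an incoming
arrow. -/
def InA {T : PlaneTree} (e : Edge T) : Prop :=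
  ¬ Dotted e ∧ ¬ HasIncoming e ∧ ∀ e', Above e' e → ¬ HasIncoming e'

/-- `B(T)`: the remaining edges without a dot. -/
def InB {T : PlaneTree} (e : Edge T) : Prop := ¬ Dotted e ∧ ¬ InA e

end Edge

open Edge

/-- A labelling of the edges in which each of `0, …, |T| - 1` appears once (the label `i` stands for
the integer `i + 1`). -/
abbrev Labelling (T : PlaneTree) : Type := Edge T ≃ Fin (Fintype.card (Edge T))

/-- Natural labellings: the labels increase from the root to the leaves. -/
def IsNatural {T : PlaneTree} (L : Labelling T) : Prop :=
  ∀ e e' : Edge T, Above e e' → L e < L e'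

/-- The edge `e` has a circle: it has no dot, and it has no incoming arrow or is one of
`s 0, …, s (p - 1)` for a sequence `s 0 ← s 1 ← ⋯ ← s (p - 1) ← s p` of edges with arrows in which
the labels of `s 0, …, s (p - 1)` are larger than that of `s p`. -/
def Circled {T : PlaneTree} (L : Labelling T) (e : Edge T) : Prop :=
  ¬ Dotted e ∧
    (¬ HasIncoming e ∨
      ∃ (p : ℕ) (s : ℕ → Edge T), (∀ i < p, Arrow (s i) (s (i + 1))) ∧
        (∀ i < p, L (s p) < L (s i)) ∧ ∃ i < p, s i = e)

open scoped Classical in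
/-- The number of pairs `(e, e')` such that `e'` is strictly right to `e` and has a smaller
label. -/
noncomputable def deg7 {T : PlaneTree} (L : Labelling T) : ℕ :=
  ∑ e : Edge T, (Finset.univ.filter fun e' : Edge T => L e' < L e ∧ StrictlyRight e e').card

open scoped Classical in
/-- The set of natural labellings. -/
noncomputable def naturalLabellings (T : PlaneTree) : Finset (Labelling T) :=
  Finset.univ.filter IsNatural

open scoped Classical in
/-- The set `A(T)`. -/
noncomputable def setA (T : PlaneTree) : Finset (Edge T) := Finset.univ.filter InA

open scoped Classical in
/-- The set `B(T)`. -/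
noncomputable def setB (T : PlaneTree) : Finset (Edge T) := Finset.univ.filter InB

open scoped Classical in
/-- The set of edges with a circle. -/
noncomputable def circledEdges {T : PlaneTree} (L : Labelling T) : Finset (Edge T) :=
  Finset.univ.filter (Circled L)

end BallotBI

namespace BallotBI

/-! ### Operators on sequences -/

section Operators

variable {R : Type*} [CommRing R] (q : R)

/-- The `q`-integer `1 + q + ⋯ + q ^ (n - 1)`. -/
def qInt (n : ℕ) : R := ∑ i ∈ Finset.range n, q ^ i

@[simp] theorem qInt_zero : qInt q 0 = 0 := by simp [qInt]

@[simp] theorem qInt_one : qInt q 1 = 1 := by simp [qInt]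

theorem pow_eq_qInt (n : ℕ) : q ^ n = 1 + (q - 1) * qInt q n := by
  have := mul_geom_sum q n
  rw [qInt, this]; ring

theorem qInt_add (m n : ℕ) : qInt q (m + n) = qInt q m + q ^ m * qInt q n := by
  simp [qInt, Finset.sum_range_add, pow_add, Finset.mul_sum]

theorem qInt_succ (n : ℕ) : qInt q (n + 1) = 1 + q * qInt q n := by
  rw [add_comm, qInt_add]; simp

/-- The `q`-factorial. -/
def qFact (n : ℕ) : R := ∏ i ∈ Finset.range n, qInt q (i + 1)

theorem qFact_succ (n : ℕ) : qFact q (n + 1) = qFact q n * qInt q (n + 1) := by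
  simp [qFact, Finset.prod_range_succ]

/-- The shift of a sequence to the right. -/
def opB : Module.End R (ℕ → R) where
  toFun g a := Nat.casesOn a 0 g
  map_add' f g := by ext a; cases a <;> simp
  map_smul' c g := by ext a; cases a <;> simp

/-- The shift of a sequence to the left. -/
def opT : Module.End R (ℕ → R) where
  toFun g a := g (a + 1)
  map_add' _ _ := rfl
  map_smul' _ _ := rfl

/-- Multiplication by a sequence. -/
def opM (c : ℕ → R) : Module.End R (ℕ → R) where
  toFun g a := c a * g a
  map_add' f g := by ext a; simp [mul_add]
  map_smul' c g := by ext a; simp; ring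

/-- The transfer operator of an up step. -/
def opU : Module.End R (ℕ → R) := (1 + opB) * opM (fun a => q ^ a)

/-- The transfer operator of a down step. -/
def opD : Module.End R (ℕ → R) := (1 + opT) * opM (fun a => q ^ a)

/-- The transfer operator of a single edge. -/
def opF : Module.End R (ℕ → R) :=
  (1 + opB) * opM (fun a => q ^ a * qInt q (a + 1)) * (1 + q • opT)

@[simp] theorem opB_zero (g : ℕ → R) : opB g 0 = 0 := rfl
@[simp] theorem opB_succ (g : ℕ → R) (a : ℕ) : opB g (a + 1) = g a := rfl
@[simp] theorem opT_apply (g : ℕ → R) (a : ℕ) : opT g a = g (a + 1) := rfl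

@[simp] theorem opU_zero (g : ℕ → R) : opU q g 0 = g 0 := by
  simp [opU, opM]

@[simp] theorem opU_succ (g : ℕ → R) (a : ℕ) :
    opU q g (a + 1) = q ^ (a + 1) * g (a + 1) + q ^ a * g a := by
  simp [opU, opM]

@[simp] theorem opD_apply (g : ℕ → R) (a : ℕ) :
    opD q g a = q ^ a * g a + q ^ (a + 1) * g (a + 1) := by
  simp [opD, opM]

@[simp] theorem opF_zero (g : ℕ → R) : opF q g 0 = g 0 + q * g 1 := by
  simp [opF, opM]

@[simp] theorem opF_succ (g : ℕ → R) (a : ℕ) :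
    opF q g (a + 1) = q ^ (a + 1) * qInt q (a + 2) * (g (a + 1) + q * g (a + 2)) +
      q ^ a * qInt q (a + 1) * (g a + q * g (a + 1)) := by
  simp [opF, opM]

theorem opF_mul_opU : opF q * opU q = q • (opU q * opF q) + opU q * opU q := by
  ext g a
  rcases a with _ | _ | a
  · simp; ring
  · simp [qInt_succ]; ring
  · simp only [Module.End.mul_apply, LinearMap.add_apply, LinearMap.smul_apply, opF_succ, opU_succ,
      Pi.add_apply, Pi.smul_apply, smul_eq_mul, pow_succ, qInt_succ, pow_eq_qInt q a]
    ring

theorem opF_mul_opB : opF q * opB = q • (opB * opF q) + q • (opU q * opU q) := by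
  ext g a
  rcases a with _ | _ | _ | a
  · simp
  · simp [qInt_succ]; ring
  · simp [qInt_succ]; ring
  · simp only [Module.End.mul_apply, LinearMap.add_apply, LinearMap.smul_apply, opF_succ, opU_succ,
      opB_succ, Pi.add_apply, Pi.smul_apply, smul_eq_mul, pow_succ, qInt_succ, pow_eq_qInt q a]
    ring

theorem opF_sub : opF q - q • (opB * opF q * opT) = opU q * opD q := by
  ext g a
  rcases a with _ | _ | a
  · simp
  · simp [qInt_succ]; ring
  · simp only [Module.End.mul_apply, LinearMap.sub_apply, LinearMap.smul_apply, opF_succ, opU_succ,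
      opB_succ, opT_apply, opD_apply, Pi.sub_apply, Pi.smul_apply, smul_eq_mul, pow_succ, qInt_succ,
      pow_eq_qInt q a]
    ring

theorem opF_sub_opU_mul : (opF q - opU q) * (opD q - q • (opU q * opT)) = 0 := by
  ext g a
  rcases a with _ | _ | _ | a
  · simp; ring
  · simp [qInt_succ]; ring
  · simp [qInt_succ]; ring
  · simp only [Module.End.mul_apply, LinearMap.sub_apply, LinearMap.smul_apply, opF_succ, opU_succ,
      opT_apply, opD_apply, Pi.sub_apply, Pi.smul_apply, smul_eq_mul, pow_succ, qInt_succ,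
      pow_eq_qInt q a, LinearMap.zero_apply, Pi.zero_apply]
    ring

theorem opF_mul_opU_mul (X : Module.End R (ℕ → R)) :
    opF q * (opU q * X) = q • (opU q * (opF q * X)) + opU q * (opU q * X) := by
  rw [← mul_assoc, opF_mul_opU, add_mul, smul_mul_assoc, mul_assoc, mul_assoc]

theorem opF_mul_opB_mul (X : Module.End R (ℕ → R)) :
    opF q * (opB * X) = q • (opB * (opF q * X)) + q • (opU q * (opU q * X)) := by
  rw [← mul_assoc, opF_mul_opB, add_mul, smul_mul_assoc, smul_mul_assoc, mul_assoc, mul_assoc]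

theorem pow_opF_mul_opD (n : ℕ) :
    opF q ^ (n + 1) * opD q = qInt q (n + 1) • (opU q * (opF q ^ n * opD q)) +
      q ^ (n + 2) • (opU q * (opF q ^ (n + 1) * opT)) := by
  induction n with
  | zero =>
    have h := opF_sub_opU_mul q
    rw [mul_sub, sub_mul, sub_mul, mul_smul_comm, mul_smul_comm, opF_mul_opU_mul] at h
    simp only [zero_add, pow_one, qInt_one, one_smul, pow_zero, one_mul]
    rw [← sub_eq_zero, ← h]
    module
  | succ n ih =>
    have e3 : opU q * (opF q ^ (n + 1) * opD q) =
        qInt q (n + 1) • (opU q * (opU q * (opF q ^ n * opD q))) +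
          q ^ (n + 2) • (opU q * (opU q * (opF q ^ (n + 1) * opT))) := by
      rw [ih, mul_add, mul_smul_comm, mul_smul_comm]
    have e4 : ∀ k : ℕ, ∀ X, opF q * (opF q ^ k * X) = opF q ^ (k + 1) * X := fun k X => by
      rw [pow_succ', mul_assoc]
    have e5 := congrArg (fun X => opF q * X) ih
    simp only [mul_add, mul_smul_comm, opF_mul_opU_mul, e4] at e5
    rw [qInt_succ q (n + 1), add_smul, one_smul]
    linear_combination (norm := module) e5 - e3

theorem pow_opF_mul_opU (n : ℕ) :
    opF q ^ (n + 1) * opU q = q ^ (n + 1) • (opU q * opF q ^ (n + 1)) +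
      qInt q (n + 1) • (opU q * (opF q ^ n * opU q)) := by
  induction n with
  | zero => simp [opF_mul_opU]
  | succ n ih =>
    have e4 : ∀ k : ℕ, ∀ X, opF q * (opF q ^ k * X) = opF q ^ (k + 1) * X := fun k X => by
      rw [pow_succ', mul_assoc]
    have e3 : opU q * (opF q ^ (n + 1) * opU q) = q ^ (n + 1) • (opU q * (opU q * opF q ^ (n + 1))) +
        qInt q (n + 1) • (opU q * (opU q * (opF q ^ n * opU q))) := by
      rw [ih, mul_add, mul_smul_comm, mul_smul_comm]
    have e5 := congrArg (fun X => opF q * X) ih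
    simp only [mul_add, mul_smul_comm, opF_mul_opU_mul, e4, ← pow_succ'] at e5
    rw [qInt_succ q (n + 1), add_smul, one_smul]
    linear_combination (norm := module) e5 - e3

theorem pow_opF_mul_opB (n : ℕ) :
    opF q ^ (n + 1) * opB = q ^ (n + 1) • (opB * opF q ^ (n + 1)) +
      (q * qInt q (n + 1)) • (opU q * (opF q ^ n * opU q)) := by
  induction n with
  | zero => simp [opF_mul_opB]
  | succ n ih =>
    have e4 : ∀ k : ℕ, ∀ X, opF q * (opF q ^ k * X) = opF q ^ (k + 1) * X := fun k X => by
      rw [pow_succ', mul_assoc]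
    have e3 : opU q * (opF q ^ (n + 1) * opU q) = q ^ (n + 1) • (opU q * (opU q * opF q ^ (n + 1))) +
        qInt q (n + 1) • (opU q * (opU q * (opF q ^ n * opU q))) := by
      rw [pow_opF_mul_opU, mul_add, mul_smul_comm, mul_smul_comm]
    rw [pow_succ', mul_assoc, ih, mul_add, mul_smul_comm, mul_smul_comm, opF_mul_opU_mul,
      opF_mul_opB_mul, e4, qInt_succ q (n + 1), ← pow_succ', mul_add q, mul_one, add_smul]
    linear_combination (norm := module) -q • e3

theorem pow_opF_sub (n : ℕ) :
    opF q ^ (n + 1) - q ^ (n + 1) • (opB * (opF q ^ (n + 1) * opT)) =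
      qInt q (n + 1) • (opU q * (opF q ^ n * opD q)) := by
  induction n with
  | zero => simpa [mul_assoc] using opF_sub q
  | succ n ih =>
    have e4 : ∀ k : ℕ, ∀ X, opF q * (opF q ^ k * X) = opF q ^ (k + 1) * X := fun k X => by
      rw [pow_succ', mul_assoc]
    have e5 := congrArg (fun X => opF q * X) ih
    have e3 := congrArg (fun X => opU q * X) (pow_opF_mul_opD q n)
    simp only [mul_sub, mul_add, mul_smul_comm, opF_mul_opU_mul, opF_mul_opB_mul, e4,
      ← pow_succ'] at e5 e3
    rw [qInt_succ q (n + 1), add_smul, one_smul]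
    linear_combination (norm := module) e5 - e3

/-! ### The sequences of the base suffixes -/

/-- `evenOdd q n` is the pair of sequences attached to suffixes with `n` edges and an even number of
unpaired up steps, and with `n + 1` edges and an odd number of them. -/
def oddAux (c : R) (g : ℕ → R) : ℕ → R
  | 0 => g 0
  | 1 => g 1
  | a + 2 => g (a + 2) + c * oddAux c g a

/-- The sequence attached to suffixes with `n` edges and an even number of unpaired up steps. -/
def seqEven : ℕ → ℕ → R
  | 0 => 1
  | n + 1 => opU q (oddAux (q ^ (2 * n)) (opU q (seqEven n)))

/-- The sequence attached to suffixes with `n + 1` edges and an odd number of unpaired up steps. -/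
def seqOdd (n : ℕ) : ℕ → R := oddAux (q ^ (2 * n)) (opU q (seqEven q n))

theorem seqEven_succ (n : ℕ) : seqEven q (n + 1) = opU q (seqOdd q n) := rfl

theorem eq_oddAux {c : R} {g f : ℕ → R} (h : f - c • opB (opB f) = g) : f = oddAux c g := by
  funext a
  induction a using Nat.twoStepInduction with
  | zero => rw [oddAux, ← h]; simp
  | one => rw [oddAux, ← h]; simp
  | more a h1 _ => rw [oddAux, ← h1, ← h]; simp

theorem oddAux_sub (c : R) (g : ℕ → R) : oddAux c g - c • opB (opB (oddAux c g)) = g := by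
  funext a
  rcases a with _ | _ | a <;> simp [oddAux]

theorem oddAux_smul (c r : R) (g : ℕ → R) : oddAux c (r • g) = r • oddAux c g := by
  refine (eq_oddAux ?_).symm
  conv_rhs => rw [← oddAux_sub c g]
  simp only [map_smul]
  module

theorem seqOdd_sub (n : ℕ) :
    seqOdd q n - q ^ (2 * n) • opB (opB (seqOdd q n)) = opU q (seqEven q n) := oddAux_sub _ _

@[simp] theorem seqOdd_apply_zero (n : ℕ) : seqOdd q n 0 = seqEven q n 0 := by
  simp [seqOdd, oddAux]

@[simp] theorem seqEven_apply_zero (n : ℕ) : seqEven q n 0 = 1 := by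
  induction n with
  | zero => rfl
  | succ n ih => simp [seqEven_succ, ih]

theorem qInt_smul_oddAux {n : ℕ} {f : ℕ → R}
    (h1 : ∀ a, qInt q (a + 2) * f (a + 2) =
      q ^ (a + 1) * qInt q (2 * n + 1) * f (a + 1) + q ^ (2 * n) * qInt q (a + 1) * f a)
    (h2 : f 1 = qInt q (2 * n + 1) * f 0) :
    qInt q (2 * n + 2) • oddAux (q ^ (2 * n)) (opU q f) =
      fun a => qInt q (a + 1) * (f a + q * f (a + 1)) := by
  rw [← oddAux_smul]
  refine (eq_oddAux ?_).symm
  funext a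
  rcases a with _ | _ | a
  · simp [h2, qInt_succ, mul_add]; ring
  · have := h1 0
    simp at this
    simp [h2, mul_add, qInt_succ, pow_eq_qInt q (2 * n)] at this ⊢
    linear_combination q * this
  · have e1 := h1 a
    have e2 := h1 (a + 1)
    simp only [Pi.sub_apply, Pi.smul_apply, smul_eq_mul, opU_succ, opB_succ]
    simp only [qInt_succ, pow_succ, pow_eq_qInt q a, pow_eq_qInt q (2 * n)] at e1 e2 ⊢
    linear_combination q * e2 + e1

theorem seqOdd_rec_aux {n : ℕ} (h : ∀ a, qInt q (2 * n + 2) * seqOdd q n a =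
      qInt q (a + 1) * (seqEven q n a + q * seqEven q n (a + 1))) (a : ℕ) :
    qInt q (a + 2) * seqOdd q n (a + 2) = q ^ (a + 1) * qInt q (2 * n + 2) * seqOdd q n (a + 1) +
      q ^ (2 * n) * qInt q (a + 2) * seqOdd q n a := by
  have e1 := congrFun (seqOdd_sub q n) (a + 2)
  have e2 := h (a + 1)
  simp only [Pi.sub_apply, Pi.smul_apply, smul_eq_mul, opU_succ, opB_succ] at e1
  linear_combination qInt q (a + 2) * e1 - q ^ (a + 1) * e2

theorem seqOdd_apply_one {n : ℕ} (h : seqEven q n 1 = qInt q (2 * n + 1)) :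
    seqOdd q n 1 = qInt q (2 * n + 2) := by
  have e1 := congrFun (seqOdd_sub q n) 1
  simp [h] at e1
  simp [e1, qInt_succ]; ring

theorem seqEven_rec (n : ℕ) :
    (∀ a, qInt q (a + 2) * seqEven q n (a + 2) =
      q ^ (a + 1) * qInt q (2 * n + 1) * seqEven q n (a + 1) +
        q ^ (2 * n) * qInt q (a + 1) * seqEven q n a) ∧
    seqEven q n 1 = qInt q (2 * n + 1) := by
  induction n with
  | zero => simp [seqEven, qInt_succ, pow_eq_qInt]; intro a; ring
  | succ n ih =>
    obtain ⟨h1, h2⟩ := ih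
    have h3 := seqOdd_rec_aux q (fun a => congrFun (qInt_smul_oddAux q h1 (by simp [h2])) a)
    have h4 := seqOdd_apply_one q h2
    rw [seqEven_succ]
    constructor
    · intro a
      have e1 := h3 a
      rcases a with _ | a
      · simp only [zero_add, pow_zero, opU_zero, opU_succ, one_mul, mul_one,
          h4, seqOdd_apply_zero, seqEven_apply_zero, mul_add 2, qInt_succ, pow_succ,
          pow_eq_qInt q (2 * n), pow_add q, qInt_zero, mul_zero, add_zero] at e1 ⊢
        linear_combination q ^ 2 * e1
      · have e2 := h3 a
        simp only [opU_succ, mul_add 2, mul_one, qInt_succ, pow_succ, pow_eq_qInt q a,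
          pow_eq_qInt q (2 * n), pow_add q] at e1 e2 ⊢
        linear_combination (1 + (q - 1) * qInt q a) * q ^ 2 * (q * e1 + e2)
    · simp [h4, mul_add, qInt_succ]; ring

theorem qInt_mul_seqOdd (n a : ℕ) : qInt q (2 * n + 2) * seqOdd q n a =
    qInt q (a + 1) * (seqEven q n a + q * seqEven q n (a + 1)) :=
  congrFun (qInt_smul_oddAux q (seqEven_rec q n).1 (by simp [seqEven_rec])) a

theorem seqOdd_rec (n a : ℕ) :
    qInt q (a + 2) * seqOdd q n (a + 2) = q ^ (a + 1) * qInt q (2 * n + 2) * seqOdd q n (a + 1) +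
      q ^ (2 * n) * qInt q (a + 2) * seqOdd q n a :=
  seqOdd_rec_aux q (qInt_mul_seqOdd q n) a

theorem opF_seqEven (n : ℕ) :
    opF q (seqEven q n) = qInt q (2 * n + 2) • seqEven q (n + 1) := by
  have h := qInt_mul_seqOdd q n
  funext a
  rw [seqEven_succ]
  rcases a with _ | a
  · have := h 0
    simp at this
    simp [this]
  · simp only [opF_succ, Pi.smul_apply, smul_eq_mul, opU_succ]
    linear_combination - q ^ (a + 1) * h (a + 1) - q ^ a * h a

theorem opF_seqOdd [NoZeroDivisors R] (hq : ∀ n, qInt q (n + 1) ≠ 0) (n : ℕ) :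
    opF q (seqOdd q n) = qInt q (2 * n + 3) • seqOdd q (n + 1) +
      q ^ (2 * n + 2) • opB (seqOdd q (n + 1)) := by
  have key : qInt q (2 * n + 4) • opF q (seqOdd q n) = qInt q (2 * n + 4) •
      (qInt q (2 * n + 3) • seqOdd q (n + 1) + q ^ (2 * n + 2) • opB (seqOdd q (n + 1))) := by
    have h := qInt_mul_seqOdd q (n + 1)
    have h1 : seqOdd q n 1 = qInt q (2 * n + 2) := seqOdd_apply_one q (seqEven_rec q n).2
    have h3 := seqOdd_rec q n
    simp only [seqEven_succ, opU_succ] at h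
    funext a
    rcases a with _ | _ | a
    · simp only [opF_zero, Pi.smul_apply, Pi.add_apply, smul_eq_mul, opB_zero, h1,
        seqOdd_apply_zero, seqEven_apply_zero, qInt_succ]
      ring
    · have e0 := h 0
      have e1 := h 1
      have e2 := h3 0
      simp only [zero_add, pow_zero, opU_zero, opU_succ, opF_succ, opB_succ,
        one_mul, mul_one, h1, seqOdd_apply_zero, seqEven_apply_zero, mul_add 2, qInt_succ, pow_succ,
        pow_eq_qInt q (2 * n), pow_add q, qInt_zero, mul_zero, add_zero, Pi.smul_apply,
        Pi.add_apply, smul_eq_mul] at e0 e1 e2 ⊢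
      linear_combination q ^ 2 * e2 - (1 + q * (1 + q * (1 + q * qInt q (2 * n)))) * e1
        - (1 + (q - 1) * qInt q (2 * n)) * q ^ 2 * e0
    · have e0 := h (a + 1)
      have e1 := h (a + 2)
      have e2 := h3 (a + 1)
      have e3 := h3 a
      simp only [opU_succ, opF_succ, opB_succ, mul_add 2, mul_one, qInt_succ, pow_succ,
        pow_eq_qInt q (2 * n), pow_add q, pow_eq_qInt q a, Pi.smul_apply,
        Pi.add_apply, smul_eq_mul] at e0 e1 e2 e3 ⊢
      linear_combination (1 + (q - 1) * qInt q a) * q ^ 2 * (q * e2 + e3) -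
        (1 + q * (1 + q * (1 + q * qInt q (2 * n)))) * e1
        - (1 + (q - 1) * qInt q (2 * n)) * q ^ 2 * e0
  funext a
  exact mul_left_cancel₀ (hq _) (congrFun key a)

/-- `∏_{i = n + 1}^{n + s} [2 i]`. -/
def qDouble (n s : ℕ) : R := ∏ i ∈ Finset.range s, qInt q (2 * (n + i) + 2)

theorem qDouble_succ (n s : ℕ) :
    qDouble q n (s + 1) = qDouble q n s * qInt q (2 * (n + s) + 2) := Finset.prod_range_succ _ _

theorem pow_opF_seqEven (n s : ℕ) :
    (opF q ^ s) (seqEven q n) = qDouble q n s • seqEven q (n + s) := by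
  induction s with
  | zero => simp [qDouble]
  | succ s ih =>
    rw [pow_succ', Module.End.mul_apply, ih, map_smul, opF_seqEven, smul_smul, qDouble_succ,
      add_assoc]

theorem opF_opB_seqOdd [NoZeroDivisors R] (hq : ∀ n, qInt q (n + 1) ≠ 0) (n : ℕ) :
    opF q (opB (seqOdd q n)) = (q * qInt q (2 * n + 3)) • opB (seqOdd q (n + 1)) +
      q • seqOdd q (n + 1) := by
  have h1 := LinearMap.congr_fun (opF_mul_opB q) (seqOdd q n)
  simp only [Module.End.mul_apply, LinearMap.add_apply, LinearMap.smul_apply, ← seqEven_succ,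
    opF_seqOdd q hq, map_add, map_smul, ← seqOdd_sub] at h1
  rw [h1, mul_add 2, mul_one]
  module

theorem pow_opF_seqOdd [NoZeroDivisors R] (hq : ∀ n, qInt q (n + 1) ≠ 0) (n s : ℕ) :
    (opF q ^ (s + 1)) (seqOdd q n) =
      (qInt q (2 * n + s + 3) * qDouble q (n + 1) s) • seqOdd q (n + s + 1) +
      (q ^ (2 * n + s + 2) * qInt q (s + 1) * qDouble q (n + 1) s) • opB (seqOdd q (n + s + 1)) := by
  induction s with
  | zero => simp [opF_seqOdd q hq, qDouble]
  | succ s ih =>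
    rw [pow_succ', Module.End.mul_apply, ih, map_add, map_smul, map_smul, opF_seqOdd q hq,
      opF_opB_seqOdd q hq, qDouble_succ]
    have h2 : qInt q 2 = 1 + q := by simp [qInt_succ]
    have h3 : qInt q 3 = 1 + q * (1 + q) := by simp [qInt_succ]
    have e1 : qInt q (2 * n + s + 3) * qInt q (2 * (n + s + 1) + 3) +
        q ^ (2 * n + s + 3) * qInt q (s + 1) =
        qInt q (2 * n + (s + 1) + 3) * qInt q (2 * (n + 1 + s) + 2) := by
      simp only [two_mul, qInt_add, pow_add, pow_eq_qInt q n, pow_eq_qInt q s, h2, h3, qInt_one]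
      ring
    have e2 : q ^ (2 * (n + s + 1) + 2) * qInt q (2 * n + s + 3) + 
        q ^ (2 * n + s + 3) * qInt q (s + 1) * qInt q (2 * (n + s + 1) + 3) =
        q ^ (2 * n + s + 3) * qInt q (s + 2) * qInt q (2 * (n + 1 + s) + 2) := by
      simp only [two_mul, qInt_add, pow_add, pow_eq_qInt q n, pow_eq_qInt q s, h2, h3, qInt_one]
      ring
    rw [show n + (s + 1) + 1 = n + s + 1 + 1 by ring]
    linear_combination (norm := module) (qDouble q (n + 1) s * e1) • seqOdd q (n + s + 1 + 1) +
      (qDouble q (n + 1) s * e2) • opB (seqOdd q (n + s + 1 + 1))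

theorem pow_opF_seqOdd_sub [NoZeroDivisors R] (hq : ∀ n, qInt q (n + 1) ≠ 0) (n s : ℕ) :
    (opF q ^ (s + 1)) (seqOdd q n) -
        q ^ (2 * n + (s + 1)) • opB ((opF q ^ (s + 1)) (opB (seqOdd q n))) =
      (qInt q (2 * n + s + 3) * qDouble q (n + 1) s) •
        (seqOdd q (n + s + 1) - q ^ (2 * (n + s + 1)) • opB (opB (seqOdd q (n + s + 1)))) := by
  have h := LinearMap.congr_fun (pow_opF_mul_opB q s) (seqOdd q n)
  simp only [Module.End.mul_apply, LinearMap.add_apply, LinearMap.smul_apply, ← seqEven_succ,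
    pow_opF_seqEven, map_smul, ← seqOdd_sub] at h
  rw [h, pow_opF_seqOdd q hq, show n + 1 + s = n + s + 1 by ring]
  simp only [map_add, map_sub, map_smul]
  have e1 : (q ^ (2 * n + s + 2) * qInt q (s + 1) * qDouble q (n + 1) s) =
    q ^ (2 * n + (s + 1)) * (q * qInt q (s + 1)) * qDouble q (n + 1) s := by ring
  rw [e1]
  module

end Operators

end BallotBI

namespace BallotBI

open DyckStep

/-! ### Decomposition of ballot words along their trees -/

namespace PlaneTree

/-- The number of edges. -/
def size : PlaneTree → ℕ
  | nil => 0
  | node _ _ c r => size c + 1 + size r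

/-- There are no dots and no arrows. -/
def IsPlain : PlaneTree → Prop
  | nil => True
  | node d a c r => d = false ∧ a = false ∧ IsPlain c ∧ IsPlain r

/-- The Dyck word of a plane tree. -/
def word : PlaneTree → List DyckStep
  | nil => []
  | node _ _ c r => U :: (word c ++ D :: word r)

end PlaneTree

open PlaneTree

theorem height_zero (w : List DyckStep) : height w 0 = 0 := by simp [height]

theorem height_cons_U (w : List DyckStep) (x : ℕ) : height (U :: w) (x + 1) = 1 + height w x := by
  simp [height]; ring

theorem height_cons_D (w : List DyckStep) (x : ℕ) : height (D :: w) (x + 1) = -1 + height w x := by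
  simp [height]; ring

theorem height_append (v w : List DyckStep) (x : ℕ) :
    height (v ++ w) (v.length + x) = height v v.length + height w x := by
  simp [height, List.take_append, List.take_of_length_le]; ring

theorem height_append_left {v w : List DyckStep} {x : ℕ} (hx : x ≤ v.length) :
    height (v ++ w) x = height v x := by
  simp [height, List.take_append_of_le_length hx]

theorem count_word (T : PlaneTree) : (word T).count U = T.size ∧ (word T).count D = T.size := by
  induction T with
  | nil => simp [word, size]
  | node d a c r hc hr => simp [word, size, hc, hr]; omega

theorem height_word (T : PlaneTree) : height (word T) (word T).length = 0 := by
  simp [height, count_word]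

theorem height_word_nonneg (T : PlaneTree) (x : ℕ) : 0 ≤ height (word T) x := by
  induction T generalizing x with
  | nil => simp [word, height]
  | node d a c r hc hr =>
    rcases x with _ | x
    · simp [height_zero]
    rw [word, height_cons_U]
    rcases le_total x (word c).length with h | h
    · rw [height_append_left h]; linarith [hc x]
    · obtain ⟨y, rfl⟩ := Nat.exists_eq_add_of_le h
      rw [height_append, height_word]
      rcases y with _ | y
      · simp [height_zero]
      · rw [height_cons_D]; linarith [hr y]

/-- The words without unmatched down steps, their number of unpaired up steps, and their trees. -/
inductive BaseWord : List DyckStep → ℕ → PlaneTree → Prop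
  | nil : BaseWord [] 0 .nil
  | edge {w k c r} : IsPlain c → BaseWord w k r →
      BaseWord (U :: (word c ++ D :: w)) k (.node false (decide (Odd k)) c r)
  | dot {w k r} : Even k → BaseWord w k r → BaseWord (U :: w) (k + 1) (.node true false r .nil)
  | up {w k r} : Odd k → BaseWord w k r → BaseWord (U :: w) (k + 1) r

/-- The word `y_0 D y_1 D ⋯ y_{m-1} D w` for the trees of the Dyck words `y_i`. -/
def unparse : List PlaneTree → List DyckStep → List DyckStep
  | [], w => w
  | F :: l, w => word F ++ D :: unparse l w

theorem exists_baseWord (w : List DyckStep) :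
    ∃ w', BaseWord w' (parse w).unpaired (parse w).base ∧ w = unparse (parse w).pending w' ∧
      ∀ F ∈ (parse w).pending, IsPlain F := by
  induction w with
  | nil => exact ⟨[], .nil, rfl, by simp [parse]⟩
  | cons s w ih =>
    obtain ⟨w', h1, h2, h3⟩ := ih
    cases s with
    | D =>
      refine ⟨w', h1, ?_, ?_⟩
      · simp only [parse, unparse, word, List.nil_append]; rw [← h2]
      · simp only [parse, List.mem_cons]
        rintro F (rfl | hF)
        · trivial
        · exact h3 F hF
    | U =>
      rw [parse]
      split
      · rename_i he
        rw [he] at h2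
        simp only [unparse] at h2
        split_ifs with hk
        · exact ⟨U :: w', .dot hk h1, by simp [unparse, h2], by simp⟩
        · exact ⟨U :: w', .up (Nat.not_even_iff_odd.1 hk) h1, by simp [unparse, h2], by simp⟩
      · rename_i F he
        rw [he] at h2 h3
        simp only [unparse] at h2
        exact ⟨U :: (word F ++ D :: w'), .edge (h3 F (by simp)) h1, by simp [unparse, ← h2], by simp⟩
      · rename_i F G l he
        rw [he] at h2 h3
        simp only [unparse] at h2
        refine ⟨w', h1, by simp [unparse, word, ← h2], ?_⟩
        simp only [List.mem_cons] at h3 ⊢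
        rintro H (rfl | hH)
        · exact ⟨rfl, rfl, h3 _ (by simp), h3 _ (by simp)⟩
        · exact h3 H (by simp [hH])

theorem pending_eq_nil {w : List DyckStep} (hw : IsBallot w) : (parse w).pending = [] := by
  obtain ⟨w', h1, h2, h3⟩ := exists_baseWord w
  rcases hp : (parse w).pending with _ | ⟨F, l⟩
  · rfl
  · rw [hp, unparse] at h2
    have := hw ((word F).length + 1)
    rw [h2, height_append, height_word, height_cons_D, height_zero] at this
    omega

theorem baseWord_of_isBallot {w : List DyckStep} (hw : IsBallot w) :
    BaseWord w (parse w).unpaired (tree w) := by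
  obtain ⟨w', h1, h2, -⟩ := exists_baseWord w
  rw [pending_eq_nil hw, unparse] at h2
  rw [tree]
  exact h2 ▸ h1

theorem parse_word_append (T : PlaneTree) (w : List DyckStep) :
    (parse (word T ++ D :: w)).pending ≠ [] ∧
      (parse (word T ++ D :: w)).pending.tail = (parse w).pending ∧
      (parse (word T ++ D :: w)).unpaired = (parse w).unpaired := by
  induction T generalizing w with
  | nil => simp [word, parse]
  | node d a c r hc hr =>
    obtain ⟨r1, r2, r3⟩ := hr w
    obtain ⟨c1, c2, c3⟩ := hc (word r ++ D :: w)
    rw [word, List.cons_append, List.append_assoc, List.cons_append, parse]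
    obtain ⟨G, l, hG⟩ := List.exists_cons_of_ne_nil r1
    obtain ⟨F, l', hF⟩ := List.exists_cons_of_ne_nil c1
    rw [hF] at c2 ⊢
    rw [List.tail_cons, hG] at c2
    subst c2
    rw [hG] at r2
    exact ⟨by simp, r2, c3.trans r3⟩

theorem BaseWord.parse_eq {w k T} (h : BaseWord w k T) :
    (parse w).pending = [] ∧ (parse w).unpaired = k := by
  induction h with
  | nil => simp [parse]
  | @edge w k c r _ _ ih =>
    obtain ⟨h1, h2, h3⟩ := parse_word_append c w
    obtain ⟨F, l, hF⟩ := List.exists_cons_of_ne_nil h1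
    rw [parse]
    rw [hF, ih.1, List.tail_cons] at h2
    subst h2
    rw [hF]
    exact ⟨rfl, h3.trans ih.2⟩
  | dot hk _ ih => simp [parse, ih, hk]
  | up hk _ ih => simp [parse, ih, Nat.not_even_iff_odd.2 hk]

theorem BaseWord.count {w k T} (h : BaseWord w k T) : w.count U = w.count D + k := by
  induction h with
  | nil => simp
  | @edge w k c r _ _ ih => simp [count_word, ih]; omega
  | dot _ _ ih => simp [ih]; omega
  | up _ _ ih => simp [ih]; omega

theorem BaseWord.height_nonneg {w k T} (h : BaseWord w k T) (x : ℕ) : 0 ≤ height w x := by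
  induction h generalizing x with
  | nil => simp [height]
  | @edge w k c r _ _ ih =>
    rcases x with _ | x
    · simp [height_zero]
    rw [height_cons_U]
    rcases le_total x (word c).length with h | h
    · rw [height_append_left h]; linarith [height_word_nonneg c x]
    · obtain ⟨y, rfl⟩ := Nat.exists_eq_add_of_le h
      rw [height_append, height_word]
      rcases y with _ | y
      · simp [height_zero]
      · rw [height_cons_D]; linarith [ih y]
  | dot _ _ ih =>
    rcases x with _ | x
    · simp [height_zero]
    · rw [height_cons_U]; linarith [ih x]
  | up _ _ ih =>
    rcases x with _ | x
    · simp [height_zero]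
    · rw [height_cons_U]; linarith [ih x]

/-! ### The transfer sums -/

/-- `1` for an up step which is unpaired and gives an edge with a dot, `0` for other up steps. -/
def dotWeight (w : List DyckStep) : ℕ :=
  if (parse w).pending.length = 0 ∧ Even (parse w).unpaired then 1 else 0

theorem dotWeight_le (w : List DyckStep) : dotWeight w ≤ 1 := by
  unfold dotWeight; split_ifs <;> simp

/-- The condition on the parity of the number of ballot tiles that start after a step with `j`
joined levels and before the suffix `w`, which has `M` joined levels. -/
def Par (w : List DyckStep) (j M : ℕ) : Prop :=
  w.count D < w.count U →
    if Odd (w.count U - w.count D) then Even (M - min j M) else M ≤ j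

instance (w : List DyckStep) (j M : ℕ) : Decidable (Par w j M) := by
  unfold Par; infer_instance

theorem Par.of_le {w : List DyckStep} {j M : ℕ} (h : M ≤ j) : Par w j M := by
  intro _
  split_ifs
  · simp [h]
  · exact h

theorem par_add {w : List DyckStep} {j M c : ℕ} : Par w (j + c) (M + c) ↔ Par w j M := by
  unfold Par
  rw [Nat.add_min_add_right, Nat.add_sub_add_right, Nat.add_le_add_iff_right]

/-- A stack of bounds with a new top entry. -/
def push (j : ℕ) (st : ℕ → ℕ) : ℕ → ℕ
  | 0 => j
  | n + 1 => st n

@[simp] theorem push_zero (j : ℕ) (st : ℕ → ℕ) : push j st 0 = j := rfl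
@[simp] theorem push_succ (j : ℕ) (st : ℕ → ℕ) (n : ℕ) : push j st (n + 1) = st n := rfl

section Transfer

variable {R : Type*} [CommRing R] (q : R)

/-- The effect of a step with `j` joined levels on a function of the number of joined levels. -/
def twist (w : List DyckStep) (j : ℕ) (φ : ℕ → R) (M : ℕ) : R :=
  if Par w j M then φ (min j M) else 0

/-- The weighted sum over the configurations of a suffix that starts at height `a`, where `st` is
the stack of the numbers of joined levels of the preceding unmatched up steps. -/
def transfer : List DyckStep → (ℕ → R) → (ℕ → ℕ) → ℕ → R
  | [], φ, _, a => φ a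
  | U :: w, φ, st, a => ∑ b ∈ Finset.Icc (a - 1) a, ∑ j ∈ Finset.Icc (st 0) b,
      q ^ (b - dotWeight w * j) * transfer w (twist w j φ) (push j st) b
  | D :: w, φ, st, a => if st 0 ≤ a then ∑ b ∈ Finset.Icc a (a + 1),
      q ^ (b - st 0) * transfer w (twist w (st 0) φ) (fun n => st (n + 1)) b else 0

theorem twist_add (w : List DyckStep) (j : ℕ) (φ ψ : ℕ → R) :
    twist w j (φ + ψ) = twist w j φ + twist w j ψ := by
  funext M; simp only [twist, Pi.add_apply]; split_ifs <;> simp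

theorem twist_smul (w : List DyckStep) (j : ℕ) (c : R) (φ : ℕ → R) :
    twist w j (c • φ) = c • twist w j φ := by
  funext M; simp only [twist, Pi.smul_apply]; split_ifs <;> simp

theorem transfer_add (w : List DyckStep) (φ ψ : ℕ → R) (st : ℕ → ℕ) (a : ℕ) :
    transfer q w (φ + ψ) st a = transfer q w φ st a + transfer q w ψ st a := by
  induction w generalizing φ ψ st a with
  | nil => rfl
  | cons s w ih =>
    cases s <;> simp only [transfer, twist_add, ih, mul_add, Finset.sum_add_distrib]
    split_ifs <;> simp

theorem transfer_smul (w : List DyckStep) (c : R) (φ : ℕ → R) (st : ℕ → ℕ) (a : ℕ) :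
    transfer q w (c • φ) st a = c * transfer q w φ st a := by
  induction w generalizing φ st a with
  | nil => rfl
  | cons s w ih =>
    cases s <;> simp only [transfer, twist_smul, ih, Finset.mul_sum, mul_left_comm c, mul_ite,
      mul_zero]

theorem transfer_zero (w : List DyckStep) (st : ℕ → ℕ) (a : ℕ) :
    transfer q w (0 : ℕ → R) st a = 0 := by
  have := transfer_smul q w 0 (0 : ℕ → R) st a
  simpa using this

/-- The number of steps that do not carry a weight. -/
def slack : List DyckStep → ℕ
  | [] => 0
  | U :: w => slack w + (1 - dotWeight w)
  | D :: w => slack w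

theorem sum_Icc_pred_add {f : ℕ → R} {a c : ℕ} (hf : ∀ b < c, f b = 0) :
    ∑ b ∈ Finset.Icc (a + c - 1) (a + c), f b = ∑ b ∈ Finset.Icc (a - 1) a, f (b + c) := by
  have h1 : Finset.Icc (a - 1 + c) (a + c) = (Finset.Icc (a - 1) a).map (addRightEmbedding c) :=
    (Finset.map_add_right_Icc _ _ _).symm
  have h2 : ∑ b ∈ Finset.Icc (a - 1 + c) (a + c), f b = ∑ b ∈ Finset.Icc (a - 1) a, f (b + c) := by
    rw [h1, Finset.sum_map]; rfl
  rw [← h2]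
  refine (Finset.sum_subset (Finset.Icc_subset_Icc_left (by omega)) ?_).symm
  intro b hb hb'
  rw [Finset.mem_Icc] at hb hb'
  exact hf b (by omega)

theorem sum_Icc_add (f : ℕ → R) (a b c : ℕ) :
    ∑ i ∈ Finset.Icc (a + c) (b + c), f i = ∑ i ∈ Finset.Icc a b, f (i + c) := by
  rw [← Finset.map_add_right_Icc, Finset.sum_map]; rfl

theorem transfer_shift (w : List DyckStep) (φ : ℕ → R) (st : ℕ → ℕ) (a c : ℕ) :
    transfer q w φ (fun n => st n + c) (a + c) =
      q ^ (slack w * c) * transfer q w (fun M => φ (M + c)) st a := by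
  have ht : ∀ (w : List DyckStep) (j : ℕ) (φ : ℕ → R), (fun M => twist w (j + c) φ (M + c)) =
      twist w j (fun M => φ (M + c)) := by
    intro w j φ
    funext M
    simp only [twist, par_add, Nat.add_min_add_right]
  induction w generalizing φ st a with
  | nil => simp [transfer, slack]
  | cons s w ih =>
    cases s with
    | U =>
      rw [transfer, transfer, sum_Icc_pred_add, Finset.mul_sum]
      · refine Finset.sum_congr rfl fun b _ => ?_
        rw [sum_Icc_add, Finset.mul_sum]
        refine Finset.sum_congr rfl fun j hj => ?_
        have hp : push (j + c) (fun n => st n + c) = fun n => push j st n + c := by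
          funext n; cases n <;> rfl
        rw [hp, ih, ht, slack, ← mul_assoc, ← mul_assoc, ← pow_add, ← pow_add]
        congr 2
        rw [Finset.mem_Icc] at hj
        rcases Nat.le_one_iff_eq_zero_or_eq_one.1 (dotWeight_le w) with h | h <;> rw [h]
        · simp [add_mul]; ring
        · simp; omega
      · intro b hb
        rw [Finset.Icc_eq_empty (by omega), Finset.sum_empty]
    | D =>
      rw [transfer, transfer, show a + c + 1 = a + 1 + c by ring, sum_Icc_add]
      simp only [Nat.add_le_add_iff_right, mul_ite, mul_zero]
      refine if_congr Iff.rfl ?_ rfl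
      rw [Finset.mul_sum]
      refine Finset.sum_congr rfl fun b _ => ?_
      rw [ih _ (fun n => st (n + 1)), ht, slack, Nat.add_sub_add_right, mul_left_comm]

theorem transfer_congr {w : List DyckStep} {φ ψ : ℕ → R} {st : ℕ → ℕ} {r : ℕ}
    (hr : ∃ x, height w x = -(r + 1 : ℤ)) (h : ∀ M ≤ st r, φ M = ψ M) (a : ℕ) :
    transfer q w φ st a = transfer q w ψ st a := by
  induction w generalizing φ ψ st r a with
  | nil => obtain ⟨x, hx⟩ := hr; simp [height] at hx; omega
  | cons s w ih =>
    obtain ⟨x, hx⟩ := hr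
    rcases x with _ | x
    · rw [height_zero] at hx; omega
    cases s with
    | U =>
      rw [height_cons_U] at hx
      rw [transfer, transfer]
      refine Finset.sum_congr rfl fun b _ => Finset.sum_congr rfl fun j _ => ?_
      rw [ih (r := r + 1) ⟨x, by push_cast; linarith⟩]
      intro M hM
      rw [push_succ] at hM
      simp only [twist]
      rw [h _ ((min_le_right _ _).trans hM)]
    | D =>
      rw [height_cons_D] at hx
      rw [transfer, transfer]
      refine if_congr Iff.rfl (Finset.sum_congr rfl fun b _ => ?_) rfl
      rcases r with _ | r
      · congr 2
        funext M
        simp only [twist]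
        rw [h _ (min_le_left _ _)]
      · rw [ih (r := r) ⟨x, by push_cast at hx; linarith⟩]
        intro M hM
        simp only [twist]
        rw [h _ ((min_le_right _ _).trans hM)]

theorem transfer_support {w : List DyckStep} {φ : ℕ → R} {st st' : ℕ → ℕ} {m : ℕ}
    (h : ∀ M < m, φ M = 0)
    (hst : ∀ r, st' r = st r ∨ st' r = m ∧ st r ≤ m ∧ ∀ x, -(r : ℤ) ≤ height w x) (a : ℕ) :
    transfer q w φ st a = transfer q w φ st' a := by
  induction w generalizing φ st st' a with
  | nil => rfl
  | cons s w ih =>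
    have ht : ∀ j, ∀ M < m, twist w j φ M = 0 := by
      intro j M hM
      simp only [twist]
      rw [h _ (by omega), ite_self]
    cases s with
    | U =>
      have key : ∀ j b, transfer q w (twist w j φ) (push j st) b =
          transfer q w (twist w j φ) (push j st') b := by
        intro j b
        refine ih (ht j) (fun r => ?_) b
        rcases r with _ | r
        · exact Or.inl rfl
        · refine (hst r).imp id fun ⟨h1, h2, h3⟩ => ⟨h1, h2, fun x => ?_⟩
          have := h3 (x + 1)
          rw [height_cons_U] at this
          push_cast
          linarith
      rw [transfer, transfer]
      refine Finset.sum_congr rfl fun b _ => ?_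
      simp only [key]
      rcases hst 0 with h0 | ⟨h0, h1, -⟩
      · rw [h0]
      · rw [h0]
        refine (Finset.sum_subset (Finset.Icc_subset_Icc_left h1) ?_).symm
        intro j hj hj'
        rw [Finset.mem_Icc] at hj hj'
        have : twist w j φ = 0 := by
          funext M
          simp only [twist]
          rw [h _ (by omega), ite_self]; rfl
        rw [this, transfer_zero, mul_zero]
    | D =>
      have h0 : st' 0 = st 0 := by
        rcases hst 0 with h0 | ⟨-, -, h0⟩
        · exact h0
        · have := h0 1
          rw [← zero_add 1, height_cons_D, height_zero] at this
          norm_num at this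
      rw [transfer, transfer, h0]
      refine if_congr Iff.rfl (Finset.sum_congr rfl fun b _ => ?_) rfl
      rw [ih (ht _) (fun r => ?_)]
      refine (hst (r + 1)).imp id fun ⟨h1, h2, h3⟩ => ⟨h1, h2, fun x => ?_⟩
      have := h3 (x + 1)
      rw [height_cons_D] at this
      push_cast at this
      linarith

/-- The transfer operator of the Dyck word of a plane tree, with at least `i` joined levels. -/
def treeOp : PlaneTree → ℕ → (ℕ → R) → ℕ → R
  | .nil, _, g => g
  | .node _ _ c r, i, g => fun a => ∑ b ∈ Finset.Icc (a - 1) a, ∑ j ∈ Finset.Icc i b,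
      q ^ b * treeOp c j (fun b₁ => if j ≤ b₁ then
        ∑ b₂ ∈ Finset.Icc b₁ (b₁ + 1), q ^ (b₂ - j) * treeOp r i g b₂ else 0) b

theorem dotWeight_word_append (T : PlaneTree) (w : List DyckStep) :
    dotWeight (word T ++ D :: w) = 0 := by
  simp [dotWeight, (parse_word_append T w).1]

theorem transfer_word_append (T : PlaneTree) (w : List DyckStep) (φ : ℕ → R) (st : ℕ → ℕ) :
    transfer q (word T ++ D :: w) φ st = treeOp q T (st 0) (transfer q (D :: w) φ st) := by
  induction T generalizing w φ st with
  | nil => rfl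
  | node d e c r hc hr =>
    funext a
    rw [word, List.cons_append, List.append_assoc, List.cons_append, transfer, treeOp]
    refine Finset.sum_congr rfl fun b _ => Finset.sum_congr rfl fun j hj => ?_
    rw [Finset.mem_Icc] at hj
    rw [dotWeight_word_append, zero_mul, Nat.sub_zero, hc]
    congr 2
    funext b₁
    rw [transfer]
    refine if_congr Iff.rfl (Finset.sum_congr rfl fun b₂ _ => ?_) rfl
    rw [← hr]
    congr 1
    refine transfer_congr q (r := 0) ⟨(word r).length + 1, ?_⟩ ?_ b₂
    · rw [height_append, height_word, height_cons_D, height_zero]; norm_num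
    · intro M hM
      change M ≤ st 0 at hM
      have h1 : M ≤ j := hM.trans hj.1
      simp [twist, h1, Par.of_le]

end Transfer

end BallotBI

namespace BallotBI

open DyckStep PlaneTree

section TreeOperators

variable {R : Type*} [CommRing R] (q : R)

/-- The `q`-binomial coefficient `[s + n; s]`. -/
def qBinom : ℕ → ℕ → R
  | 0, _ => 1
  | _ + 1, 0 => 1
  | s + 1, n + 1 => qBinom s (n + 1) + q ^ (s + 1) * qBinom (s + 1) n

theorem qFact_add (s n : ℕ) : qFact q (s + n) = qBinom q s n * qFact q s * qFact q n := by
  induction s, n using qBinom.induct with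
  | case1 n => simp [qBinom, qFact]
  | case2 s => simp [qBinom, qFact]
  | case3 s n h1 h2 =>
    have e1 : qInt q (s + n + 2) = qInt q (s + 1) + q ^ (s + 1) * qInt q (n + 1) := by
      rw [← qInt_add]; congr 1; ring
    have e2 : qFact q (s + 1 + (n + 1)) = qFact q (s + (n + 1)) * qInt q (s + n + 2) := by
      rw [← add_assoc s n 1, ← qFact_succ]; congr 1; ring
    have e3 : qFact q (s + (n + 1)) = qFact q (s + 1 + n) := by congr 1; ring
    rw [Nat.succ_eq_add_one, Nat.succ_eq_add_one, e2, e1, mul_add, qBinom]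
    conv_lhs =>
      enter [1]
      rw [h1]
    rw [e3, h2, qFact_succ q s, qFact_succ q n]
    ring

/-- The generating function of inversions of the natural labellings of a plane forest. -/
def invSum : PlaneTree → R
  | .nil => 1
  | .node _ _ c r => qBinom q (c.size + 1) r.size * invSum c * invSum r

/-- The part of the transfer operator of an edge with exactly `j` joined levels. -/
def edgeOp (c : PlaneTree) (j : ℕ) (g : ℕ → R) : ℕ → R := fun a =>
  ∑ b ∈ Finset.Icc (a - 1) a, if j ≤ b then q ^ b * treeOp q c j (fun b₁ => if j ≤ b₁ then
    ∑ b₂ ∈ Finset.Icc b₁ (b₁ + 1), q ^ (b₂ - j) * g b₂ else 0) b else 0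

theorem sum_Icc_edgeOp (c : PlaneTree) (i : ℕ) (f : ℕ → ℕ → ℕ → R) (a : ℕ) :
    ∑ b ∈ Finset.Icc (a - 1) a, ∑ j ∈ Finset.Icc i b,
      q ^ b * treeOp q c j (fun b₁ => if j ≤ b₁ then
        ∑ b₂ ∈ Finset.Icc b₁ (b₁ + 1), q ^ (b₂ - j) * f j i b₂ else 0) b =
    ∑ j ∈ Finset.Icc i a, edgeOp q c j (f j i) a := by
  unfold edgeOp
  rw [Finset.sum_comm]
  refine Finset.sum_congr rfl fun b hb => ?_
  rw [Finset.mem_Icc] at hb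
  rw [← Finset.sum_filter]
  refine Finset.sum_congr ?_ fun _ _ => rfl
  ext j
  simp only [Finset.mem_Icc, Finset.mem_filter]
  omega

theorem treeOp_node (d e : Bool) (c r : PlaneTree) (i : ℕ) (g : ℕ → R) (a : ℕ) :
    treeOp q (.node d e c r) i g a = ∑ j ∈ Finset.Icc i a, edgeOp q c j (treeOp q r i g) a := by
  rw [treeOp]
  exact sum_Icc_edgeOp q c i (fun _ i => treeOp q r i g) a

theorem treeOp_smul (T : PlaneTree) (i : ℕ) (x : R) (f : ℕ → R) :
    treeOp q T i (x • f) = x • treeOp q T i f := by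
  induction T generalizing i f with
  | nil => rfl
  | node d e c r hc hr =>
    funext a
    simp only [treeOp, Pi.smul_apply, smul_eq_mul, hr, Finset.mul_sum]
    refine Finset.sum_congr rfl fun b _ => Finset.sum_congr rfl fun j _ => ?_
    rw [mul_left_comm x, ← smul_eq_mul x, ← Pi.smul_apply, ← hc]
    congr 2
    funext b₁
    simp only [Pi.smul_apply, smul_eq_mul, mul_ite, mul_zero, Finset.mul_sum, mul_left_comm x]

theorem treeOp_shift (T : PlaneTree) (i c : ℕ) (g : ℕ → R) (a : ℕ) :
    treeOp q T (i + c) g (a + c) = q ^ (T.size * c) * treeOp q T i (fun b => g (b + c)) a := by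
  induction T generalizing i g a with
  | nil => simp [treeOp, size]
  | node d e c' r hc hr =>
    simp only [treeOp]
    rw [sum_Icc_pred_add, Finset.mul_sum]
    · refine Finset.sum_congr rfl fun b _ => ?_
      rw [sum_Icc_add, Finset.mul_sum]
      refine Finset.sum_congr rfl fun j _ => ?_
      have h1 : (fun b => if j + c ≤ b + c then ∑ b₂ ∈ Finset.Icc (b + c) (b + c + 1),
          q ^ (b₂ - (j + c)) * treeOp q r (i + c) g b₂ else 0) = q ^ (r.size * c) •
          fun b => if j ≤ b then ∑ b₂ ∈ Finset.Icc b (b + 1),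
          q ^ (b₂ - j) * treeOp q r i (fun b => g (b + c)) b₂ else 0 := by
        funext b
        simp only [Pi.smul_apply, smul_eq_mul, mul_ite, mul_zero, Nat.add_le_add_iff_right]
        refine if_congr Iff.rfl ?_ rfl
        rw [show b + c + 1 = b + 1 + c by ring, sum_Icc_add, Finset.mul_sum]
        refine Finset.sum_congr rfl fun b₂ _ => ?_
        rw [hr, Nat.add_sub_add_right]
        ring
      rw [hc, h1, treeOp_smul, Pi.smul_apply, smul_eq_mul, size]
      ring
    · intro b hb
      rw [Finset.Icc_eq_empty (by omega), Finset.sum_empty]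

theorem edgeOp_add (c : PlaneTree) (j : ℕ) (g : ℕ → R) (a : ℕ) :
    edgeOp q c j g (a + j) = q ^ ((c.size + 1) * j) * edgeOp q c 0 (fun b => g (b + j)) a := by
  unfold edgeOp
  rw [sum_Icc_pred_add, Finset.mul_sum]
  · refine Finset.sum_congr rfl fun b _ => ?_
    rw [if_pos (Nat.le_add_left _ _), if_pos (Nat.zero_le _)]
    have h := treeOp_shift q c 0 j (fun b₁ => if j ≤ b₁ then
        ∑ b₂ ∈ Finset.Icc b₁ (b₁ + 1), q ^ (b₂ - j) * g b₂ else 0) b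
    rw [zero_add] at h
    rw [h]
    have h1 : ∀ b₁, (if j ≤ b₁ + j then
        ∑ b₂ ∈ Finset.Icc (b₁ + j) (b₁ + j + 1), q ^ (b₂ - j) * g b₂ else 0) =
        if 0 ≤ b₁ then ∑ b₂ ∈ Finset.Icc b₁ (b₁ + 1), q ^ (b₂ - 0) * g (b₂ + j) else 0 := by
      intro b₁
      rw [if_pos (Nat.le_add_left _ _), if_pos (Nat.zero_le _),
        show b₁ + j + 1 = b₁ + 1 + j by ring, sum_Icc_add]
      simp
    simp only [h1]
    ring
  · intro b hb
    rw [if_neg (by omega)]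

theorem sum_Icc_pred (f : ℕ → R) (a : ℕ) :
    ∑ b ∈ Finset.Icc (a + 1 - 1) (a + 1), f b = f (a + 1) + f a := by
  rw [Nat.add_sub_cancel, Finset.sum_Icc_succ_top (Nat.le_succ a)]
  simp [add_comm]

theorem edgeOp_zero (c : PlaneTree) (g : ℕ → R) :
    edgeOp q c 0 g = opU q (treeOp q c 0 (opD q g)) := by
  have h : (fun b₁ => if 0 ≤ b₁ then
      ∑ b₂ ∈ Finset.Icc b₁ (b₁ + 1), q ^ (b₂ - 0) * g b₂ else 0) = opD q g := by
    funext b₁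
    rw [if_pos (Nat.zero_le _), opD_apply, Finset.sum_Icc_succ_top (Nat.le_succ _)]
    simp
  funext a
  simp only [edgeOp]
  rw [h]
  simp only [Nat.zero_le, if_true]
  rcases a with _ | a
  · simp
  · rw [sum_Icc_pred, opU_succ]

/-- The transfer operator of an edge with a plane tree below it. -/
def fullEdgeOp (c : PlaneTree) (g : ℕ → R) : ℕ → R := fun a =>
  ∑ j ∈ Finset.range (a + 1), edgeOp q c j g a

theorem qFact_smul_edgeOp {c : PlaneTree}
    (hc : ∀ g : ℕ → R, qFact q c.size • treeOp q c 0 g = invSum q c • (opF q ^ c.size) g)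
    (g : ℕ → R) : qFact q (c.size + 1) • edgeOp q c 0 g = invSum q c •
      ((opF q ^ (c.size + 1)) g - q ^ (c.size + 1) • opB ((opF q ^ (c.size + 1)) (opT g))) := by
  have h := LinearMap.congr_fun (pow_opF_sub q c.size) g
  simp only [Module.End.mul_apply, LinearMap.sub_apply, LinearMap.smul_apply] at h
  rw [h, edgeOp_zero, qFact_succ, mul_comm, ← smul_smul, ← map_smul, hc, map_smul, smul_comm]

theorem qFact_smul_fullEdgeOp {c : PlaneTree}
    (hc : ∀ g : ℕ → R, qFact q c.size • treeOp q c 0 g = invSum q c • (opF q ^ c.size) g)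
    (g : ℕ → R) : qFact q (c.size + 1) • fullEdgeOp q c g =
      invSum q c • (opF q ^ (c.size + 1)) g := by
  have key := fun g => congrFun (qFact_smul_edgeOp q hc g)
  funext a
  induction a generalizing g with
  | zero => 
    have := key g 0
    simp at this
    simpa [fullEdgeOp] using this
  | succ a ih =>
    have h1 : fullEdgeOp q c g (a + 1) = edgeOp q c 0 g (a + 1) +
        q ^ (c.size + 1) * fullEdgeOp q c (opT g) a := by
      rw [fullEdgeOp, Finset.sum_range_succ', add_comm, fullEdgeOp, Finset.mul_sum]
      congr 1
      refine Finset.sum_congr rfl fun j hj => ?_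
      obtain ⟨b, rfl⟩ := Nat.exists_eq_add_of_le' (Nat.le_of_lt_succ (Finset.mem_range.1 hj))
      rw [edgeOp_add, add_assoc, edgeOp_add, ← mul_assoc, ← pow_add]
      congr 2
      ring
    have h2 := ih (opT g)
    have h3 := key g (a + 1)
    simp only [Pi.smul_apply, Pi.sub_apply, smul_eq_mul, opB_succ] at h2 h3 ⊢
    rw [h1]
    linear_combination h3 + q ^ (c.size + 1) * h2

theorem qFact_smul_treeOp (T : PlaneTree) (g : ℕ → R) :
    qFact q T.size • treeOp q T 0 g = invSum q T • (opF q ^ T.size) g := by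
  induction T generalizing g with
  | nil => simp [qFact, size, invSum, treeOp]
  | node d e c r hc hr =>
    have h1 : treeOp q (.node d e c r) 0 g = fullEdgeOp q c (treeOp q r 0 g) := by
      funext a
      rw [treeOp_node, fullEdgeOp, ← Nat.range_succ_eq_Icc_zero]
    have h2 := qFact_smul_fullEdgeOp q hc (treeOp q r 0 g)
    rw [h1, size, qFact_add, invSum, mul_assoc, mul_comm (qFact q _), mul_assoc, ← smul_smul,
      ← smul_smul, ← smul_smul, ← smul_smul, h2]
    rw [smul_comm (qFact q r.size), ← map_smul, hr, map_smul, pow_add _ _ r.size,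
      Module.End.mul_apply]

/-! ### The sums over the suffixes of ballot words -/

/-- The function of the number of joined levels that admits the value `0` only. -/
def single0 : ℕ → R := fun M => if M = 0 then 1 else 0

/-- The function of the number of joined levels that admits the even values only. -/
def evenInd : ℕ → R := fun M => if Even M then 1 else 0

theorem transfer_eq_zero {w : List DyckStep} {φ : ℕ → R} {a : ℕ} (h : ∀ M ≤ a, φ M = 0)
    (st : ℕ → ℕ) : transfer q w φ st a = 0 := by
  have ht : ∀ w, ∀ j ≤ a, twist w j φ = 0 := by
    intro w j hj
    funext M
    simp only [twist]
    rw [h _ ((min_le_left _ _).trans hj), ite_self]; rfl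
  rcases w with _ | ⟨_ | _, w⟩
  · exact h a le_rfl
  · refine Finset.sum_eq_zero fun b hb => Finset.sum_eq_zero fun j hj => ?_
    rw [Finset.mem_Icc] at hb hj
    rw [ht _ _ (by omega), transfer_zero, mul_zero]
  · rw [transfer]
    split_ifs with h1
    · refine Finset.sum_eq_zero fun b _ => ?_
      rw [ht _ _ h1, transfer_zero, mul_zero]
    · rfl

theorem transfer_stack_congr {w : List DyckStep} {φ : ℕ → R} {st st' : ℕ → ℕ}
    (h : ∀ r : ℕ, st' r = st r ∨ ∀ x, 1 - (r : ℤ) ≤ height w x) (a : ℕ) :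
    transfer q w φ st a = transfer q w φ st' a := by
  induction w generalizing φ st st' a with
  | nil => rfl
  | cons s w ih =>
    have h0 : st' 0 = st 0 := by
      rcases h 0 with h | h
      · exact h
      · have := h 0; rw [height_zero] at this; norm_num at this
    cases s with
    | U =>
      rw [transfer, transfer, h0]
      refine Finset.sum_congr rfl fun b _ => Finset.sum_congr rfl fun j _ => ?_
      congr 1
      refine ih (fun r => ?_) b
      rcases r with _ | r
      · exact Or.inl rfl
      · refine (h r).imp id fun h x => ?_
        have := h (x + 1)
        rw [height_cons_U] at this
        push_cast
        linarith
    | D =>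
      rw [transfer, transfer, h0]
      refine if_congr Iff.rfl (Finset.sum_congr rfl fun b _ => ?_) rfl
      congr 1
      refine ih (fun r => (h (r + 1)).imp id fun h x => ?_) b
      have := h (x + 1)
      rw [height_cons_D] at this
      push_cast at this
      linarith

theorem transfer_push {w : List DyckStep} (hw : ∀ x, 0 ≤ height w x) (φ : ℕ → R) (j b : ℕ) :
    transfer q w φ (push j 0) (b + j) =
      q ^ (slack w * j) * transfer q w (fun M => φ (M + j)) 0 b := by
  rw [← transfer_shift]
  refine transfer_stack_congr q (fun r => ?_) _
  rcases r with _ | r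
  · left; simp
  · right
    intro x
    have := hw x
    push_cast
    linarith

theorem transfer_even {w : List DyckStep} (hw : ∀ x, 0 ≤ height w x) :
    transfer q w evenInd 0 - q ^ (2 * slack w) • opB (opB (transfer q w evenInd 0)) =
      transfer q w single0 0 := by
  set ψ : ℕ → R := fun M => if M < 2 then 0 else evenInd M with hψ
  have h0 : ∀ M < 2, ψ M = 0 := fun M hM => if_pos hM
  have h1 : (evenInd : ℕ → R) = single0 + ψ := by
    funext M
    rcases M with _ | _ | M <;> simp [evenInd, single0, hψ]
  have h2 : ∀ a, transfer q w evenInd 0 a = transfer q w single0 0 a + transfer q w ψ 0 a := by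
    intro a; rw [← transfer_add, ← h1]
  funext a
  simp only [Pi.sub_apply, Pi.smul_apply, smul_eq_mul]
  rw [h2 a]
  rcases a with _ | _ | a
  · rw [transfer_eq_zero q fun M hM => h0 M (by omega)]; simp
  · rw [transfer_eq_zero q fun M hM => h0 M (by omega)]; simp
  · rw [transfer_support q (st' := fun n => (0 : ℕ → ℕ) n + 2) h0, transfer_shift]
    · have : (fun M => ψ (M + 2)) = evenInd := by funext M; simp [hψ, evenInd, Nat.even_add]
      simp [this, mul_comm]
    · intro r
      right
      refine ⟨by simp, by simp, fun x => ?_⟩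
      have := hw x
      linarith

theorem slack_word_append (T : PlaneTree) (w : List DyckStep) :
    slack (word T ++ D :: w) = T.size + slack w := by
  induction T generalizing w with
  | nil => simp [word, size, slack]
  | node d e c r hc hr =>
    rw [word, List.cons_append, List.append_assoc, List.cons_append, slack, hc, hr,
      dotWeight_word_append, size]
    ring

theorem transfer_edge (c : PlaneTree) (w : List DyckStep) (φ : ℕ → R) (a : ℕ) :
    transfer q (U :: (word c ++ D :: w)) φ 0 a =
      ∑ j ∈ Finset.range (a + 1), edgeOp q c j (transfer q w (twist w j φ) 0) a := by
  rw [transfer, Nat.range_succ_eq_Icc_zero,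
    ← sum_Icc_edgeOp q c 0 (fun j _ => transfer q w (twist w j φ) 0)]
  refine Finset.sum_congr rfl fun b _ => Finset.sum_congr rfl fun j hj => ?_
  rw [dotWeight_word_append, zero_mul, Nat.sub_zero, transfer_word_append]
  congr 2
  funext b₁
  rw [transfer, push_zero]
  refine if_congr Iff.rfl (Finset.sum_congr rfl fun b₂ _ => ?_) rfl
  congr 2
  funext M
  simp [twist, Par.of_le]

/-- The final value of the sums over the suffixes of a ballot word, by recursion on its tree. -/
def treeValue : PlaneTree → R
  | .nil => 1
  | .node true _ c _ => treeValue c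
  | .node false false c r => qBinom q (c.size + 1) r.size * invSum q c *
      (∏ i ∈ Finset.range (c.size + 1), (1 + q ^ (r.size + 1 + i))) * treeValue r
  | .node false true c r => (qBinom q c.size r.size +
      (1 + q ^ r.size) * (q ^ (c.size + 1) * qBinom q (c.size + 1) (r.size - 1))) * invSum q c *
      (∏ i ∈ Finset.range c.size, (1 + q ^ (r.size + 1 + i))) * treeValue r

theorem qInt_two_mul (n : ℕ) : qInt q (2 * n) = (1 + q ^ n) * qInt q n := by
  rw [two_mul, qInt_add]; ring

theorem qDouble_eq [IsDomain R] (hq : ∀ n, qInt q (n + 1) ≠ 0) (n s : ℕ) :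
    qDouble q n s = qFact q s * qBinom q s n * ∏ i ∈ Finset.range s, (1 + q ^ (n + 1 + i)) := by
  have h0 : ∀ n, qFact q n ≠ 0 := fun n => Finset.prod_ne_zero_iff.2 fun i _ => hq i
  refine mul_left_cancel₀ (h0 n) ?_
  have h1 : qFact q (n + s) = qFact q n * ∏ i ∈ Finset.range s, qInt q (n + 1 + i) := by
    rw [qFact, Finset.prod_range_add]; simp [add_right_comm, qFact]
  have h2 : qDouble q n s = (∏ i ∈ Finset.range s, (1 + q ^ (n + 1 + i))) *
      ∏ i ∈ Finset.range s, qInt q (n + 1 + i) := by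
    rw [qDouble, ← Finset.prod_mul_distrib]
    refine Finset.prod_congr rfl fun i _ => ?_
    rw [show 2 * (n + i) + 2 = 2 * (n + 1 + i) by ring, qInt_two_mul]
  have h3 := qFact_add q s n
  rw [add_comm] at h3
  rw [h2, mul_left_comm, ← h1, h3]
  ring

theorem qDouble_odd [IsDomain R] (hq : ∀ n, qInt q (n + 1) ≠ 0) (n s : ℕ) :
    qInt q (2 * n + s + 3) * qDouble q (n + 1) s =
      qFact q (s + 1) * (qBinom q s (n + 1) + (1 + q ^ (n + 1)) *
        (q ^ (s + 1) * qBinom q (s + 1) n)) * ∏ i ∈ Finset.range s, (1 + q ^ (n + 1 + 1 + i)) := by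
  have h0 : ∀ n, qFact q n ≠ 0 := fun n => Finset.prod_ne_zero_iff.2 fun i _ => hq i
  have h1 := qFact_add q s (n + 1)
  have h2 := qFact_add q (s + 1) n
  have e3 : qFact q (s + (n + 1)) = qFact q (s + 1 + n) := by congr 1; ring
  have h4 : qInt q (2 * n + s + 3) = qInt q (s + 1) + q ^ (s + 1) * qInt q (2 * (n + 1)) := by
    rw [← qInt_add]; congr 1; ring
  have h5 : qInt q (n + 1) * qBinom q s (n + 1) = qInt q (s + 1) * qBinom q (s + 1) n := by
    refine mul_left_cancel₀ (mul_ne_zero (h0 s) (h0 n)) ?_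
    rw [e3, h2, qFact_succ, qFact_succ] at h1
    linear_combination -h1
  rw [qDouble_eq q hq, h4, qInt_two_mul, qFact_succ]
  linear_combination (q ^ (s + 1) * (1 + q ^ (n + 1)) * qFact q s *
    ∏ i ∈ Finset.range s, (1 + q ^ (n + 1 + 1 + i))) * h5

theorem BaseWord.twist_even {w k T} (h : BaseWord w k T) (hk : Even k) (j : ℕ) :
    twist w j (if k = 0 then 1 else single0) = if k = 0 then (1 : ℕ → R) else single0 := by
  have hc := h.count
  funext M
  rcases Nat.eq_zero_or_pos k with h0 | h0
  · have : Par w j M := by intro h; omega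
    simp [twist, this, h0]
  · have : Par w j M ↔ M ≤ j := by
      have : ¬ Odd k := Nat.not_odd_iff_even.2 hk
      simp [Par, hc, h0, this]
    simp only [twist, this, if_neg h0.ne', single0]
    split_ifs <;> first | rfl | omega

theorem BaseWord.par_iff {w k T} (h : BaseWord w k T) (hk : Odd k) (j M : ℕ) :
    Par w j M ↔ Even (M - min j M) := by
  have hc := h.count
  have h0 := hk.pos
  simp [Par, hc, h0, hk]

theorem BaseWord.twist_odd {w k T} (h : BaseWord w k T) (hk : Odd k) (j : ℕ) :
    twist w j single0 = if j = 0 then (evenInd : ℕ → R) else single0 := by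
  funext M
  simp only [twist, h.par_iff hk]
  rcases j with _ | j
  · simp [single0, evenInd]
  · rcases M with _ | M
    · simp [single0]
    · simp [single0]

theorem transfer_edge_even [IsDomain R] (hq : ∀ n, qInt q (n + 1) ≠ 0) {w k c r}
    (h : BaseWord w k r) (hk : Even k) (hr : transfer q w (if k = 0 then 1 else single0) 0 =
      treeValue q r • seqEven q r.size) :
    transfer q (U :: (word c ++ D :: w)) (if k = 0 then 1 else single0) 0 =
      treeValue q (.node false false c r) • seqEven q (c.size + 1 + r.size) := by
  have h0 : ∀ n, qFact q n ≠ 0 := fun n => Finset.prod_ne_zero_iff.2 fun i _ => hq i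
  have h1 : transfer q (U :: (word c ++ D :: w)) (if k = 0 then 1 else single0) 0 =
      fullEdgeOp q c (treeValue q r • seqEven q r.size) := by
    funext a
    rw [transfer_edge, fullEdgeOp]
    simp only [h.twist_even hk, hr]
  have h2 := qFact_smul_fullEdgeOp q (qFact_smul_treeOp q c) (treeValue q r • seqEven q r.size)
  rw [← h1, map_smul, pow_opF_seqEven, qDouble_eq q hq] at h2
  funext a
  refine mul_left_cancel₀ (h0 (c.size + 1)) ((congrFun h2 a).trans ?_)
  simp only [Pi.smul_apply, smul_eq_mul, treeValue, add_comm r.size (c.size + 1)]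
  ring

theorem transfer_edge_odd [IsDomain R] (hq : ∀ n, qInt q (n + 1) ≠ 0) {w k c r n}
    (h : BaseWord w k r) (h' : BaseWord (U :: (word c ++ D :: w)) k (.node false true c r))
    (hk : Odd k) (hn : r.size = n + 1) (hs : slack w = n)
    (hs' : slack (U :: (word c ++ D :: w)) = n + c.size + 1)
    (hr : transfer q w evenInd 0 = treeValue q r • seqOdd q n) :
    transfer q (U :: (word c ++ D :: w)) evenInd 0 =
      treeValue q (.node false true c r) • seqOdd q (n + c.size + 1) := by
  have h0 : ∀ n, qFact q n ≠ 0 := fun n => Finset.prod_ne_zero_iff.2 fun i _ => hq i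
  set G := transfer q w evenInd 0 with hG
  have e0 := transfer_even q h.height_nonneg
  rw [← hG, hs] at e0
  have e1 := transfer_even q h'.height_nonneg
  have e2 : transfer q (U :: (word c ++ D :: w)) single0 0 =
      fullEdgeOp q c (transfer q w single0 0) + edgeOp q c 0 G -
        edgeOp q c 0 (transfer q w single0 0) := by
    funext a
    rw [transfer_edge]
    simp only [h.twist_odd hk]
    simp only [Pi.add_apply, Pi.sub_apply, fullEdgeOp, Finset.sum_range_succ']
    simp only [Nat.add_eq_zero_iff, one_ne_zero, and_false, if_false, if_true]
    rw [hG]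
    ring
  have e3 : qFact q (c.size + 1) • transfer q (U :: (word c ++ D :: w)) single0 0 =
      invSum q c • ((opF q ^ (c.size + 1)) G -
        q ^ (2 * n + (c.size + 1)) • opB ((opF q ^ (c.size + 1)) (opB G))) := by
    have hT : opT (opB (opB G)) = opB G := rfl
    rw [e2, smul_sub, smul_add, qFact_smul_fullEdgeOp q (qFact_smul_treeOp q c),
      qFact_smul_edgeOp q (qFact_smul_treeOp q c), qFact_smul_edgeOp q (qFact_smul_treeOp q c), ← e0]
    simp only [map_sub, map_smul, hT, pow_add]
    module
  have e4 : qFact q (c.size + 1) • transfer q (U :: (word c ++ D :: w)) evenInd 0 =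
      (invSum q c * treeValue q r * (qInt q (2 * n + c.size + 3) * qDouble q (n + 1) c.size)) •
        seqOdd q (n + c.size + 1) := by
    have e5 := pow_opF_seqOdd_sub q hq n c.size
    refine (eq_oddAux (c := q ^ (2 * (n + c.size + 1))) ?_).trans (eq_oddAux rfl).symm
    rw [map_smul, map_smul, smul_comm _ (qFact q _), ← smul_sub, ← hs', e1, e3, hr]
    simp only [map_smul, hs']
    linear_combination (norm := module) (invSum q c * treeValue q r) • e5
  rw [qDouble_odd q hq] at e4
  funext a
  refine mul_left_cancel₀ (h0 (c.size + 1)) ((congrFun e4 a).trans ?_)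
  simp only [Pi.smul_apply, smul_eq_mul, treeValue, hn, Nat.add_sub_cancel]
  ring

/-- The transfer sums of the suffixes without unmatched down steps. -/
theorem transfer_baseWord [IsDomain R] (hq : ∀ n, qInt q (n + 1) ≠ 0) {w k T}
    (h : BaseWord w k T) :
    (Even k → slack w = T.size ∧ transfer q w (if k = 0 then 1 else single0) 0 =
      treeValue q T • seqEven q T.size) ∧
    (Odd k → ∃ n, T.size = n + 1 ∧ slack w = n ∧ transfer q w evenInd 0 =
      treeValue q T • seqOdd q n) := by
  induction h with
  | nil => 
    refine ⟨fun _ => ⟨rfl, ?_⟩, fun h => by simp at h⟩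
    funext a
    simp [transfer, treeValue, size, seqEven]
  | @edge w k c r hc h ih =>
    have hs : slack (U :: (word c ++ D :: w)) = slack w + c.size + 1 := by
      rw [slack, slack_word_append, dotWeight_word_append]; ring
    constructor
    · intro hk
      obtain ⟨h1, h2⟩ := ih.1 hk
      have : decide (Odd k) = false := by simpa using hk
      rw [this]
      refine ⟨by rw [hs, h1, size]; ring, ?_⟩
      rw [transfer_edge_even q hq h hk h2, size]
    · intro hk
      obtain ⟨n, h1, h2, h3⟩ := ih.2 hk
      have h' := BaseWord.edge hc h
      have : decide (Odd k) = true := by simpa using hk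
      rw [this] at h' ⊢
      rw [h2] at hs
      exact ⟨n + c.size + 1, by rw [size, h1]; ring, hs, transfer_edge_odd q hq h h' hk h1 h2 hs h3⟩
  | @dot w k r hk h ih =>
    obtain ⟨h1, h2⟩ := ih.1 hk
    have hw : dotWeight w = 1 := by simp [dotWeight, h.parse_eq, hk]
    have hs : slack (U :: w) = r.size := by rw [slack, hw, h1]; rfl
    refine ⟨fun h => absurd hk (by simpa [Nat.even_add_one] using h), fun _ =>
      ⟨r.size, by simp [size], hs, ?_⟩⟩
    have e1 := transfer_even q (BaseWord.dot hk h).height_nonneg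
    have e2 : transfer q (U :: w) single0 0 = treeValue q r • opU q (seqEven q r.size) := by
      have key : ∀ b, ∑ j ∈ Finset.Icc ((0 : ℕ → ℕ) 0) b, q ^ (b - dotWeight w * j) *
          transfer q w (twist w j single0) (push j 0) b = q ^ b * (treeValue q r * seqEven q r.size b) := by
        intro b
        rw [Finset.sum_eq_single_of_mem 0 (by simp)]
        · have e3 : (fun M => twist w 0 single0 (M + 0)) = if k = 0 then (1 : ℕ → R) else single0 := by
            rw [← h.twist_even hk 0]
            funext M
            split_ifs <;> simp [twist, single0]
          have := transfer_push q h.height_nonneg (twist w 0 single0) 0 b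
          rw [add_zero] at this
          rw [this, e3, h2]
          simp
        · intro j hj hj0
          obtain ⟨b', rfl⟩ := Nat.exists_eq_add_of_le' (Finset.mem_Icc.1 hj).2
          have e3 : (fun M => twist w j (single0 : ℕ → R) (M + j)) = 0 := by
            funext M
            simp [twist, single0, hj0]
          rw [transfer_push q h.height_nonneg, e3, transfer_zero, mul_zero, mul_zero]
      funext a
      rw [transfer]
      simp only [key]
      rcases a with _ | a
      · simp
      · rw [sum_Icc_pred]
        simp
        ring
    rw [hs, e2, ← seqOdd_sub] at e1
    refine (eq_oddAux e1).trans (eq_oddAux ?_).symm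
    simp only [map_smul, treeValue]
    module
  | @up w k r hk h ih =>
    obtain ⟨n, h1, h2, h3⟩ := ih.2 hk
    have hw : dotWeight w = 0 := by simp [dotWeight, h.parse_eq, Nat.not_even_iff_odd.2 hk]
    refine ⟨fun _ => ⟨by rw [slack, hw, h1, h2], ?_⟩, fun h => absurd h (by simpa [Nat.odd_add_one] using hk)⟩
    have key : ∀ b, ∑ j ∈ Finset.Icc ((0 : ℕ → ℕ) 0) b, q ^ (b - dotWeight w * j) *
        transfer q w (twist w j single0) (push j 0) b = q ^ b * (treeValue q r * seqOdd q n b) := by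
      intro b
      rw [Finset.sum_eq_single_of_mem 0 (by simp)]
      · have e3 : (fun M => twist w 0 single0 (M + 0)) = (evenInd : ℕ → R) := by
          simpa using h.twist_odd hk 0
        have := transfer_push q h.height_nonneg (twist w 0 single0) 0 b
        rw [add_zero] at this
        rw [this, e3, h3]
        simp
      · intro j hj hj0
        obtain ⟨b', rfl⟩ := Nat.exists_eq_add_of_le' (Finset.mem_Icc.1 hj).2
        have e3 : (fun M => twist w j (single0 : ℕ → R) (M + j)) = 0 := by
          funext M
          simp [twist, single0, hj0]
        rw [transfer_push q h.height_nonneg, e3, transfer_zero, mul_zero, mul_zero]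
    rw [if_neg (by omega), h1, seqEven_succ]
    funext a
    rw [transfer]
    simp only [key]
    rcases a with _ | a
    · simp
    · rw [sum_Icc_pred]
      simp
      ring

theorem transfer_of_isBallot [IsDomain R] (hq : ∀ n, qInt q (n + 1) ≠ 0) {w : List DyckStep}
    (hw : IsBallot w) : transfer q w (twist w 0 1) 0 0 = treeValue q (tree w) := by
  have h := baseWord_of_isBallot hw
  have hb := transfer_baseWord q hq h
  rcases Nat.even_or_odd (parse w).unpaired with hk | hk
  · have e : twist w 0 (1 : ℕ → R) = if (parse w).unpaired = 0 then 1 else single0 := by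
      rw [← h.twist_even hk 0]
      funext M
      split_ifs <;> simp [twist, single0]
    rw [e, (hb.1 hk).2]
    simp
  · obtain ⟨n, -, -, h3⟩ := hb.2 hk
    have e : twist w 0 (1 : ℕ → R) = evenInd := by
      have := h.twist_odd hk (R := R) 0
      rw [if_pos rfl] at this
      rw [← this]
      funext M
      simp [twist, single0]
    rw [e, h3]
    simp

end TreeOperators

end BallotBI

namespace BallotBI

open DyckStep PlaneTree Edge

/-! ### Edges of a plane tree -/

/-- The edges of a tree with at least one edge. -/
def edgeEquiv (d a : Bool) (c r : PlaneTree) :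
    Option (Edge c) ⊕ Edge r ≃ Edge (.node d a c r) where
  toFun
    | .inl none => .top
    | .inl (some e) => .under e
    | .inr e => .later e
  invFun
    | .top => .inl none
    | .under e => .inl (some e)
    | .later e => .inr e
  left_inv := by rintro ((_ | _) | _) <;> rfl
  right_inv := by rintro (_ | _ | _) <;> rfl

instance : IsEmpty (Edge .nil) := ⟨fun e => by cases e⟩

@[to_additive]
theorem prod_edge {M : Type*} [CommMonoid M] {d a : Bool} {c r : PlaneTree}
    (f : Edge (.node d a c r) → M) :
    ∏ e, f e = (f .top * ∏ e, f (.under e)) * ∏ e, f (.later e) := by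
  rw [← (edgeEquiv d a c r).prod_comp, Fintype.prod_sum_type, Fintype.prod_option]
  rfl

theorem card_edge (T : PlaneTree) : Fintype.card (Edge T) = T.size := by
  induction T with
  | nil => simp [size]
  | node d a c r hc hr =>
    rw [← Fintype.card_congr (edgeEquiv d a c r), Fintype.card_sum, Fintype.card_option, hc, hr, size]

theorem length_modPost (T : PlaneTree) : (modPost T).length = T.size := by
  induction T with
  | nil => rfl
  | node d a c r hc hr => cases d <;> simp [modPost, size, hc, hr] <;> omega

theorem idxOf_map_of_injective {α β : Type*} [DecidableEq α] [DecidableEq β] {f : α → β}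
    (hf : Function.Injective f) (l : List α) (x : α) : (l.map f).idxOf (f x) = l.idxOf x := by
  induction l with
  | nil => rfl
  | cons y l ih =>
    have : (f y == f x) = (y == x) := by rw [Bool.eq_iff_iff]; simp [hf.eq_iff]
    simp [List.idxOf_cons, ih, this]

theorem under_injective {d a : Bool} {c r : PlaneTree} :
    Function.Injective (Edge.under : Edge c → Edge (.node d a c r)) := fun _ _ h => by cases h; rfl

theorem later_injective {d a : Bool} {c r : PlaneTree} :
    Function.Injective (Edge.later : Edge r → Edge (.node d a c r)) := fun _ _ h => by cases h; rfl

theorem idxOf_lt {T : PlaneTree} (e : Edge T) : (modPost T).idxOf e < T.size := by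
  rw [← length_modPost]
  exact List.idxOf_lt_length_of_mem (mem_modPost e)

theorem S_eq {T : PlaneTree} (e : Edge T) : S e = T.size - (modPost T).idxOf e := by
  rw [S, card_edge, refLabel]; omega

theorem S_later {d a : Bool} {c r : PlaneTree} (e : Edge r) :
    S (.later e : Edge (.node d a c r)) = S e := by
  have h := idxOf_lt e
  rw [S_eq, S_eq]
  cases d
  · rw [modPost, List.idxOf_append_of_notMem (by simp), List.idxOf_cons_ne _ (by simp),
      idxOf_map_of_injective later_injective, List.length_map, length_modPost, size]
    omega
  · rw [modPost, List.cons_append, List.idxOf_cons_ne _ (by simp), List.idxOf_append_of_notMem (by simp),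
      idxOf_map_of_injective later_injective, List.length_map, length_modPost, size]
    omega

theorem S_top {a : Bool} {c r : PlaneTree} :
    S (.top : Edge (.node false a c r)) = r.size + 1 := by
  rw [S_eq, modPost, List.idxOf_append_of_notMem (by simp), List.idxOf_cons_self, List.length_map,
    length_modPost, size]
  omega

theorem S_under {a : Bool} {c r : PlaneTree} (e : Edge c) :
    S (.under e : Edge (.node false a c r)) = S e + (r.size + 1) := by
  have h := idxOf_lt e
  rw [S_eq, S_eq, modPost, List.idxOf_append_of_mem (List.mem_map_of_mem (mem_modPost e)),
    idxOf_map_of_injective under_injective, size]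
  omega

theorem S_under_dotted {a : Bool} {c : PlaneTree} (e : Edge c) :
    S (.under e : Edge (.node true a c .nil)) = S e := by
  have h := idxOf_lt e
  rw [S_eq, S_eq, modPost, List.cons_append, List.idxOf_cons_ne _ (by simp),
    List.idxOf_append_of_mem (List.mem_map_of_mem (mem_modPost e)),
    idxOf_map_of_injective under_injective, size, size]
  omega

theorem prod_S {M : Type*} [CommMonoid M] {T : PlaneTree} (hT : IsPlain T) (f : ℕ → M) :
    ∏ e : Edge T, f (S e) = ∏ i ∈ Finset.range T.size, f (i + 1) := by
  induction T generalizing f with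
  | nil => simp [size]
  | node d a c r hc hr =>
    obtain ⟨rfl, rfl, h1, h2⟩ := hT
    rw [prod_edge]
    simp only [S_top, S_under, S_later]
    rw [hr h2, hc h1 (fun i => f (i + (r.size + 1))), size, Nat.add_comm _ r.size,
      Finset.prod_range_add, Finset.prod_range_succ' _ c.size, mul_comm, mul_comm (f _)]
    congr 2
    refine Finset.prod_congr rfl fun i _ => ?_
    congr 1
    ring

/-! ### Statistics of labellings in terms of the order of the labels -/

/-- The number of inversions. -/
noncomputable def invCount {T : PlaneTree} (lt : Edge T → Edge T → Prop) : ℕ :=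
  open scoped Classical in ∑ e, ∑ e', if lt e' e ∧ StrictlyRight e e' then 1 else 0

/-- The circled edges. -/
def CircledBy {T : PlaneTree} (lt : Edge T → Edge T → Prop) (e : Edge T) : Prop :=
  ¬ Dotted e ∧ (¬ HasIncoming e ∨ ∃ e', Relation.TransGen Arrow e e' ∧ lt e' e)

theorem exists_chain {T : PlaneTree} {L : Edge T → ℕ} {x y : Edge T} {θ : ℕ}
    (h : Relation.ReflTransGen Arrow x y) (hy : L y < θ) (hx : θ ≤ L x) :
    ∃ (p : ℕ) (s : ℕ → Edge T), s 0 = x ∧ 0 < p ∧ (∀ i < p, Arrow (s i) (s (i + 1))) ∧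
      (∀ i < p, θ ≤ L (s i)) ∧ L (s p) < θ := by
  induction h using Relation.ReflTransGen.head_induction_on with
  | refl => omega
  | @head x z hxz hzy ih =>
    by_cases hz : L z < θ
    · refine ⟨1, fun i => if i = 0 then x else z, rfl, one_pos, ?_, ?_, ?_⟩
      · intro i hi
        obtain rfl : i = 0 := by omega
        simpa using hxz
      · intro i hi
        obtain rfl : i = 0 := by omega
        simpa using hx
      · simpa using hz
    · obtain ⟨p, s, h1, -, h2, h3, h4⟩ := ih (not_lt.1 hz)
      refine ⟨p + 1, fun i => Nat.casesOn i x s, rfl, Nat.succ_pos p, ?_, ?_, h4⟩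
      · rintro (_ | i) hi
        · simpa [h1] using hxz
        · exact h2 i (by omega)
      · rintro (_ | i) hi
        · exact hx
        · exact h3 i (by omega)

theorem transGen_of_chain {T : PlaneTree} {s : ℕ → Edge T} {p i : ℕ}
    (h : ∀ i < p, Arrow (s i) (s (i + 1))) (hi : i < p) : Relation.TransGen Arrow (s i) (s p) := by
  obtain ⟨k, rfl⟩ := Nat.exists_eq_add_of_lt hi
  clear hi
  induction k with
  | zero => exact .single (h i (by omega))
  | succ k ih => exact .tail (ih fun i hi => h i (by omega)) (h (i + k + 1) (by omega))

theorem circled_iff {T : PlaneTree} (L : Labelling T) (e : Edge T) :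
    Circled L e ↔ CircledBy (fun e e' => L e < L e') e := by
  refine and_congr_right fun _ => or_congr_right ⟨?_, ?_⟩
  · rintro ⟨p, s, h1, h2, i, hi, rfl⟩
    exact ⟨s p, transGen_of_chain h1 hi, h2 i hi⟩
  · rintro ⟨e', h1, h2⟩
    obtain ⟨p, s, h3, h4, h5, h6, h7⟩ :=
      exists_chain (L := fun e => (L e : ℕ)) h1.to_reflTransGen h2 le_rfl
    exact ⟨p, s, h5, fun i hi => Fin.lt_def.2 (h7.trans_le (h6 i hi)), 0, h4, h3⟩

theorem deg7_eq {T : PlaneTree} (L : Labelling T) :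
    deg7 L = invCount (fun e e' => L e < L e') := by
  classical
  simp only [deg7, invCount, Finset.card_filter]
  congr!

section Weights

variable {R : Type*} [CommRing R] (q : R)

open scoped Classical in
/-- The factor of an edge. -/
noncomputable def edgeFactor {T : PlaneTree} (lt : Edge T → Edge T → Prop) (e : Edge T) : R :=
  if InA e then 1 + q ^ S e else if CircledBy lt e then 1 + q ^ (S e - 1) else 1

/-- The weight of a labelling. -/
noncomputable def labelWeight {T : PlaneTree} (lt : Edge T → Edge T → Prop) : R :=
  q ^ invCount lt * ∏ e, edgeFactor q lt e

theorem sum_labelWeight (T : PlaneTree) :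
    (∑ L ∈ naturalLabellings T, q ^ deg7 L * ∏ e ∈ setB T ∩ circledEdges L, (1 + q ^ (S e - 1))) *
      ∏ e ∈ setA T, (1 + q ^ S e) =
    ∑ L ∈ naturalLabellings T, labelWeight q (fun e e' => L e < L e') := by
  classical
  rw [Finset.sum_mul]
  refine Finset.sum_congr rfl fun L _ => ?_
  rw [labelWeight, deg7_eq, mul_assoc]
  congr 1
  have h1 : setB T ∩ circledEdges L = Finset.univ.filter fun e => InB e ∧ Circled L e := by
    ext e; simp [setB, circledEdges]
  rw [h1, setA, Finset.prod_filter, Finset.prod_filter, ← Finset.prod_mul_distrib]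
  refine Finset.prod_congr rfl fun e _ => ?_
  rw [edgeFactor, circled_iff]
  by_cases hA : InA e
  · simp [InB, hA]
  · by_cases hc : CircledBy (fun e e' => L e < L e') e
    · simp [InB, hA, hc, hc.1]
    · simp [hA, hc]

end Weights

/-! ### Shuffles -/

section Shuffles

variable {R : Type*} [CommRing R] (q : R)

/-- The number of pairs `j < i` with `i` in a set and `j` in its complement. -/
def crossCount {N : ℕ} (v : Fin N → Bool) : ℕ :=
  ∑ i, ∑ j, if v i = true ∧ v j = false ∧ j < i then 1 else 0

/-- The number of elements of a set. -/
def trueCount {N : ℕ} (v : Fin N → Bool) : ℕ := ∑ i, if v i = true then 1 else 0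

theorem trueCount_cons {N : ℕ} (b : Bool) (v : Fin N → Bool) :
    trueCount (Fin.cons b v : Fin (N + 1) → Bool) = (if b = true then 1 else 0) + trueCount v := by
  simp [trueCount, Fin.sum_univ_succ, -Finset.sum_boole]

theorem crossCount_cons {N : ℕ} (b : Bool) (v : Fin N → Bool) :
    crossCount (Fin.cons b v : Fin (N + 1) → Bool) =
      (if b = true then 0 else trueCount v) + crossCount v := by
  cases b <;> simp [crossCount, trueCount, Fin.sum_univ_succ, Finset.sum_add_distrib, -Finset.sum_boole]

theorem sum_cons {N : ℕ} (f : (Fin (N + 1) → Bool) → R) :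
    ∑ v, f v = (∑ v : Fin N → Bool, f (Fin.cons true v)) + ∑ v : Fin N → Bool, f (Fin.cons false v) := by
  rw [← (Fin.consEquiv fun _ => Bool).sum_comp, Fintype.sum_prod_type]
  simp [Fin.consEquiv]

theorem sum_crossCount (s n N : ℕ) (hN : N = s + n) :
    ∑ v : Fin N → Bool, (if trueCount v = s then q ^ crossCount v else 0) = qBinom q s n := by
  have h0 : ∀ N, ∑ v : Fin N → Bool, (if trueCount v = 0 then q ^ crossCount v else 0) = 1 := by
    intro N
    induction N with
    | zero => simp [trueCount, crossCount]
    | succ N ih =>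
      rw [sum_cons]
      simp only [trueCount_cons, crossCount_cons]
      rw [← ih, Finset.sum_eq_zero (by intro v _; simp), zero_add]
      refine Finset.sum_congr rfl fun v _ => ?_
      by_cases h : trueCount v = 0 <;> simp [h]
  have h1 : ∀ s N, N < s → ∑ v : Fin N → Bool, (if trueCount v = s then q ^ crossCount v else 0) = 0 := by
    intro s N h
    refine Finset.sum_eq_zero fun v _ => if_neg ?_
    have : trueCount v ≤ ∑ i : Fin N, 1 := Finset.sum_le_sum fun i _ => by split_ifs <;> simp
    simp at this
    omega
  have h2 : ∀ s N, ∑ v : Fin (N + 1) → Bool, (if trueCount v = s + 1 then q ^ crossCount v else 0) =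
      (∑ v : Fin N → Bool, if trueCount v = s then q ^ crossCount v else 0) +
        q ^ (s + 1) * ∑ v : Fin N → Bool, if trueCount v = s + 1 then q ^ crossCount v else 0 := by
    intro s N
    rw [sum_cons, Finset.mul_sum]
    simp only [trueCount_cons, crossCount_cons]
    congr 1
    · refine Finset.sum_congr rfl fun v _ => ?_
      simp [add_comm 1]
    · refine Finset.sum_congr rfl fun v _ => ?_
      by_cases h : trueCount v = s + 1 <;> simp [h, pow_add]
  subst hN
  induction s, n using qBinom.induct with
  | case1 n => rw [h0, qBinom]
  | case2 s =>
    rw [qBinom, Nat.succ_eq_add_one, add_zero]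
    induction s with
    | zero => rw [h2, h0, h1 _ _ (by omega)]; simp
    | succ s ih => rw [h2, ih, h1 _ _ (by omega)]; simp
  | case3 s n ih1 ih2 =>
    rw [qBinom, ← ih1, ← ih2]
    have e : s.succ + n.succ = s + (n + 1) + 1 := by omega
    have e' : s + (n + 1) = s + 1 + n := by omega
    rw [e, h2, e']

/-- The sum over the shuffles of `k + 1` and `m` letters, with a factor `x` if the first letter is
one of the latter. -/
def shuffleSum (k m : ℕ) (x : R) : R :=
  qBinom q k m + x * if m = 0 then 0 else q ^ (k + 1) * qBinom q (k + 1) (m - 1)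

theorem shuffleSum_one (k m : ℕ) : shuffleSum q k m 1 = qBinom q (k + 1) m := by
  rcases m with _ | m
  · cases k <;> simp [shuffleSum, qBinom]
  · simp [shuffleSum, qBinom]

theorem sum_crossCount_factor (k m N : ℕ) (hN : N = k + 1 + m) (x : R) :
    ∑ v : Fin N → Bool, (if trueCount v = k + 1 then q ^ crossCount v *
      (if ∀ i, v i = false → 0 < (i : ℕ) then 1 else x) else 0) = shuffleSum q k m x := by
  obtain rfl : N = k + m + 1 := by omega
  rw [sum_cons]
  simp only [trueCount_cons, crossCount_cons, Fin.forall_fin_succ]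
  rw [shuffleSum]
  congr 1
  · rw [← sum_crossCount q k m _ rfl]
    refine Finset.sum_congr rfl fun v _ => ?_
    simp [add_comm 1]
  · rcases m with _ | m
    · simp only [if_true, mul_zero]
      refine Finset.sum_eq_zero fun v _ => if_neg ?_
      have : trueCount v ≤ ∑ i : Fin (k + 0), 1 :=
        Finset.sum_le_sum fun i _ => by split_ifs <;> simp
      simp at this
      simp
      omega
    · rw [if_neg (Nat.succ_ne_zero m), Nat.add_sub_cancel,
        ← sum_crossCount q (k + 1) m (k + (m + 1)) (by omega), Finset.mul_sum, Finset.mul_sum]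
      refine Finset.sum_congr rfl fun v _ => ?_
      by_cases h : trueCount v = k + 1
      · simp [h, pow_add]
        ring
      · simp [h]

theorem card_compl_eq {s m : ℕ} (A : {A : Finset (Fin (s + m)) // A.card = s}) :
    (A.1ᶜ).card = m := by
  simp [Finset.card_compl, A.2]

/-- The bijection that is obtained from two bijections and the set of the values on the left. -/
def merge {α β : Type*} {s m : ℕ} (A : {A : Finset (Fin (s + m)) // A.card = s})
    (f : α ≃ Fin s) (g : β ≃ Fin m) : α ⊕ β ≃ Fin (s + m) :=
  (Equiv.sumCongr f g).trans (finSumEquivOfFinset A.2 (card_compl_eq A))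

variable {α β : Type*} {s m : ℕ}

theorem merge_inl (A : {A : Finset (Fin (s + m)) // A.card = s}) (f : α ≃ Fin s) (g : β ≃ Fin m)
    (a : α) : merge A f g (.inl a) = A.1.orderEmbOfFin A.2 (f a) := rfl

theorem merge_inr (A : {A : Finset (Fin (s + m)) // A.card = s}) (f : α ≃ Fin s) (g : β ≃ Fin m)
    (b : β) : merge A f g (.inr b) = (A.1ᶜ).orderEmbOfFin (card_compl_eq A) (g b) := rfl

theorem merge_inl_lt (A : {A : Finset (Fin (s + m)) // A.card = s}) (f : α ≃ Fin s) (g : β ≃ Fin m)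
    (a a' : α) : merge A f g (.inl a) < merge A f g (.inl a') ↔ f a < f a' := by
  rw [merge_inl, merge_inl, OrderEmbedding.lt_iff_lt]

theorem merge_inr_lt (A : {A : Finset (Fin (s + m)) // A.card = s}) (f : α ≃ Fin s) (g : β ≃ Fin m)
    (b b' : β) : merge A f g (.inr b) < merge A f g (.inr b') ↔ g b < g b' := by
  rw [merge_inr, merge_inr, OrderEmbedding.lt_iff_lt]

theorem merge_inl_mem (A : {A : Finset (Fin (s + m)) // A.card = s}) (f : α ≃ Fin s) (g : β ≃ Fin m)
    (a : α) : merge A f g (.inl a) ∈ A.1 := Finset.orderEmbOfFin_mem _ A.2 _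

theorem merge_inr_notMem (A : {A : Finset (Fin (s + m)) // A.card = s}) (f : α ≃ Fin s)
    (g : β ≃ Fin m) (b : β) : merge A f g (.inr b) ∉ A.1 :=
  Finset.mem_compl.1 (Finset.orderEmbOfFin_mem _ (card_compl_eq A) _)

theorem exists_equiv_orderEmb [Fintype α] {N : ℕ} (A : Finset (Fin N)) (hA : A.card = s)
    (l : α → Fin N) (hl : Function.Injective l) (hl' : ∀ i, i ∈ A ↔ ∃ a, l a = i) :
    ∃ f : α ≃ Fin s, ∀ a, A.orderEmbOfFin hA (f a) = l a := by
  let e : α ≃ A := Equiv.ofBijective (fun a => ⟨l a, (hl' _).2 ⟨a, rfl⟩⟩)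
    ⟨fun a b h => hl (congrArg Subtype.val h), fun i => by
      obtain ⟨a, ha⟩ := (hl' i).1 i.2
      exact ⟨a, Subtype.ext ha⟩⟩
  refine ⟨e.trans (A.orderIsoOfFin hA).symm.toEquiv, fun a => ?_⟩
  rw [← Finset.coe_orderIsoOfFin_apply]
  exact congrArg Subtype.val ((A.orderIsoOfFin hA).apply_symm_apply (e a))

theorem merge_bijective [Fintype α] [Fintype β] (hα : Fintype.card α = s) :
    Function.Bijective fun p : {A : Finset (Fin (s + m)) // A.card = s} × (α ≃ Fin s) × (β ≃ Fin m) =>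
      merge p.1 p.2.1 p.2.2 := by
  classical
  constructor
  · rintro ⟨A, f, g⟩ ⟨A', f', g'⟩ h
    simp only at h
    have hA : A = A' := by
      ext i
      obtain ⟨a | b, rfl⟩ := (merge A f g).surjective i
      · simp only [merge_inl_mem, true_iff]; rw [h]; exact merge_inl_mem _ _ _ _
      · simp only [merge_inr_notMem, false_iff]; rw [h]; exact merge_inr_notMem _ _ _ _
    subst hA
    congr 2
    · ext1 a
      have := congrArg (fun e => e (Sum.inl a)) h
      exact (A.1.orderEmbOfFin A.2).injective this
    · ext1 b
      have := congrArg (fun e => e (Sum.inr b)) h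
      exact ((A.1ᶜ).orderEmbOfFin (card_compl_eq A)).injective this
  · intro L
    have hc : (Finset.univ.image fun a => L (.inl a)).card = s := by
      rw [Finset.card_image_of_injective _ fun a b h => Sum.inl_injective (L.injective h),
        Finset.card_univ, hα]
    have hc' : ((Finset.univ.image fun a => L (.inl a))ᶜ).card = m := by
      simp [Finset.card_compl, hc]
    obtain ⟨f, hf⟩ := exists_equiv_orderEmb _ hc (fun a => L (.inl a))
      (L.injective.comp Sum.inl_injective) (by simp)
    obtain ⟨g, hg⟩ := exists_equiv_orderEmb _ hc' (fun b => L (.inr b))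
      (L.injective.comp Sum.inr_injective) (by
        intro i
        obtain ⟨a | b, rfl⟩ := L.surjective i <;> simp)
    refine ⟨⟨⟨_, hc⟩, f, g⟩, ?_⟩
    ext1 x
    rcases x with a | b
    · exact hf a
    · exact hg b

theorem sum_merge [Fintype α] [Fintype β] [DecidableEq α] [DecidableEq β]
    (hα : Fintype.card α = s) (H : (α ⊕ β ≃ Fin (s + m)) → R) :
    ∑ L, H L = ∑ A : {A : Finset (Fin (s + m)) // A.card = s}, ∑ f : α ≃ Fin s, ∑ g : β ≃ Fin m,
      H (merge A f g) := by
  rw [← Fintype.sum_bijective _ (merge_bijective (β := β) (m := m) hα) _ H fun _ => rfl]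
  rw [Fintype.sum_prod_type]
  simp only [Fintype.sum_prod_type]

theorem sum_optionEquiv [Fintype α] [DecidableEq α] {k : ℕ} (H : (Option α ≃ Fin (k + 1)) → R) :
    ∑ L, (if L none = 0 then H L else 0) =
      ∑ f : α ≃ Fin k, H (f.optionCongr.trans (finSuccEquiv k).symm) := by
  rw [← Finset.sum_filter]
  symm
  refine Finset.sum_bij (fun f _ => f.optionCongr.trans (finSuccEquiv k).symm) ?_ ?_ ?_ ?_
  · intro f _; simp
  · intro f _ g _ h
    ext1 a
    have := congrArg (fun e => e (some a)) h
    simpa using this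
  · intro L hL
    simp only [Finset.mem_filter, Finset.mem_univ, true_and] at hL
    set e := L.trans (finSuccEquiv k) with he
    have h0 : e none = none := by simp [he, hL]
    refine ⟨e.removeNone, Finset.mem_univ _, ?_⟩
    ext1 x
    have : e.removeNone.optionCongr x = e x := by
      rcases x with _ | a
      · simp [h0]
      · have h1 : ∃ x', e (some a) = some x' := by
          rw [← Option.ne_none_iff_exists']
          intro h
          rw [← h0] at h
          simpa using e.injective h
        simpa using Equiv.removeNone_some e h1
    simp only [Equiv.trans_apply, this]
    simp [he]
  · intro f _; rfl

/-- Sets of labels as words. -/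
def finsetEquivWord (N : ℕ) : Finset (Fin N) ≃ (Fin N → Bool) where
  toFun A i := decide (i ∈ A)
  invFun v := Finset.univ.filter fun i => v i = true
  left_inv A := by ext; simp
  right_inv v := by ext; simp

theorem sum_card_eq (s N : ℕ) (X : (Fin N → Bool) → R) :
    ∑ A : {A : Finset (Fin N) // A.card = s}, X (fun i => decide (i ∈ A.1)) =
      ∑ v, if trueCount v = s then X v else 0 := by
  rw [← (finsetEquivWord N).sum_comp, ← Finset.sum_filter,
    Finset.sum_subtype (p := fun A : Finset (Fin N) => A.card = s)]
  · rfl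
  · intro A
    simp [trueCount, finsetEquivWord]

theorem crossCount_merge [Fintype α] [Fintype β] (A : {A : Finset (Fin (s + m)) // A.card = s})
    (f : α ≃ Fin s) (g : β ≃ Fin m) :
    crossCount (fun i => decide (i ∈ A.1)) =
      ∑ a, ∑ b, if merge A f g (.inr b) < merge A f g (.inl a) then 1 else 0 := by
  rw [crossCount, ← (merge A f g).sum_comp, Fintype.sum_sum_type]
  have : ∀ i, ∑ j, (if decide (merge A f g i ∈ A.1) = true ∧ decide (j ∈ A.1) = false ∧
      j < merge A f g i then 1 else 0) = ∑ j, if decide (merge A f g i ∈ A.1) = true ∧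
      decide (merge A f g j ∈ A.1) = false ∧ merge A f g j < merge A f g i then 1 else 0 :=
    fun i => ((merge A f g).sum_comp fun j => if decide (merge A f g i ∈ A.1) = true ∧
      decide (j ∈ A.1) = false ∧ j < merge A f g i then 1 else 0).symm
  simp only [this]
  simp [Fintype.sum_sum_type, merge_inl_mem, merge_inr_notMem, -Finset.sum_boole]

theorem exists_merge_lt {k : ℕ} (A : {A : Finset (Fin (k + 1 + m)) // A.card = k + 1})
    (f : α ≃ Fin (k + 1)) (g : β ≃ Fin m) {a : α} (ha : f a = 0) :
    (∃ b, merge A f g (.inr b) < merge A f g (.inl a)) ↔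
      ¬ ∀ i, decide (i ∈ A.1) = false → 0 < (i : ℕ) := by
  simp only [decide_eq_false_iff_not]
  push Not
  constructor
  · rintro ⟨b, hb⟩
    obtain ⟨a' | b', hx⟩ := (merge A f g).surjective ⟨0, by omega⟩
    · have h1 : ¬ f a' < f a := by rw [ha]; exact Fin.not_lt_zero _
      rw [← merge_inl_lt A f g, hx, not_lt] at h1
      exact absurd (hb.trans_le h1) (Nat.not_lt_zero _)
    · exact ⟨_, hx ▸ merge_inr_notMem A f g b', le_rfl⟩
  · rintro ⟨i, hi, hi0⟩
    obtain ⟨a' | b', rfl⟩ := (merge A f g).surjective i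
    · exact absurd (merge_inl_mem _ _ _ _) hi
    · refine ⟨b', lt_of_le_of_ne (Fin.le_def.2 (by omega)) ?_⟩
      intro h
      simpa using (merge A f g).injective h

end Shuffles

section NaturalSums

variable {R : Type*} [CommRing R] (q : R)

open scoped Classical in
theorem sum_natural {T : PlaneTree} {N : ℕ} (hN : T.size = N) (F : (Edge T → Edge T → Prop) → R) :
    ∑ L ∈ naturalLabellings T, F (fun e e' => L e < L e') =
      ∑ L : Edge T ≃ Fin N, if ∀ e e', Above e e' → L e < L e' then F (fun e e' => L e < L e')
        else 0 := by
  rw [← card_edge] at hN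
  subst hN
  rw [naturalLabellings, Finset.sum_filter]
  exact Finset.sum_congr rfl fun L _ => if_congr Iff.rfl rfl rfl

open scoped Classical in
/-- The factor that records the comparisons between the labels of two parts of a tree. -/
noncomputable def nodeFactor {d a : Bool} {c r : PlaneTree} (x : R)
    (lt : Edge (.node d a c r) → Edge (.node d a c r) → Prop) : R :=
  q ^ (∑ e : Option (Edge c), ∑ e' : Edge r,
      if lt (.later e') (edgeEquiv d a c r (.inl e)) then 1 else 0) *
    if ∃ e', lt (.later e') .top then x else 1

open scoped Classical in
theorem sum_natural_node {d a : Bool} {c r : PlaneTree} (F : (Edge c → Edge c → Prop) → R)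
    (G : (Edge r → Edge r → Prop) → R) (x : R) :
    ∑ L ∈ naturalLabellings (.node d a c r), nodeFactor q x (fun e e' => L e < L e') *
      F (fun e e' => L (.under e) < L (.under e')) * G (fun e e' => L (.later e) < L (.later e')) =
    shuffleSum q c.size r.size x * (∑ L ∈ naturalLabellings c, F fun e e' => L e < L e') *
      ∑ L ∈ naturalLabellings r, G fun e e' => L e < L e' := by
  refine (sum_natural (T := .node d a c r) (N := c.size + 1 + r.size) rfl (fun lt => nodeFactor q x lt *
      F (fun e e' => lt (.under e) (.under e')) * G (fun e e' => lt (.later e) (.later e')))).trans ?_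
  rw [sum_natural rfl F, sum_natural rfl G, ← sum_crossCount_factor q c.size r.size _ rfl x,
    ← sum_card_eq (c.size + 1) (c.size + 1 + r.size) fun v => q ^ crossCount v *
      if ∀ i, v i = false → 0 < (i : ℕ) then 1 else x]
  rw [← (Equiv.equivCongr (edgeEquiv d a c r) (Equiv.refl (Fin (c.size + 1 + r.size)))).sum_comp,
    sum_merge (s := c.size + 1) (m := r.size) (by rw [Fintype.card_option, card_edge])]
  rw [Finset.sum_mul, Finset.sum_mul]
  refine Finset.sum_congr rfl fun A _ => ?_
  have h1 := sum_optionEquiv (α := Edge c) (k := c.size) (fun f =>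
    if ∀ e e', Above e e' → f (some e) < f (some e') then F fun e e' => f (some e) < f (some e') else 0)
  have h2 : ∑ f : Edge c ≃ Fin c.size, (if ∀ e e', Above e e' → f e < f e' then
      F fun e e' => f e < f e' else 0) = ∑ L : Option (Edge c) ≃ Fin (c.size + 1),
      if L none = 0 then (if ∀ e e', Above e e' → L (some e) < L (some e') then
        F fun e e' => L (some e) < L (some e') else 0) else 0 := by
    rw [h1]
    refine Finset.sum_congr rfl fun f _ => ?_
    simp
  rw [h2, mul_assoc, Finset.sum_mul_sum, Finset.mul_sum]
  refine Finset.sum_congr rfl fun f _ => ?_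
  rw [Finset.mul_sum]
  refine Finset.sum_congr rfl fun g _ => ?_
  have e1 : ∀ e, Equiv.equivCongr (edgeEquiv d a c r) (Equiv.refl (Fin (c.size + 1 + r.size))) (merge A f g)
      (edgeEquiv d a c r e) = merge A f g e := by intro e; simp [Equiv.equivCongr]
  have et := e1 (.inl none)
  have eu := fun e => e1 (.inl (some e))
  have el := fun e => e1 (.inr e)
  generalize Equiv.equivCongr (edgeEquiv d a c r) (Equiv.refl (Fin (c.size + 1 + r.size))) (merge A f g) = L at *
  change L .top = _ at et
  change ∀ e, L (.under e) = _ at eu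
  change ∀ e, L (.later e) = _ at el
  have hnat : (∀ e e', Above e e' → L e < L e') ↔ f none = 0 ∧
      (∀ e e', Above e e' → f (some e) < f (some e')) ∧ ∀ e e', Above e e' → g e < g e' := by
    have h0 : f none = 0 ↔ ∀ e, f none < f (some e) := by
      constructor
      · intro h e
        rw [h, Fin.pos_iff_ne_zero, ← h]
        simp
      · intro h
        obtain ⟨y, hy⟩ := f.surjective 0
        rcases y with _ | y
        · exact hy
        · exact absurd (hy ▸ h y) (Fin.not_lt_zero _)
    rw [h0]
    constructor
    · intro h
      refine ⟨fun e => ?_, fun e e' he => ?_, fun e e' he => ?_⟩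
      · have := h .top (.under e) trivial
        rwa [et, eu, merge_inl_lt] at this
      · have := h (.under e) (.under e') he
        rwa [eu, eu, merge_inl_lt] at this
      · have := h (.later e) (.later e') he
        rwa [el, el, merge_inr_lt] at this
    · rintro ⟨h1, h2, h3⟩ e e' he
      cases e <;> cases e' <;> first | exact he.elim | skip
      · rw [et, eu, merge_inl_lt]; exact h1 _
      · rw [eu, eu, merge_inl_lt]; exact h2 _ _ he
      · rw [el, el, merge_inr_lt]; exact h3 _ _ he
  by_cases hn : f none = 0
  · by_cases hc : ∀ e e', Above e e' → f (some e) < f (some e')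
    · by_cases hg : ∀ e e', Above e e' → g e < g e'
      · rw [if_pos (hnat.2 ⟨hn, hc, hg⟩), if_pos hn, if_pos hc, if_pos hg, crossCount_merge A f g, nodeFactor]
        have hm := exists_merge_lt A f g hn
        simp only [e1, eu, el, et, merge_inl_lt, merge_inr_lt, hm]
        by_cases hz : ∀ i, decide (i ∈ A.1) = false → 0 < (i : ℕ)
        · rw [if_neg (not_not.2 hz), if_pos hz]; ring
        · rw [if_pos hz, if_neg hz]; ring
      · rw [if_neg (fun h => hg (hnat.1 h).2.2), if_neg hg]; ring
    · rw [if_neg (fun h => hc (hnat.1 h).2.1), if_neg hc]; simp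
  · rw [if_neg (fun h => hn (hnat.1 h).1), if_neg hn]; simp

end NaturalSums

/-! ### The recursion for the labellings -/

section Arrows

variable {d a : Bool} {c r : PlaneTree}

theorem transGen_map_iff {α β : Type*} {s : α → α → Prop} {s' : β → β → Prop} {f : α → β}
    (h : ∀ x y, s' (f x) y ↔ ∃ z, y = f z ∧ s x z) (x : α) (y : β) :
    Relation.TransGen s' (f x) y ↔ ∃ z, y = f z ∧ Relation.TransGen s x z := by
  constructor
  · intro hy
    induction hy with
    | single hy =>
      obtain ⟨z, rfl, hz⟩ := (h _ _).1 hy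
      exact ⟨z, rfl, .single hz⟩
    | tail _ hy ih =>
      obtain ⟨z, rfl, hz⟩ := ih
      obtain ⟨z', rfl, hz'⟩ := (h _ _).1 hy
      exact ⟨z', rfl, hz.tail hz'⟩
  · rintro ⟨z, rfl, hz⟩
    induction hz with
    | single hz => exact .single ((h _ _).2 ⟨_, rfl, hz⟩)
    | tail _ hz ih => exact ih.tail ((h _ _).2 ⟨_, rfl, hz⟩)

theorem arrow_under_iff (e : Edge c) (e' : Edge (.node d a c r)) :
    Arrow (.under e) e' ↔ ∃ z, e' = .under z ∧ Arrow e z := by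
  cases e' <;> simp [Arrow]

theorem arrow_later_iff (e : Edge r) (e' : Edge (.node d a c r)) :
    Arrow (.later e) e' ↔ ∃ z, e' = .later z ∧ Arrow e z := by
  cases e' <;> simp [Arrow]

theorem arrow_top_iff (e' : Edge (.node d a c r)) :
    Arrow .top e' ↔ ∃ z, e' = .later z ∧ a = true ∧ IsTop z := by
  cases e' <;> simp [Arrow]

theorem hasIncoming_under (e : Edge c) :
    HasIncoming (.under e : Edge (.node d a c r)) ↔ HasIncoming e := by
  simp [HasIncoming, arrow_under_iff]

theorem hasIncoming_later (e : Edge r) :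
    HasIncoming (.later e : Edge (.node d a c r)) ↔ HasIncoming e := by
  simp [HasIncoming, arrow_later_iff]

theorem inA_later (e : Edge r) : InA (.later e : Edge (.node d a c r)) ↔ InA e := by
  unfold InA
  rw [hasIncoming_later]
  refine and_congr Iff.rfl (and_congr Iff.rfl ⟨fun h e' he => ?_, fun h e' he => ?_⟩)
  · exact fun h' => h (.later e') he (hasIncoming_later e' |>.2 h')
  · cases e' with
    | later e' => exact fun h' => h e' he (hasIncoming_later e' |>.1 h')
    | top => exact he.elim
    | under => exact he.elim

theorem inA_under (e : Edge c) :
    InA (.under e : Edge (.node d a c r)) ↔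
      InA e ∧ ¬ HasIncoming (.top : Edge (.node d a c r)) := by
  unfold InA
  rw [hasIncoming_under, and_assoc, and_assoc]
  refine and_congr Iff.rfl (and_congr Iff.rfl ⟨fun h => ⟨fun e' he h' => ?_, ?_⟩, fun h e' he => ?_⟩)
  · exact h (.under e') he (hasIncoming_under e' |>.2 h')
  · exact h .top trivial
  · cases e' with
    | later e' => exact he.elim
    | top => exact h.2
    | under e' => exact fun h' => h.1 e' he (hasIncoming_under e' |>.1 h')

theorem circledBy_later (lt : Edge (.node d a c r) → Edge (.node d a c r) → Prop) (e : Edge r) :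
    CircledBy lt (.later e) ↔ CircledBy (fun e e' => lt (.later e) (.later e')) e := by
  simp only [CircledBy, hasIncoming_later, Dotted, transGen_map_iff arrow_later_iff]
  simp

theorem circledBy_under (lt : Edge (.node d a c r) → Edge (.node d a c r) → Prop) (e : Edge c) :
    CircledBy lt (.under e) ↔ CircledBy (fun e e' => lt (.under e) (.under e')) e := by
  simp only [CircledBy, hasIncoming_under, Dotted, transGen_map_iff arrow_under_iff]
  simp

theorem not_dotted_of_isPlain {T : PlaneTree} (hT : IsPlain T) (e : Edge T) : ¬ Dotted e := by
  induction e with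
  | top => simp [Dotted, hT.1]
  | under e ih => exact ih hT.2.2.1
  | later e ih => exact ih hT.2.2.2

theorem not_hasIncoming_of_isPlain {T : PlaneTree} (hT : IsPlain T) (e : Edge T) :
    ¬ HasIncoming e := by
  induction e with
  | top => simp [HasIncoming, arrow_top_iff, hT.2.1]
  | under e ih => rw [hasIncoming_under]; exact ih hT.2.2.1
  | later e ih => rw [hasIncoming_later]; exact ih hT.2.2.2

theorem inA_of_isPlain {T : PlaneTree} (hT : IsPlain T) (e : Edge T) : InA e :=
  ⟨not_dotted_of_isPlain hT e, not_hasIncoming_of_isPlain hT e,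
    fun e' _ => not_hasIncoming_of_isPlain hT e'⟩

/-- Every edge is below, or equal to, an edge that is connected by arrows with the leftmost edge at
the root. -/
theorem BaseWord.exists_reflTransGen {w k T} (h : BaseWord w k T) (hk : Odd k) (e : Edge T) :
    ∃ t e', IsTop t ∧ Relation.ReflTransGen Arrow t e' ∧ (e' = e ∨ Above e' e) := by
  induction h with
  | nil => simp at hk
  | edge hc hr ih =>
    cases e with
    | top => exact ⟨.top, .top, trivial, .refl, .inl rfl⟩
    | under e => exact ⟨.top, .top, trivial, .refl, .inr trivial⟩
    | later e =>
      obtain ⟨t, e', h1, h2, h3⟩ := ih hk e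
      refine ⟨.top, .later e', trivial, .head (b := .later t) ?_ ?_, ?_⟩
      · exact ⟨decide_eq_true hk, h1⟩
      · exact h2.lift Edge.later fun _ _ h => h
      · rcases h3 with rfl | h3
        · exact .inl rfl
        · exact .inr h3
  | dot hk' hr ih =>
    cases e with
    | top => exact ⟨.top, .top, trivial, .refl, .inl rfl⟩
    | under e => exact ⟨.top, .top, trivial, .refl, .inr trivial⟩
    | later e => exact isEmptyElim e
  | up hk' => exact absurd hk' (by simpa [parity_simps] using hk)

theorem BaseWord.exists_isTop {w k T} (h : BaseWord w k T) (hk : Odd k) :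
    ∃ t : Edge T, IsTop t := by
  induction h with
  | nil => simp at hk
  | edge hc hr ih => exact ⟨.top, trivial⟩
  | dot hk' hr ih => exact ⟨.top, trivial⟩
  | up hk' => exact absurd hk' (by simpa [parity_simps] using hk)

theorem circledBy_top {w k} (hr : BaseWord w k r) (hk : Odd k)
    {L : Edge (.node false true c r) → ℕ} (hL : ∀ e e', Above e e' → L e < L e') :
    CircledBy (fun e e' => L e < L e') (.top : Edge (.node false true c r)) ↔
      ∃ e', L (.later e') < L .top := by
  obtain ⟨t₀, ht₀⟩ := hr.exists_isTop hk
  have hi : HasIncoming (.top : Edge (.node false true c r)) := ⟨.later t₀, rfl, ht₀⟩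
  rw [CircledBy]
  simp only [Dotted, hi, not_true_eq_false, false_or, Bool.false_eq_true, not_false_eq_true, true_and]
  constructor
  · rintro ⟨e', h1, h2⟩
    cases e' with
    | later e' => exact ⟨e', h2⟩
    | top => exact absurd h2 (lt_irrefl _)
    | under e' => exact absurd h2 (hL .top (.under e') trivial).not_gt
  · rintro ⟨e, he⟩
    obtain ⟨t, e', h1, h2, h3⟩ := hr.exists_reflTransGen hk e
    have h0 : Arrow (.top : Edge (.node false true c r)) (.later t) := ⟨rfl, h1⟩
    refine ⟨.later e', .head' h0 (h2.lift Edge.later fun _ _ h => h), ?_⟩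
    rcases h3 with rfl | h3
    · exact he
    · exact (hL (.later e') (.later e) h3).trans he

end Arrows

section Recursion

theorem isNatural_of_mem {T : PlaneTree} {L : Labelling T} (hL : L ∈ naturalLabellings T) :
    IsNatural L := by
  classical
  rw [naturalLabellings, Finset.mem_filter] at hL
  exact hL.2

variable {R : Type*} [CommRing R] (q : R) {d a : Bool} {c r : PlaneTree}

theorem edgeFactor_later (lt : Edge (.node d a c r) → Edge (.node d a c r) → Prop) (e : Edge r) :
    edgeFactor q lt (.later e) = edgeFactor q (fun e e' => lt (.later e) (.later e')) e := by
  rw [edgeFactor, edgeFactor, S_later]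
  congr 1
  · rw [inA_later]
  · congr 1
    rw [circledBy_later]

open scoped Classical in
theorem invCount_node (lt : Edge (.node d a c r) → Edge (.node d a c r) → Prop) :
    invCount lt = (∑ e : Option (Edge c), ∑ e' : Edge r,
      if lt (.later e') (edgeEquiv d a c r (.inl e)) then 1 else 0) +
      invCount (fun e e' => lt (.under e) (.under e')) +
      invCount (fun e e' => lt (.later e) (.later e')) := by
  unfold invCount
  simp only [sum_edge, Fintype.sum_option, StrictlyRight, and_false, and_true, if_false,
    Finset.sum_const_zero, zero_add, Finset.sum_add_distrib]
  have h1 : edgeEquiv d a c r (.inl none) = .top := rfl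
  have h2 : ∀ e, edgeEquiv d a c r (.inl (some e)) = .under e := fun _ => rfl
  simp only [h1, h2]
  ring

theorem pow_invCount_node (lt : Edge (.node d a c r) → Edge (.node d a c r) → Prop) :
    q ^ invCount lt = nodeFactor q 1 lt * q ^ invCount (fun e e' => lt (.under e) (.under e')) *
      q ^ invCount (fun e e' => lt (.later e) (.later e')) := by
  rw [invCount_node, nodeFactor, ite_self, mul_one, pow_add, pow_add]

theorem sum_natural_nil (F : (Edge .nil → Edge .nil → Prop) → R) :
    ∑ L ∈ naturalLabellings .nil, F (fun e e' => L e < L e') = F fun e => isEmptyElim e := by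
  rw [sum_natural (T := .nil) (N := 0) rfl F, 
    Fintype.sum_eq_single (Equiv.equivOfIsEmpty _ _) fun L hL => absurd (Subsingleton.elim _ _) hL,
    if_pos fun e => isEmptyElim e]
  congr 1
  funext e
  exact isEmptyElim e

theorem sum_pow_invCount (T : PlaneTree) :
    ∑ L ∈ naturalLabellings T, q ^ invCount (fun e e' => L e < L e') = invSum q T := by
  induction T with
  | nil =>
    rw [sum_natural_nil fun lt => q ^ invCount lt]
    simp [invCount, invSum]
  | node d a c r hc hr =>
    have h := sum_natural_node q (d := d) (a := a) (c := c) (r := r) (fun lt => q ^ invCount lt)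
      (fun lt => q ^ invCount lt) 1
    simp only [hc, hr, shuffleSum_one] at h
    rw [invSum, ← h]
    exact Finset.sum_congr rfl fun L _ => pow_invCount_node q _

theorem labelWeight_plain (hc : IsPlain c)
    (lt : Edge (.node false false c r) → Edge (.node false false c r) → Prop) :
    labelWeight q lt = nodeFactor q 1 lt *
      (q ^ invCount (fun e e' => lt (.under e) (.under e')) *
        ∏ i ∈ Finset.range (c.size + 1), (1 + q ^ (r.size + 1 + i))) *
      labelWeight q (fun e e' => lt (.later e) (.later e')) := by
  have hi : ¬ HasIncoming (.top : Edge (.node false false c r)) := by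
    simp [HasIncoming, arrow_top_iff]
  have ht : edgeFactor q lt .top = 1 + q ^ (r.size + 1) := by
    have : InA (.top : Edge (.node false false c r)) := by
      refine ⟨by simp [Dotted], hi, fun e' he => ?_⟩
      cases e' <;> exact he.elim
    rw [edgeFactor, if_pos this, S_top]
  have hu : ∀ e : Edge c, edgeFactor q lt (.under e) = 1 + q ^ (S e + (r.size + 1)) := by
    intro e
    rw [edgeFactor, if_pos ((inA_under e).2 ⟨inA_of_isPlain hc e, hi⟩), S_under]
  rw [labelWeight, pow_invCount_node, prod_edge, ht]
  simp only [hu, edgeFactor_later]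
  rw [prod_S hc fun i => 1 + q ^ (i + (r.size + 1)), labelWeight, Finset.prod_range_succ']
  have : ∀ i, 1 + q ^ (i + 1 + (r.size + 1)) = 1 + q ^ (r.size + 1 + (i + 1)) := fun i => by
    congr 2; ring
  simp only [this, add_zero]
  ring

theorem labelWeight_arrow {w k} (hr : BaseWord w k r) (hk : Odd k) (hc : IsPlain c)
    {L : Edge (.node false true c r) → ℕ} (hL : ∀ e e', Above e e' → L e < L e') :
    labelWeight q (fun e e' => L e < L e') =
      nodeFactor q (1 + q ^ r.size) (fun e e' => L e < L e') *
      (q ^ invCount (fun e e' => L (.under e) < L (.under e')) *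
        ∏ i ∈ Finset.range c.size, (1 + q ^ (r.size + 1 + i))) *
      labelWeight q (fun e e' => L (.later e) < L (.later e')) := by
  obtain ⟨t₀, ht₀⟩ := hr.exists_isTop hk
  have hi : HasIncoming (.top : Edge (.node false true c r)) := ⟨.later t₀, rfl, ht₀⟩
  have hu : ∀ e : Edge c, edgeFactor q (fun e e' => L e < L e') (.under e) =
      1 + q ^ (S e + r.size) := by
    intro e
    have h1 : CircledBy (fun e e' => L (.under e : Edge (.node false true c r)) < L (.under e')) e :=
      ⟨not_dotted_of_isPlain hc e, .inl (not_hasIncoming_of_isPlain hc e)⟩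
    rw [edgeFactor, if_neg fun h => ((inA_under e).1 h).2 hi, if_pos ((circledBy_under _ e).2 h1),
      S_under]
    rfl
  have ht : nodeFactor q 1 (fun e e' => L e < L e') *
      edgeFactor q (fun e e' => L e < L e') .top =
      nodeFactor q (1 + q ^ r.size) (fun e e' => L e < L e') := by
    rw [edgeFactor, if_neg fun h => h.2.1 hi, nodeFactor, nodeFactor, ite_self, mul_one, S_top]
    rw [Nat.add_sub_cancel]
    congr 2
    rw [circledBy_top hr hk hL]
  rw [labelWeight, pow_invCount_node, prod_edge, ← ht]
  simp only [hu, edgeFactor_later]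
  rw [prod_S hc fun i => 1 + q ^ (i + r.size), labelWeight]
  have : ∀ i, 1 + q ^ (i + 1 + r.size) = 1 + q ^ (r.size + 1 + i) := fun i => by
    congr 2; ring
  simp only [this]
  ring

theorem labelWeight_dot (lt : Edge (.node true false c .nil) → Edge (.node true false c .nil) → Prop) :
    labelWeight q lt = nodeFactor q 1 lt *
      labelWeight q (fun e e' => lt (.under e) (.under e')) * 1 := by
  have hi : ¬ HasIncoming (.top : Edge (.node true false c .nil)) := by
    simp [HasIncoming, arrow_top_iff]
  have ht : edgeFactor q lt .top = 1 := by
    rw [edgeFactor, if_neg fun h => h.1 rfl, if_neg fun h => h.1 rfl]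
  have hu : ∀ e : Edge c, edgeFactor q lt (.under e) =
      edgeFactor q (fun e e' => lt (.under e) (.under e')) e := by
    intro e
    rw [edgeFactor, edgeFactor, S_under_dotted]
    congr 1
    · rw [inA_under, and_iff_left hi]
    · congr 1
      rw [circledBy_under]
  rw [labelWeight, pow_invCount_node, prod_edge, ht]
  simp only [hu, Finset.univ_eq_empty, Finset.prod_empty]
  rw [labelWeight]
  have : invCount (fun e e' => lt (.later e) (.later e')) = 0 := by simp [invCount]
  rw [this]
  ring

theorem BaseWord.sum_labelWeight {w k T} (h : BaseWord w k T) :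
    ∑ L ∈ naturalLabellings T, labelWeight q (fun e e' => L e < L e') = treeValue q T := by
  induction h with
  | nil =>
    rw [sum_natural_nil fun lt => labelWeight q lt]
    simp [labelWeight, invCount, treeValue]
  | @edge w k c r hc hr ih =>
    by_cases hk : Odd k
    · rw [decide_eq_true hk, treeValue]
      have h := sum_natural_node q (d := false) (a := true) (c := c) (r := r) (fun lt =>
        q ^ invCount lt * ∏ i ∈ Finset.range c.size, (1 + q ^ (r.size + 1 + i)))
        (labelWeight q) (1 + q ^ r.size)
      rw [ih, ← Finset.sum_mul, sum_pow_invCount, shuffleSum, if_neg] at h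
      · refine (Finset.sum_congr rfl fun L hL => ?_).trans (h.trans (by ring))
        exact labelWeight_arrow q hr hk hc (L := fun e => L e) (isNatural_of_mem hL)
      · obtain ⟨t, -⟩ := hr.exists_isTop hk
        rw [← card_edge]
        exact (Fintype.card_pos_iff.2 ⟨t⟩).ne'
    · rw [decide_eq_false hk, treeValue]
      have h := sum_natural_node q (d := false) (a := false) (c := c) (r := r) (fun lt =>
        q ^ invCount lt * ∏ i ∈ Finset.range (c.size + 1), (1 + q ^ (r.size + 1 + i)))
        (labelWeight q) 1
      rw [ih, ← Finset.sum_mul, sum_pow_invCount, shuffleSum_one] at h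
      refine (Finset.sum_congr rfl fun L hL => ?_).trans (h.trans (by ring))
      exact labelWeight_plain q hc _
  | @dot w k r hk hr ih =>
    rw [treeValue]
    have h := sum_natural_node q (d := true) (a := false) (c := r) (r := .nil) (labelWeight q)
      (fun _ => 1) 1
    rw [ih, shuffleSum_one, sum_natural_nil fun _ => (1 : R)] at h
    refine (Finset.sum_congr rfl fun L hL => ?_).trans (h.trans ?_)
    · exact labelWeight_dot q _
    · simp [size, qBinom]
  | up hk hr ih => exact ih

end Recursion

/-! ### The transfer sums as sums over configurations -/

/-- The stack of bounds after a step with `j` joined levels. -/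
def nextStack : DyckStep → ℕ → (ℕ → ℕ) → ℕ → ℕ
  | U, j, st => push j st
  | D, _, st => fun n => st (n + 1)

/-- The weight of a joined level at a step before the suffix `w`. -/
def stepWeight : DyckStep → List DyckStep → ℕ
  | U, w => dotWeight w
  | D, _ => 1

/-- The possible heights after a step from height `a`, with the possible numbers of joined levels. -/
def stepOptions : DyckStep → (ℕ → ℕ) → ℕ → Finset (ℕ × ℕ)
  | U, st, a => (Finset.Icc (a - 1) a ×ˢ Finset.range (a + 1)).filter fun p => st 0 ≤ p.2 ∧ p.2 ≤ p.1
  | D, st, a => if st 0 ≤ a then Finset.Icc a (a + 1) ×ˢ {st 0} else ∅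

/-- The configurations of a suffix: the list of the heights after each step with the numbers of
joined levels. -/
def configs : List DyckStep → (ℕ → ℕ) → ℕ → Finset (List (ℕ × ℕ))
  | [], _, _ => {[]}
  | s :: w, st, a => (stepOptions s st a).biUnion fun p =>
      (configs w (nextStack s p.2 st) p.1).image (p :: ·)

/-- The number of levels that are joined up to the end of the word. -/
def endJoined : ℕ → List (ℕ × ℕ) → ℕ
  | a, [] => a
  | _, p :: c => min p.2 (endJoined p.1 c)

/-- The parity conditions of a configuration. -/
def ParAll : List DyckStep → ℕ → ℕ → List (ℕ × ℕ) → Prop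
  | s :: w, j, a, p :: c => Par (s :: w) j (endJoined a (p :: c)) ∧ ParAll w p.2 p.1 c
  | w, j, a, c => Par w j (endJoined a c)

/-- The exponent of a configuration. -/
def exponent : List DyckStep → List (ℕ × ℕ) → ℕ
  | s :: w, p :: c => (p.1 - stepWeight s w * p.2) + exponent w c
  | _, _ => 0

section Expansion

variable {R : Type*} [CommRing R] (q : R)

theorem transfer_cons (s : DyckStep) (w : List DyckStep) (φ : ℕ → R) (st : ℕ → ℕ) (a : ℕ) :
    transfer q (s :: w) φ st a = ∑ p ∈ stepOptions s st a,
      q ^ (p.1 - stepWeight s w * p.2) * transfer q w (twist w p.2 φ) (nextStack s p.2 st) p.1 := by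
  cases s with
  | U =>
    rw [transfer, stepOptions, Finset.sum_filter, Finset.sum_product]
    refine Finset.sum_congr rfl fun b hb => ?_
    rw [← Finset.sum_filter]
    refine Finset.sum_congr ?_ fun j _ => rfl
    ext j
    simp only [Finset.mem_Icc, Finset.mem_filter, Finset.mem_range] at hb ⊢
    omega
  | D =>
    rw [transfer, stepOptions]
    split_ifs with h
    · rw [Finset.sum_product]
      simp [stepWeight, nextStack]
    · simp

open scoped Classical in
theorem transfer_eq_sum (w : List DyckStep) (φ : ℕ → R) (st : ℕ → ℕ) (j a : ℕ) :
    transfer q w (twist w j φ) st a = ∑ c ∈ configs w st a, q ^ exponent w c *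
      if ParAll w j a c then φ (min j (endJoined a c)) else 0 := by
  induction w generalizing φ st j a with
  | nil =>
    simp only [transfer, configs, exponent, ParAll, endJoined, twist, Finset.sum_singleton, pow_zero,
      one_mul]
    congr
  | cons s w ih =>
    rw [transfer_cons, configs, Finset.sum_biUnion]
    · refine Finset.sum_congr rfl fun p _ => ?_
      rw [ih, Finset.sum_image (fun x _ y _ h => List.tail_eq_of_cons_eq h), Finset.mul_sum]
      refine Finset.sum_congr rfl fun c _ => ?_
      rw [exponent, pow_add, mul_assoc, twist, ParAll]
      congr 2
      by_cases h1 : ParAll w p.2 p.1 c <;> simp [h1, endJoined]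
    · intro p _ p' _ hp
      rw [Function.onFun, Finset.disjoint_left]
      intro c hc hc'
      obtain ⟨x, -, rfl⟩ := Finset.mem_image.1 hc
      obtain ⟨y, -, h⟩ := Finset.mem_image.1 hc'
      exact hp (List.head_eq_of_cons_eq h).symm

end Expansion

/-- The heights of a configuration that starts at height `a`. -/
def heightFun (a : ℕ) (c : List (ℕ × ℕ)) (x : ℕ) : ℕ := (a :: c.map Prod.fst).getD x 0

/-- The numbers of joined levels of a configuration. -/
def joinFun (c : List (ℕ × ℕ)) (s : ℕ) : ℕ := (c.map Prod.snd).getD s 0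

/-- The function `j` shifted by one, with first value `j₀`. -/
def prevFun (j₀ : ℕ) (j : ℕ → ℕ) : ℕ → ℕ
  | 0 => j₀
  | n + 1 => j n

/-- The height over its start of the run of joined steps at each level, where `t` is the initial
value. -/
def runHeight (w : List DyckStep) (j : ℕ → ℕ) (t : ℕ → ℤ) : ℕ → ℕ → ℤ
  | 0 => t
  | x + 1 => fun k => if k < j x then runHeight w j t x k + (height w (x + 1) - height w x) else 0

theorem height_succ (w : List DyckStep) {x : ℕ} (hx : x < w.length) :
    height w (x + 1) - height w x = 1 ∨ height w (x + 1) - height w x = -1 := by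
  induction w generalizing x with
  | nil => simp at hx
  | cons s w ih =>
    rcases x with _ | x
    · cases s
      · rw [height_cons_U, height_zero, height_zero]; simp
      · rw [height_cons_D, height_zero, height_zero]; simp
    · have := ih (x := x) (by simpa using hx)
      cases s
      · rw [height_cons_U, height_cons_U]; omega
      · rw [height_cons_D, height_cons_D]; omega

theorem height_cons_sub (s : DyckStep) (w : List DyckStep) (x : ℕ) :
    height (s :: w) (x + 1 + 1) - height (s :: w) (x + 1) = height w (x + 1) - height w x := by
  cases s
  · rw [height_cons_U, height_cons_U]; ring
  · rw [height_cons_D, height_cons_D]; ring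

theorem runHeight_cons (s : DyckStep) (w : List DyckStep) (j : ℕ → ℕ) (t : ℕ → ℤ) (x : ℕ) :
    runHeight (s :: w) j t (x + 1) =
      runHeight w (fun n => j (n + 1)) (runHeight (s :: w) j t 1) x := by
  induction x with
  | zero => rfl
  | succ x ih =>
    funext k
    rw [runHeight, ih, height_cons_sub]
    rfl

/-- The local conditions for the heights and the numbers of joined levels. -/
structure LocalAt (w : List DyckStep) (t : ℕ → ℤ) (h j : ℕ → ℕ) (x : ℕ) : Prop where
  step : height w (x + 1) - height w x + 2 * ((h (x + 1) : ℤ) - h x) = 1 ∨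
    height w (x + 1) - height w x + 2 * ((h (x + 1) : ℤ) - h x) = -1
  le_left : j x ≤ h x
  le_right : j x ≤ h (x + 1)
  closed : ∀ k, j x ≤ k → runHeight w j t x k = 0
  ballot : ∀ k, 0 ≤ runHeight w j t (x + 1) k

theorem localAt_cons (s : DyckStep) (w : List DyckStep) (t : ℕ → ℤ) (h j : ℕ → ℕ) (x : ℕ) :
    LocalAt (s :: w) t h j (x + 1) ↔ LocalAt w (runHeight (s :: w) j t 1) (fun n => h (n + 1))
      (fun n => j (n + 1)) x := by
  constructor
  · rintro ⟨h1, h2, h3, h4, h5⟩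
    rw [height_cons_sub] at h1
    rw [runHeight_cons] at h4 h5
    exact ⟨h1, h2, h3, h4, h5⟩
  · rintro ⟨h1, h2, h3, h4, h5⟩
    rw [← height_cons_sub s] at h1
    rw [← runHeight_cons] at h4 h5
    exact ⟨h1, h2, h3, h4, h5⟩

/-- The stack of bounds `st` corresponds to the run heights `t`. -/
def StackRel (st : ℕ → ℕ) (t : ℕ → ℤ) : Prop := ∀ k, 0 ≤ t k ∧ ∀ n, k < st n ↔ (n : ℤ) < t k

theorem localAt_zero_iff {s : DyckStep} {w : List DyckStep} {st : ℕ → ℕ} {t : ℕ → ℤ}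
    (hst : StackRel st t) (h j : ℕ → ℕ) :
    LocalAt (s :: w) t h j 0 ↔ (h 1, j 0) ∈ stepOptions s st (h 0) := by
  have h0 := height_zero (s :: w)
  cases s with
  | U =>
    have h1 : height (U :: w) 1 = 1 := by rw [height_cons_U, height_zero]; rfl
    simp only [stepOptions, Finset.mem_filter, Finset.mem_product, Finset.mem_Icc, Finset.mem_range]
    constructor
    · rintro ⟨h2, h3, h4, h5, h6⟩
      rw [zero_add, h0, h1] at h2
      rw [zero_add] at h4
      have h7 : st 0 ≤ j 0 := by
        by_contra hlt
        have := (hst (j 0)).2 0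
        have := h5 (j 0) le_rfl
        simp only [runHeight] at this
        omega
      omega
    · rintro ⟨⟨⟨h2, h3⟩, h4⟩, h5, h6⟩
      refine ⟨?_, by omega, h6, fun k hk => ?_, fun k => ?_⟩
      · rw [zero_add, h0, h1]; omega
      · have := hst k
        have := this.2 0
        simp only [runHeight]
        omega
      · have := (hst k).1
        simp only [runHeight, zero_add, h0, h1]
        split_ifs <;> omega
  | D =>
    have h1 : height (D :: w) 1 = -1 := by rw [height_cons_D, height_zero]; rfl
    have e : (h 1, j 0) ∈ stepOptions D st (h 0) ↔ st 0 ≤ h 0 ∧ (h 0 ≤ h 1 ∧ h 1 ≤ h 0 + 1) ∧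
        j 0 = st 0 := by
      rw [stepOptions]
      split_ifs with h <;> simp [h, and_assoc, eq_comm]
    rw [e]
    constructor
    · rintro ⟨h2, h3, h4, h5, h6⟩
      rw [zero_add, h0, h1] at h2
      rw [zero_add] at h4
      have h7 : st 0 ≤ j 0 := by
        by_contra hlt
        have := (hst (j 0)).2 0
        have := h5 (j 0) le_rfl
        simp only [runHeight] at this
        omega
      have h8 : j 0 ≤ st 0 := by
        by_contra hlt
        have h9 := (hst (st 0)).2 0
        have := h6 (st 0)
        simp only [runHeight, zero_add, h0, h1] at this
        rw [if_pos (by omega)] at this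
        omega
      omega
    · rintro ⟨h2, ⟨h3, h4⟩, h5⟩
      refine ⟨?_, by omega, ?_, fun k hk => ?_, fun k => ?_⟩
      · rw [zero_add, h0, h1]; omega
      · rw [zero_add]; omega
      · have := hst k
        have := this.2 0
        simp only [runHeight]
        omega
      · have := (hst k).2 0
        simp only [runHeight, zero_add, h0, h1]
        split_ifs <;> omega

theorem stackRel_next {s : DyckStep} {w : List DyckStep} {st : ℕ → ℕ} {t : ℕ → ℤ}
    (hst : StackRel st t) {h j : ℕ → ℕ} (hl : LocalAt (s :: w) t h j 0) :
    StackRel (nextStack s (j 0) st) (runHeight (s :: w) j t 1) := by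
  have h0 := height_zero (s :: w)
  intro k
  refine ⟨hl.ballot k, fun n => ?_⟩
  have hc := hl.closed k
  have hb := hl.ballot k
  have ht := hst k
  simp only [runHeight, zero_add, h0] at hc hb ⊢
  cases s with
  | U =>
    have h1 : height (U :: w) 1 = 1 := by rw [height_cons_U, height_zero]; rfl
    rw [h1] at hb ⊢
    rcases n with _ | n
    · simp only [nextStack, push_zero]
      split_ifs <;> simp <;> omega
    · have := ht.2 n
      simp only [nextStack, push_succ]
      split_ifs <;> push_cast <;> omega
  | D =>
    have h1 : height (D :: w) 1 = -1 := by rw [height_cons_D, height_zero]; rfl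
    rw [h1] at hb ⊢
    have := ht.2 (n + 1)
    simp only [nextStack]
    split_ifs <;> push_cast at * <;> omega

theorem mem_configs {w : List DyckStep} {st : ℕ → ℕ} {t : ℕ → ℤ} (hst : StackRel st t) {a : ℕ}
    {c : List (ℕ × ℕ)} : c ∈ configs w st a ↔
      c.length = w.length ∧ ∀ x < w.length, LocalAt w t (heightFun a c) (joinFun c) x := by
  induction w generalizing st t a c with
  | nil => simp [configs]
  | cons s w ih =>
    rw [configs]
    simp only [Finset.mem_biUnion, Finset.mem_image]
    constructor
    · rintro ⟨p, hp, c, hc, rfl⟩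
      have h0 := (localAt_zero_iff (w := w) hst (heightFun a (p :: c)) (joinFun (p :: c))).2 hp
      obtain ⟨h1, h2⟩ := (ih (stackRel_next hst h0)).1 hc
      refine ⟨by simp [h1], fun x hx => ?_⟩
      rcases x with _ | x
      · exact h0
      · exact (localAt_cons _ _ _ _ _ _).2 (h2 x (by simpa using hx))
    · rintro ⟨h1, h2⟩
      obtain ⟨p, c, rfl⟩ := List.exists_cons_of_length_eq_add_one (by simpa using h1)
      have h0 := h2 0 (by simp)
      refine ⟨p, (localAt_zero_iff hst _ _).1 h0, c, (ih (stackRel_next hst h0)).2 ⟨?_, ?_⟩, rfl⟩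
      · simpa using h1
      · exact fun x hx => (localAt_cons _ _ _ _ _ _).1 (h2 (x + 1) (by simpa using hx))

theorem lt_endJoined_iff {a k : ℕ} {c : List (ℕ × ℕ)} :
    k < endJoined a c ↔ k < heightFun a c c.length ∧ ∀ x < c.length, k < joinFun c x := by
  induction c generalizing a with
  | nil => simp [endJoined, heightFun]
  | cons p c ih =>
    rw [endJoined, lt_min_iff, ih, List.length_cons, and_left_comm]
    refine and_congr Iff.rfl ⟨?_, fun h => ⟨h 0 (by simp), fun x hx => h (x + 1) (by simpa using hx)⟩⟩
    rintro ⟨h1, h2⟩ (_ | x) hx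
    · exact h1
    · exact h2 x (by simpa using hx)

theorem parAll_iff {w : List DyckStep} {j a : ℕ} {c : List (ℕ × ℕ)} (hc : c.length = w.length) :
    ParAll w j a c ↔ ∀ x ≤ w.length,
      Par (w.drop x) (prevFun j (joinFun c) x) (endJoined (heightFun a c x) (c.drop x)) := by
  induction w generalizing j a c with
  | nil =>
    obtain rfl := List.length_eq_zero_iff.1 hc
    simp [ParAll, heightFun, prevFun]
  | cons s w ih =>
    obtain ⟨p, c, rfl⟩ := List.exists_cons_of_length_eq_add_one (by simpa using hc)
    rw [ParAll, ih (by simpa using hc)]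
    constructor
    · rintro ⟨h1, h2⟩ (_ | x) hx
      · exact h1
      · have := h2 x (by simpa using hx)
        rcases x with _ | x <;> exact this
    · intro h
      refine ⟨h 0 (by simp), fun x hx => ?_⟩
      have := h (x + 1) (by simpa using hx)
      rcases x with _ | x <;> exact this

/-- The weight of a joined level at the step of `w` from `x` to `x + 1`. -/
def weightAt (w : List DyckStep) (x : ℕ) : ℕ :=
  match w.drop x with
  | [] => 0
  | s :: v => stepWeight s v

theorem exponent_eq {w : List DyckStep} (a : ℕ) {c : List (ℕ × ℕ)} (hc : c.length = w.length) :
    exponent w c = ∑ x ∈ Finset.range w.length,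
      (heightFun a c (x + 1) - weightAt w x * joinFun c x) := by
  induction w generalizing a c with
  | nil => simp [exponent]
  | cons s w ih =>
    obtain ⟨p, c, rfl⟩ := List.exists_cons_of_length_eq_add_one (by simpa using hc)
    rw [exponent, ih p.1 (by simpa using hc), List.length_cons, Finset.sum_range_succ', add_comm]
    rfl

/-! ### Runs of joined boxes and tilings -/

theorem count_add_count (w : List DyckStep) : w.count U + w.count D = w.length := by
  induction w with
  | nil => rfl
  | cons s w ih => cases s <;> simp <;> omega

theorem height_of_length_le {w : List DyckStep} {x : ℕ} (hx : w.length ≤ x) :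
    height w x = height w w.length := by
  simp [height, List.take_of_length_le hx]

theorem height_length (w : List DyckStep) :
    height w w.length = (w.count U : ℤ) - (w.count D : ℤ) := by
  simp [height]

theorem eq_of_height_eq {v w : List DyckStep} (hl : v.length = w.length)
    (h : ∀ x ≤ v.length, height v x = height w x) : v = w := by
  induction v generalizing w with
  | nil => exact (List.length_eq_zero_iff.1 hl.symm).symm
  | cons s v ih =>
    obtain ⟨s', w, rfl⟩ := List.exists_cons_of_length_eq_add_one (by simpa using hl.symm)
    have h1 := h (0 + 1) (by simp)
    have hs : s = s' := by
      cases s <;> cases s' <;> simp only [height_cons_U, height_cons_D, height_zero] at h1 <;>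
        first | rfl | omega
    subst hs
    congr 1
    refine ih (by simpa using hl) fun x hx => ?_
    have := h (x + 1) (by simpa using hx)
    cases s
    · rw [height_cons_U, height_cons_U] at this; omega
    · rw [height_cons_D, height_cons_D] at this; omega

theorem height_infix (w : List DyckStep) {a e i : ℕ} (hi : i ≤ e - a) :
    height ((w.drop a).take (e - a)) i = height w (a + i) - height w a := by
  simp only [height, List.take_take, min_eq_left hi, List.take_add, List.count_append]
  push_cast
  ring

theorem length_infix (w : List DyckStep) {a e : ℕ} (he : e ≤ w.length) :
    ((w.drop a).take (e - a)).length = e - a := by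
  simp; omega

/-- The tile on the level `k` over the steps of `lam` from `a` to `e`. -/
def tile (lam : List DyckStep) (a e k : ℕ) : Tile :=
  ⟨a, height lam a + 2 * k + 1, (lam.drop a).take (e - a)⟩

theorem mem_boxes_tile {lam : List DyckStep} {a e k : ℕ} (hae : a ≤ e) (he : e ≤ lam.length)
    (b : ℕ × ℤ) : b ∈ (tile lam a e k).boxes ↔
      (a ≤ b.1 ∧ b.1 ≤ e) ∧ b.2 = height lam b.1 + 2 * k + 1 := by
  simp only [Tile.boxes, tile, length_infix lam he, Finset.mem_image, Finset.mem_range]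
  constructor
  · rintro ⟨i, hi, rfl⟩
    rw [height_infix lam (by omega)]
    exact ⟨by simp; omega, by ring⟩
  · rintro ⟨⟨h1, h2⟩, h3⟩
    refine ⟨b.1 - a, by omega, ?_⟩
    rw [height_infix lam (by omega), Nat.add_sub_cancel' h1]
    exact Prod.ext rfl (by rw [h3]; ring)

theorem tile_inj {lam : List DyckStep} {a e k a' e' k' : ℕ} (hae : a ≤ e) (he : e ≤ lam.length)
    (hae' : a' ≤ e') (he' : e' ≤ lam.length) (h : tile lam a e k = tile lam a' e' k') :
    a = a' ∧ e = e' ∧ k = k' := by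
  have h1 : a = a' := congrArg Tile.x h
  subst h1
  have h2 : height lam a + 2 * k + 1 = height lam a + 2 * k' + 1 := congrArg Tile.y h
  have h3 := congrArg (fun t => t.word.length) h
  simp only [tile, length_infix lam he, length_infix lam he'] at h3
  omega

/-- The steps from `a` to `e` form a maximal run of steps that are joined on the level `k`. -/
structure IsRun (j : ℕ → ℕ) (a e k : ℕ) : Prop where
  le : a ≤ e
  start : prevFun 0 j a ≤ k
  joined : ∀ s, a ≤ s → s < e → k < j s
  maximal : j e ≤ k

theorem IsRun.unique {j : ℕ → ℕ} {a e a' e' k x : ℕ} (h : IsRun j a e k) (h' : IsRun j a' e' k)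
    (hx : a ≤ x ∧ x ≤ e) (hx' : a' ≤ x ∧ x ≤ e') : a = a' ∧ e = e' := by
  have key : ∀ {a e a' e'}, IsRun j a e k → IsRun j a' e' k → a ≤ x ∧ x ≤ e → a' ≤ x ∧ x ≤ e' →
      a' ≤ a ∧ e ≤ e' := by
    intro a e a' e' h h' hx hx'
    constructor
    · by_contra hlt
      obtain ⟨b, rfl⟩ : ∃ b, a' = b + 1 := ⟨a' - 1, by omega⟩
      exact absurd h'.start (not_le.2 (h.joined b (by omega) (by omega)))
    · by_contra hlt
      exact absurd h'.maximal (not_le.2 (h.joined e' (by omega) (by omega)))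
  have h1 := key h h' hx hx'
  have h2 := key h' h hx' hx
  omega

/-- The numbers of boxes `h` in the columns, and the numbers `j` of joined levels. -/
structure Levels (N : ℕ) (h j : ℕ → ℕ) : Prop where
  le_left : ∀ s < N, j s ≤ h s
  le_right : ∀ s < N, j s ≤ h (s + 1)
  zero : ∀ s, N ≤ s → j s = 0

theorem Levels.exists_isRun {N : ℕ} {h j : ℕ → ℕ} (hl : Levels N h j) {x : ℕ} (hx : x ≤ N) (k : ℕ) :
    ∃ a e, IsRun j a e k ∧ (a ≤ x ∧ x ≤ e) ∧ e ≤ N := by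
  have h1 : ∃ a ≤ x, prevFun 0 j a ≤ k ∧ ∀ s, a ≤ s → s < x → k < j s := by
    clear hx
    induction x with
    | zero => exact ⟨0, le_rfl, Nat.zero_le _, fun s _ hs => absurd hs (Nat.not_lt_zero _)⟩
    | succ x ih =>
      by_cases hk : k < j x
      · obtain ⟨a, h1, h2, h3⟩ := ih
        refine ⟨a, by omega, h2, fun s hs hs' => ?_⟩
        rcases eq_or_ne s x with rfl | hne
        · exact hk
        · exact h3 s hs (by omega)
      · exact ⟨x + 1, le_rfl, not_lt.1 hk, fun s hs hs' => by omega⟩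
  have h2 : ∃ e, x ≤ e ∧ j e ≤ k := ⟨N, hx, by simp [hl.zero N le_rfl]⟩
  classical
  obtain ⟨a, ha, h3, h4⟩ := h1
  obtain ⟨h5, h6⟩ := Nat.find_spec h2
  refine ⟨a, Nat.find h2, ⟨ha.trans h5, h3, fun s hs hs' => ?_, h6⟩, ⟨ha, h5⟩,
    Nat.find_min' h2 ⟨hx, by simp [hl.zero N le_rfl]⟩⟩
  by_cases hsx : s < x
  · exact h4 s hs hsx
  · by_contra hk
    exact Nat.find_min h2 hs' ⟨by omega, by omega⟩

theorem Levels.lt_of_isRun {N : ℕ} {h j : ℕ → ℕ} (hl : Levels N h j) {a e k x y : ℕ}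
    (hr : IsRun j a e k) (he : e ≤ N) (hx : a ≤ x ∧ x ≤ e) (hk : k < h x) (hy : a ≤ y ∧ y ≤ e) :
    k < h y := by
  rcases hy.2.lt_or_eq with hlt | rfl
  · exact (hr.joined y hy.1 hlt).trans_le (hl.le_left y (by omega))
  · rcases hy.1.lt_or_eq with hlt | rfl
    · obtain ⟨b, rfl⟩ : ∃ b, y = b + 1 := ⟨y - 1, by omega⟩
      exact (hr.joined b (by omega) (by omega)).trans_le (hl.le_right b (by omega))
    · obtain rfl : x = a := by omega
      exact hk

theorem Levels.eq_of_isRun {N : ℕ} {h j : ℕ → ℕ} (hl : Levels N h j) {a e k : ℕ}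
    (hr : IsRun j a e k) (he : e ≤ N) (hk : ¬ k < h a) : e = a := by
  by_contra hne
  have := hr.le
  exact hk ((hr.joined a le_rfl (by omega)).trans_le (hl.le_left a (by omega)))

open scoped Classical in
/-- The tiles over the maximal runs. -/
noncomputable def tilesOf (lam : List DyckStep) (h j : ℕ → ℕ) : Finset Tile :=
  (Finset.range (lam.length + 1)).biUnion fun a => (Finset.range (lam.length + 1)).biUnion fun e =>
    ((Finset.range (h a)).filter fun k => IsRun j a e k).image (tile lam a e)

theorem mem_tilesOf {lam : List DyckStep} {h j : ℕ → ℕ} {t : Tile} : t ∈ tilesOf lam h j ↔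
    ∃ a e k, e ≤ lam.length ∧ k < h a ∧ IsRun j a e k ∧ t = tile lam a e k := by
  simp only [tilesOf, Finset.mem_biUnion, Finset.mem_image, Finset.mem_filter, Finset.mem_range]
  constructor
  · rintro ⟨a, -, e, he, k, ⟨hk, hr⟩, rfl⟩
    exact ⟨a, e, k, by omega, hk, hr, rfl⟩
  · rintro ⟨a, e, k, he, hk, hr, rfl⟩
    have := hr.le
    exact ⟨a, by omega, e, by omega, k, ⟨hk, hr⟩, rfl⟩

theorem tile_mem_tilesOf {lam : List DyckStep} {h j : ℕ → ℕ} {a e k : ℕ} (hae : a ≤ e)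
    (he : e ≤ lam.length) : tile lam a e k ∈ tilesOf lam h j ↔ k < h a ∧ IsRun j a e k := by
  rw [mem_tilesOf]
  constructor
  · rintro ⟨a', e', k', he', hk, hr, ht⟩
    obtain ⟨rfl, rfl, rfl⟩ := tile_inj hae he hr.le he' ht
    exact ⟨hk, hr⟩
  · rintro ⟨hk, hr⟩
    exact ⟨a, e, k, he, hk, hr, rfl⟩

theorem Levels.joined_iff {lam : List DyckStep} {h j : ℕ → ℕ} (hl : Levels lam.length h j) {s k : ℕ} :
    k < j s ↔ ∃ a e, (a ≤ s ∧ s < e ∧ e ≤ lam.length) ∧ tile lam a e k ∈ tilesOf lam h j := by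
  constructor
  · intro hk
    have hs : s < lam.length := by
      by_contra hs
      rw [hl.zero s (by omega)] at hk
      omega
    obtain ⟨a, e, hr, hx, he⟩ := hl.exists_isRun hs.le k
    have hse : s < e := by
      rcases hx.2.lt_or_eq with h1 | rfl
      · exact h1
      · exact absurd hr.maximal (by omega)
    exact ⟨a, e, ⟨hx.1, hse, he⟩, (tile_mem_tilesOf hr.le he).2 ⟨hl.lt_of_isRun hr he hx
      (hk.trans_le (hl.le_left s hs)) ⟨le_rfl, hr.le⟩, hr⟩⟩
  · rintro ⟨a, e, ⟨h1, h2, h3⟩, ht⟩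
    exact ((tile_mem_tilesOf (by omega) h3).1 ht).2.joined s h1 h2

/-- The runs are ballot paths, and return to their initial height unless they end with `lam`. -/
structure RunsOK (lam : List DyckStep) (j : ℕ → ℕ) : Prop where
  ballot : ∀ a e k, e ≤ lam.length → IsRun j a e k → ∀ x, a ≤ x → x ≤ e →
    height lam a ≤ height lam x
  closed : ∀ a e k, e < lam.length → IsRun j a e k → height lam e = height lam a

theorem runHeight_eq {w : List DyckStep} {j : ℕ → ℕ} {a x k : ℕ} (ha : prevFun 0 j a ≤ k)
    (hax : a ≤ x) (hj : ∀ s, a ≤ s → s < x → k < j s) :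
    runHeight w j 0 x k = height w x - height w a := by
  induction x, hax using Nat.le_induction with
  | base =>
    rw [sub_self]
    rcases a with _ | a
    · rfl
    · exact if_neg (not_lt.2 ha)
  | succ x hx ih =>
    refine (if_pos (hj x hx (by omega))).trans ?_
    rw [ih fun s hs hs' => hj s hs (by omega)]
    ring

theorem localAt_iff {lam : List DyckStep} {h j : ℕ → ℕ} (hz : ∀ s, lam.length ≤ s → j s = 0) :
    (∀ x < lam.length, LocalAt lam 0 h j x) ↔ Levels lam.length h j ∧ RunsOK lam j ∧
      ∀ x < lam.length, height lam (x + 1) - height lam x + 2 * ((h (x + 1) : ℤ) - h x) = 1 ∨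
        height lam (x + 1) - height lam x + 2 * ((h (x + 1) : ℤ) - h x) = -1 := by
  constructor
  · intro H
    refine ⟨⟨fun x hx => (H x hx).le_left, fun x hx => (H x hx).le_right, hz⟩, ⟨?_, ?_⟩,
      fun x hx => (H x hx).step⟩
    · intro a e k he hr x hax hxe
      rcases x with _ | x
      · obtain rfl : a = 0 := by omega
        rfl
      · have h1 := (H x (by omega)).ballot k
        rw [runHeight_eq hr.start hax fun s hs hs' => hr.joined s hs (by omega)] at h1
        omega
    · intro a e k he hr
      have h1 := (H e he).closed k hr.maximal
      rw [runHeight_eq hr.start hr.le hr.joined] at h1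
      omega
  · rintro ⟨hl, hr, hs⟩ x hx
    refine ⟨hs x hx, hl.le_left x hx, hl.le_right x hx, fun k hk => ?_, fun k => ?_⟩
    · obtain ⟨a, e, hr1, hxa, he⟩ := hl.exists_isRun hx.le k
      obtain rfl : x = e := by
        by_contra hne
        exact absurd (hr1.joined x hxa.1 (by omega)) (by omega)
      rw [runHeight_eq hr1.start hr1.le hr1.joined, hr.closed a x k hx hr1, sub_self]
    · obtain ⟨a, e, hr1, hxa, he⟩ := hl.exists_isRun hx k
      rw [runHeight_eq hr1.start hxa.1 fun s hs hs' => hr1.joined s hs (by omega)]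
      have := hr.ballot a e k he hr1 _ hxa.1 hxa.2
      omega

/-! ### The tilings of a configuration -/

section Parity

variable {lam : List DyckStep} {h j M : ℕ → ℕ}

theorem hasLength_tile_length (a k n n' : ℕ) : (tile lam a lam.length k).HasLength n n' ↔
    (lam.drop a).count D = n ∧ (lam.drop a).count U = n + n' := by
  rw [Tile.HasLength, tile, ← List.length_drop, List.take_length]

theorem count_sub_count (lam : List DyckStep) (a k : ℕ) {e : ℕ} (hae : a ≤ e) (he : e ≤ lam.length) :
    ((tile lam a e k).word.count U : ℤ) - (tile lam a e k).word.count D =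
      height lam e - height lam a := by
  have h1 := height_infix lam (a := a) (e := e) le_rfl
  rw [Nat.add_sub_cancel' hae] at h1
  rw [← h1, ← height_length, tile, length_infix lam he]

theorem isRun_length (hl : Levels lam.length h j) (hM : ∀ x ≤ lam.length, ∀ k,
    k < M x ↔ k < h lam.length ∧ ∀ s, x ≤ s → s < lam.length → k < j s) {a k : ℕ}
    (ha : a ≤ lam.length) : k < h a ∧ IsRun j a lam.length k ↔ prevFun 0 j a ≤ k ∧ k < M a := by
  rw [hM a ha]
  constructor
  · rintro ⟨h1, h2⟩
    exact ⟨h2.start, hl.lt_of_isRun h2 le_rfl ⟨le_rfl, h2.le⟩ h1 ⟨h2.le, le_rfl⟩, h2.joined⟩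
  · rintro ⟨h1, h2, h3⟩
    have hr : IsRun j a lam.length k := ⟨ha, h1, h3, by simp [hl.zero _ le_rfl]⟩
    exact ⟨hl.lt_of_isRun hr le_rfl ⟨hr.le, le_rfl⟩ h2 ⟨le_rfl, hr.le⟩, hr⟩

theorem exists_of_hasLength (hl : Levels lam.length h j) (hr : RunsOK lam j) (hM : ∀ x ≤ lam.length,
    ∀ k, k < M x ↔ k < h lam.length ∧ ∀ s, x ≤ s → s < lam.length → k < j s) {t : Tile}
    (ht : t ∈ tilesOf lam h j) {n n' : ℕ} (hn : 1 ≤ n') (htl : t.HasLength n n') :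
    ∃ a k, a ≤ lam.length ∧ (prevFun 0 j a ≤ k ∧ k < M a) ∧ t = tile lam a lam.length k ∧
      (lam.drop a).count D = n ∧ (lam.drop a).count U = n + n' := by
  obtain ⟨a, e, k, he, hk, hr1, rfl⟩ := mem_tilesOf.1 ht
  have h1 := count_sub_count lam a k hr1.le he
  rw [htl.1, htl.2] at h1
  obtain rfl : e = lam.length := by
    by_contra hne
    have := hr.closed a e k (by omega) hr1
    push_cast at h1
    omega
  exact ⟨a, k, hr1.le, (isRun_length hl hM hr1.le).1 ⟨hk, hr1⟩, rfl,
    (hasLength_tile_length a k n n').1 htl⟩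

theorem ncard_hasLength (hl : Levels lam.length h j) (hr : RunsOK lam j) (hM : ∀ x ≤ lam.length,
    ∀ k, k < M x ↔ k < h lam.length ∧ ∀ s, x ≤ s → s < lam.length → k < j s) {a n n' : ℕ}
    (ha : a ≤ lam.length) (hn : 1 ≤ n') (hD : (lam.drop a).count D = n)
    (hU : (lam.drop a).count U = n + n') :
    {t | t ∈ tilesOf lam h j ∧ t.HasLength n n'}.ncard =
      M a - min (prevFun 0 j a) (M a) := by
  have : {t | t ∈ tilesOf lam h j ∧ t.HasLength n n'} =
      (Finset.Ico (prevFun 0 j a) (M a)).image (tile lam a lam.length) := by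
    ext t
    simp only [Set.mem_ofPred_eq, Finset.coe_image, Set.mem_image, Finset.mem_coe, Finset.mem_Ico]
    constructor
    · rintro ⟨h1, h2⟩
      obtain ⟨a', k, ha', hk, rfl, hD', hU'⟩ := exists_of_hasLength hl hr hM h1 hn h2
      have e1 := count_add_count (lam.drop a)
      have e2 := count_add_count (lam.drop a')
      rw [List.length_drop] at e1 e2
      obtain rfl : a = a' := by omega
      exact ⟨k, hk, rfl⟩
    · rintro ⟨k, hk, rfl⟩
      exact ⟨(tile_mem_tilesOf ha le_rfl).2 ((isRun_length hl hM ha).2 hk),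
        (hasLength_tile_length a k n n').2 ⟨hD, hU⟩⟩
  rw [this, Set.ncard_coe_finset, Finset.card_image_of_injOn, Nat.card_Ico]
  · omega
  · intro k _ k' _ hkk
    exact (tile_inj ha le_rfl ha le_rfl hkk).2.2

theorem mem_region_iff {mu : List DyckStep} (hmu : ∀ x ≤ lam.length,
    height mu x = height lam x + 2 * h x) (b : ℕ × ℤ) : b ∈ region lam mu ↔
      b.1 ≤ lam.length ∧ ∃ k < h b.1, b.2 = height lam b.1 + 2 * k + 1 := by
  simp only [region, Set.mem_ofPred_eq]
  refine and_congr_right fun hb => ?_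
  rw [hmu _ hb]
  constructor
  · rintro ⟨h1, h2, m, hm⟩
    exact ⟨m.toNat, by omega, by omega⟩
  · rintro ⟨k, hk, h1⟩
    exact ⟨by omega, by omega, k, by omega⟩

theorem isTiling_tilesOf {mu : List DyckStep} (hlen : mu.length = lam.length)
    (hmu : ∀ x ≤ lam.length, height mu x = height lam x + 2 * h x) (hl : Levels lam.length h j)
    (hr : RunsOK lam j) (hM : ∀ x ≤ lam.length,
      ∀ k, k < M x ↔ k < h lam.length ∧ ∀ s, x ≤ s → s < lam.length → k < j s)
    (hP : ∀ x ≤ lam.length, Par (lam.drop x) (prevFun 0 j x) (M x)) :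
    IsTiling lam mu (tilesOf lam h j) where
  length_eq := hlen
  le := by
    intro x
    rcases le_total x lam.length with hx | hx
    · rw [hmu x hx]; omega
    · rw [height_of_length_le hx, height_of_length_le (hlen.trans_le hx), hlen, hmu _ le_rfl]; omega
  ballot := by
    intro t ht x
    obtain ⟨a, e, k, he, hk, hr1, rfl⟩ := mem_tilesOf.1 ht
    have key : ∀ x ≤ e - a, 0 ≤ height ((lam.drop a).take (e - a)) x := by
      intro x hx
      rw [height_infix lam hx]
      have := hr.ballot a e k he hr1 (a + x) (by omega) (by have := hr1.le; omega)
      omega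
    rcases le_total x (e - a) with hx | hx
    · exact key x hx
    · rw [tile, height_of_length_le ((length_infix lam he).trans_le hx), length_infix lam he]
      exact key _ le_rfl
  cover := by
    intro b
    rw [mem_region_iff hmu]
    constructor
    · rintro ⟨hb, k, hk, hb2⟩
      obtain ⟨a, e, hr1, hx, he⟩ := hl.exists_isRun hb k
      exact ⟨tile lam a e k, (tile_mem_tilesOf hr1.le he).2 ⟨hl.lt_of_isRun hr1 he hx hk
        ⟨le_rfl, hr1.le⟩, hr1⟩, (mem_boxes_tile hr1.le he b).2 ⟨hx, hb2⟩⟩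
    · rintro ⟨t, ht, hb⟩
      obtain ⟨a, e, k, he, hk, hr1, rfl⟩ := mem_tilesOf.1 ht
      obtain ⟨hx, hb2⟩ := (mem_boxes_tile hr1.le he b).1 hb
      exact ⟨by omega, k, hl.lt_of_isRun hr1 he ⟨le_rfl, hr1.le⟩ hk hx, hb2⟩
  disjoint := by
    intro t ht t' ht' hne
    rw [Finset.disjoint_left]
    intro b hb hb'
    obtain ⟨a, e, k, he, hk, hr1, rfl⟩ := mem_tilesOf.1 ht
    obtain ⟨a', e', k', he', hk', hr1', rfl⟩ := mem_tilesOf.1 ht'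
    obtain ⟨hx, hb2⟩ := (mem_boxes_tile hr1.le he b).1 hb
    obtain ⟨hx', hb2'⟩ := (mem_boxes_tile hr1'.le he' b).1 hb'
    obtain rfl : k = k' := by omega
    obtain ⟨rfl, rfl⟩ := hr1.unique hr1' hx hx'
    exact hne rfl
  coverInclusive := by
    intro t ht
    obtain ⟨a, e, k, he, hk, hr1, rfl⟩ := mem_tilesOf.1 ht
    have hae := hr1.le
    rcases k with _ | k
    · refine .inl fun b hb => ?_
      have := ((mem_boxes_tile hr1.le he b).1 hb).2
      push_cast at this
      omega
    · obtain ⟨a', e', hr2, hx, he'⟩ := hl.exists_isRun (hae.trans he) k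
      have hee : e ≤ e' := by
        by_contra hlt
        have h1 := hr1.joined e' hx.2 (by omega)
        have h2 := hr2.maximal
        omega
      refine .inr ⟨tile lam a' e' k, (tile_mem_tilesOf hr2.le he').2 ⟨hl.lt_of_isRun hr2 he' hx
        (by omega) ⟨le_rfl, hr2.le⟩, hr2⟩, fun b hb => ?_⟩
      obtain ⟨h1, h2⟩ := (mem_boxes_tile hr1.le he b).1 hb
      refine (mem_boxes_tile hr2.le he' _).2 ⟨⟨by dsimp only; omega, by dsimp only; omega⟩, ?_⟩
      push_cast at h2
      dsimp only
      omega
  anchor := by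
    intro t ht n n' hn htl
    obtain ⟨a, k, ha, hk, rfl, -⟩ := exists_of_hasLength hl hr hM ht hn htl
    rw [tile, length_infix lam le_rfl]
    exact Nat.add_sub_cancel' ha
  even_card := by
    intro n n' hn
    by_cases hex : ∃ a ≤ lam.length, (lam.drop a).count D = n ∧ (lam.drop a).count U = n + n'
    · obtain ⟨a, ha, hD, hU⟩ := hex
      rw [ncard_hasLength hl hr hM ha hn.pos hD hU]
      have h1 := hP a ha (by have := hn.pos; omega)
      rwa [if_pos (by rwa [hD, hU, Nat.add_sub_cancel_left])] at h1
    · have : {t | t ∈ tilesOf lam h j ∧ t.HasLength n n'} = ∅ := by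
        ext t
        simp only [Set.mem_ofPred_eq, Set.mem_empty_iff_false, iff_false]
        rintro ⟨h1, h2⟩
        obtain ⟨a, k, ha, hk, rfl, hD, hU⟩ := exists_of_hasLength hl hr hM h1 hn.pos h2
        exact hex ⟨a, ha, hD, hU⟩
      rw [this, Set.ncard_empty]
      exact Even.zero
  no_even := by
    intro t ht n n' he hn htl
    obtain ⟨a, k, ha, hk, rfl, hD, hU⟩ := exists_of_hasLength hl hr hM ht hn htl
    have h1 := hP a ha (by omega)
    rw [if_neg (by rw [hD, hU, Nat.add_sub_cancel_left]; exact Nat.not_odd_iff_even.2 he)] at h1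
    omega

theorem runsOK_of_isTiling {mu : List DyckStep} (hl : Levels lam.length h j)
    (hT : IsTiling lam mu (tilesOf lam h j)) : RunsOK lam j := by
  have hb : ∀ a e k, e ≤ lam.length → IsRun j a e k → ∀ x, a ≤ x → x ≤ e →
      height lam a ≤ height lam x := by
    intro a e k he hr x hax hxe
    by_cases hk : k < h a
    · have h1 := hT.ballot _ ((tile_mem_tilesOf hr.le he).2 ⟨hk, hr⟩) (x - a)
      rw [tile, height_infix lam (by omega), Nat.add_sub_cancel' hax] at h1
      omega
    · obtain rfl := hl.eq_of_isRun hr he hk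
      obtain rfl : x = e := by omega
      rfl
  refine ⟨hb, fun a e k he hr => ?_⟩
  by_cases hk : k < h a
  · by_contra hne
    have h1 := hb a e k he.le hr e hr.le le_rfl
    have h2 := count_sub_count lam a k hr.le he.le
    have h3 := hT.anchor _ ((tile_mem_tilesOf hr.le he.le).2 ⟨hk, hr⟩)
      ((tile lam a e k).word.count D)
      ((tile lam a e k).word.count U - (tile lam a e k).word.count D) (by omega) ⟨rfl, by omega⟩
    rw [tile, length_infix lam he.le] at h3
    have := hr.le
    simp only at h3
    omega
  · rw [hl.eq_of_isRun hr he.le hk]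

theorem par_of_isTiling {mu : List DyckStep} (hl : Levels lam.length h j)
    (hT : IsTiling lam mu (tilesOf lam h j)) (hM : ∀ x ≤ lam.length,
      ∀ k, k < M x ↔ k < h lam.length ∧ ∀ s, x ≤ s → s < lam.length → k < j s) :
    ∀ x ≤ lam.length, Par (lam.drop x) (prevFun 0 j x) (M x) := by
  have hr := runsOK_of_isTiling hl hT
  intro x hx hlt
  have hU : (lam.drop x).count U = (lam.drop x).count D +
    ((lam.drop x).count U - (lam.drop x).count D) := by omega
  split_ifs with ho
  · have := hT.even_card ((lam.drop x).count D) _ ho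
    rwa [ncard_hasLength hl hr hM hx ho.pos rfl hU] at this
  · by_contra hk
    refine hT.no_even (tile lam x lam.length (prevFun 0 j x)) ((tile_mem_tilesOf hx le_rfl).2
      ((isRun_length hl hM hx).2 ⟨le_rfl, not_le.1 hk⟩)) _ _ (Nat.not_odd_iff_even.1 ho) (by omega)
      ((hasLength_tile_length _ _ _ _).2 ⟨rfl, hU⟩)

end Parity

/-! ### The configuration of a tiling -/

theorem exists_forall_lt_iff {P : ℕ → Prop} (h : ∀ k, P (k + 1) → P k) {b : ℕ} (hb : ∀ k, P k → k < b) :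
    ∃ n, ∀ k, k < n ↔ P k := by
  classical
  have hex : ∃ n, ¬ P n := ⟨b, fun hP => (hb b hP).false⟩
  refine ⟨Nat.find hex, fun k => ⟨fun hk => not_not.1 (Nat.find_min hex hk), fun hk => ?_⟩⟩
  by_contra hlt
  have hle := not_lt.1 hlt
  induction k, hle using Nat.le_induction with
  | base => exact Nat.find_spec hex hk
  | succ m hm ih => exact ih (h m hk) (not_lt.2 hm)

section OfTiling

variable {lam mu : List DyckStep} {S : Finset Tile}

theorem exists_height_eq (hT : IsTiling lam mu S) :
    ∃ h : ℕ → ℕ, ∀ x, height mu x = height lam x + 2 * h x := by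
  have : ∀ x, ∃ n : ℕ, height mu x = height lam x + 2 * n := by
    intro x
    have h1 := count_add_count (lam.take x)
    have h2 := count_add_count (mu.take x)
    rw [List.length_take] at h1 h2
    have h3 := hT.length_eq
    have h4 := hT.le x
    unfold height at *
    rw [h3] at h2
    exact ⟨(lam.take x).count D - (mu.take x).count D, by omega⟩
  exact Classical.skolem.1 this

theorem exists_tile_eq (hT : IsTiling lam mu S) {h : ℕ → ℕ}
    (hmu : ∀ x, height mu x = height lam x + 2 * h x) {t : Tile} (ht : t ∈ S) :
    ∃ a e k, a ≤ e ∧ e ≤ lam.length ∧ t = tile lam a e k := by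
  have hbox : ∀ t ∈ S, ∀ i ≤ t.word.length, (t.x + i, t.y + height t.word i) ∈ t.boxes :=
    fun t _ i hi => Finset.mem_image.2 ⟨i, Finset.mem_range.2 (by omega), rfl⟩
  have hreg : ∀ t ∈ S, ∀ b ∈ t.boxes, b.1 ≤ lam.length ∧ ∃ k < h b.1,
      b.2 = height lam b.1 + 2 * k + 1 :=
    fun t ht b hb => (mem_region_iff (fun x _ => hmu x) b).1 ((hT.cover b).2 ⟨t, ht, hb⟩)
  have hlev : ∀ k : ℕ, ∀ t ∈ S, ∀ b₀ ∈ t.boxes, b₀.2 = height lam b₀.1 + 2 * k + 1 → ∀ b ∈ t.boxes,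
      b.2 = height lam b.1 + 2 * k + 1 := by
    intro k
    induction k with
    | zero =>
      intro t ht b₀ hb₀ hy b hb
      rcases hT.coverInclusive t ht with h1 | ⟨t', ht', h1⟩
      · have h3 := h1 b hb
        obtain ⟨-, m, -, hm⟩ := hreg t ht b hb
        push_cast
        omega
      · obtain ⟨-, m, -, hm⟩ := hreg t' ht' _ (h1 _ hb₀)
        dsimp only at hm
        push_cast at hy
        omega
    | succ k ih =>
      intro t ht b₀ hb₀ hy b hb
      push_cast at hy ⊢
      rcases hT.coverInclusive t ht with h1 | ⟨t', ht', h1⟩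
      · have h3 := h1 _ hb₀
        omega
      · have h2 := ih t' ht' _ (h1 _ hb₀) (by dsimp only; omega) _ (h1 _ hb)
        dsimp only at h2
        omega
  obtain ⟨hx, k, hk, hy⟩ := hreg t ht _ (hbox t ht 0 (Nat.zero_le _))
  obtain ⟨he, -⟩ := hreg t ht _ (hbox t ht _ le_rfl)
  simp only [add_zero, height_zero] at hy
  refine ⟨t.x, t.x + t.word.length, k, by omega, he, ?_⟩
  have hw : t.word = (lam.drop t.x).take (t.x + t.word.length - t.x) := by
    refine eq_of_height_eq ?_ fun i hi => ?_
    · rw [length_infix lam he]; omega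
    · rw [height_infix lam (by omega)]
      have := hlev k t ht _ (hbox t ht 0 (Nat.zero_le _)) (by simpa [height_zero] using hy) _ (hbox t ht i hi)
      dsimp only at this
      omega
  rw [tile, ← hw, ← hy]

end OfTiling

section OfTiling

variable {lam mu : List DyckStep} {S : Finset Tile}

theorem IsTiling.exists_levels (hT : IsTiling lam mu S) :
    ∃ h j : ℕ → ℕ, (∀ x, height mu x = height lam x + 2 * h x) ∧ Levels lam.length h j ∧
      S = tilesOf lam h j := by
  obtain ⟨h, hmu⟩ := exists_height_eq hT
  have hreg : ∀ {a e k}, a ≤ e → e ≤ lam.length → tile lam a e k ∈ S → ∀ x, a ≤ x → x ≤ e →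
      k < h x := by
    intro a e k hae he ht x hax hxe
    have hb := (mem_boxes_tile (k := k) hae he (x, height lam x + 2 * k + 1)).2 ⟨⟨hax, hxe⟩, rfl⟩
    obtain ⟨-, m, hm, hm2⟩ := (mem_region_iff (fun x _ => hmu x) _).1 ((hT.cover _).2 ⟨_, ht, hb⟩)
    dsimp only at hm hm2
    omega
  have huniq : ∀ {a e a' e' k}, a ≤ e → e ≤ lam.length → tile lam a e k ∈ S →
      a' ≤ e' → e' ≤ lam.length → tile lam a' e' k ∈ S → ∀ x, a ≤ x ∧ x ≤ e → a' ≤ x ∧ x ≤ e' →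
      a = a' ∧ e = e' := by
    intro a e a' e' k hae he ht hae' he' ht' x hx hx'
    have hb := (mem_boxes_tile (k := k) hae he (x, height lam x + 2 * k + 1)).2 ⟨hx, rfl⟩
    have hb' := (mem_boxes_tile (k := k) hae' he' (x, height lam x + 2 * k + 1)).2 ⟨hx', rfl⟩
    have h1 : tile lam a e k = tile lam a' e' k := by
      by_contra hne
      exact Finset.disjoint_left.1 (hT.disjoint _ ht _ ht' hne) hb hb'
    have h2 := tile_inj hae he hae' he' h1
    exact ⟨h2.1, h2.2.1⟩
  have hj : ∀ s, ∃ n, ∀ k, k < n ↔ ∃ a e, (a ≤ s ∧ s < e ∧ e ≤ lam.length) ∧ tile lam a e k ∈ S := by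
    intro s
    refine exists_forall_lt_iff (b := h s) ?_ ?_
    · rintro k ⟨a, e, ⟨h1, h2, h3⟩, ht⟩
      have hb : ∀ x, a ≤ x → x ≤ e → (x, height lam x + 2 * (k + 1 : ℕ) + 1) ∈
          (tile lam a e (k + 1)).boxes :=
        fun x hx hx' => (mem_boxes_tile (by omega) h3 _).2 ⟨⟨hx, hx'⟩, rfl⟩
      rcases hT.coverInclusive _ ht with h4 | ⟨t', ht', h4⟩
      · have := h4 _ (hb a le_rfl (by omega))
        dsimp only at this
        push_cast at this
        omega
      · obtain ⟨a', e', k', hae', he', rfl⟩ := exists_tile_eq hT hmu ht'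
        have h5 := (mem_boxes_tile hae' he' _).1 (h4 _ (hb a le_rfl (by omega)))
        have h6 := (mem_boxes_tile hae' he' _).1 (h4 _ (hb e (by omega) le_rfl))
        dsimp only at h5 h6
        push_cast at h5
        obtain rfl : k' = k := by omega
        exact ⟨a', e', ⟨by omega, by omega, he'⟩, ht'⟩
    · rintro k ⟨a, e, ⟨h1, h2, h3⟩, ht⟩
      exact hreg (by omega) h3 ht s h1 (by omega)
  choose j hj using hj
  have hl : Levels lam.length h j := by
    refine ⟨fun s hs => ?_, fun s hs => ?_, fun s hs => ?_⟩
    · by_contra hlt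
      obtain ⟨a, e, ⟨h1, h2, h3⟩, ht⟩ := (hj s (h s)).1 (not_le.1 hlt)
      exact (hreg (by omega) h3 ht s h1 (by omega)).false
    · by_contra hlt
      obtain ⟨a, e, ⟨h1, h2, h3⟩, ht⟩ := (hj s (h (s + 1))).1 (not_le.1 hlt)
      exact (hreg (by omega) h3 ht (s + 1) (by omega) h2).false
    · by_contra hne
      obtain ⟨a, e, ⟨h1, h2, h3⟩, ht⟩ := (hj s 0).1 (by omega)
      omega
  have hrun : ∀ {a e k}, a ≤ e → e ≤ lam.length → tile lam a e k ∈ S → k < h a ∧ IsRun j a e k := by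
    intro a e k hae he ht
    refine ⟨hreg hae he ht a le_rfl hae, hae, ?_, fun s hs hs' => ?_, ?_⟩
    · rcases a with _ | a
      · exact Nat.zero_le _
      · by_contra hlt
        obtain ⟨a', e', ⟨h1, h2, h3⟩, ht'⟩ := (hj a k).1 (not_le.1 hlt)
        have := huniq hae he ht (by omega) h3 ht' (a + 1) ⟨le_rfl, hae⟩ ⟨by omega, h2⟩
        omega
    · exact (hj s k).2 ⟨a, e, ⟨hs, hs', he⟩, ht⟩
    · by_contra hlt
      obtain ⟨a', e', ⟨h1, h2, h3⟩, ht'⟩ := (hj e k).1 (not_le.1 hlt)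
      have := huniq hae he ht (by omega) h3 ht' e ⟨hae, le_rfl⟩ ⟨h1, h2.le⟩
      omega
  refine ⟨h, j, hmu, hl, Finset.ext fun t => ⟨fun ht => ?_, fun ht => ?_⟩⟩
  · obtain ⟨a, e, k, hae, he, rfl⟩ := exists_tile_eq hT hmu ht
    exact (tile_mem_tilesOf hae he).2 (hrun hae he ht)
  · obtain ⟨a, e, k, he, hk, hr, rfl⟩ := mem_tilesOf.1 ht
    have hb : (a, height lam a + 2 * k + 1) ∈ region lam mu :=
      (mem_region_iff (fun x _ => hmu x) _).2 ⟨hr.le.trans he, k, hk, rfl⟩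
    obtain ⟨t', ht', hbt⟩ := (hT.cover _).1 hb
    obtain ⟨a', e', k', hae', he', rfl⟩ := exists_tile_eq hT hmu ht'
    obtain ⟨hx, hy⟩ := (mem_boxes_tile hae' he' _).1 hbt
    dsimp only at hx hy
    obtain rfl : k = k' := by omega
    obtain ⟨rfl, rfl⟩ := hr.unique (hrun hae' he' ht').2 ⟨le_rfl, hr.le⟩ hx
    exact ht'

end OfTiling

/-! ### The weight of a tiling -/

/-- The sum of the weights of the steps. -/
def totalWeight : List DyckStep → ℕ
  | [] => 0
  | s :: w => stepWeight s w + totalWeight w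

theorem weightAt_add (w : List DyckStep) (x : ℕ) :
    weightAt w x + totalWeight (w.drop (x + 1)) = totalWeight (w.drop x) := by
  rw [weightAt, ← List.tail_drop]
  cases w.drop x <;> rfl

theorem sum_weightAt (w : List DyckStep) {a e : ℕ} (hae : a ≤ e) :
    ∑ x ∈ Finset.Ico a e, weightAt w x + totalWeight (w.drop e) = totalWeight (w.drop a) := by
  induction e, hae using Nat.le_induction with
  | base => simp
  | succ e he ih => rw [Finset.sum_Ico_succ_top he, add_assoc, weightAt_add, ih]

theorem totalWeight_word_append (T : PlaneTree) (w : List DyckStep) :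
    totalWeight (word T ++ w) = T.size + totalWeight w := by
  induction T generalizing w with
  | nil => simp [word, size]
  | node d a c r hc hr =>
    have h1 : dotWeight (word c ++ D :: (word r ++ w)) = 0 := by
      rw [dotWeight, if_neg]
      exact fun h => (parse_word_append c _).1 (List.length_eq_zero_iff.1 h.1)
    rw [word, List.cons_append, List.append_assoc, List.cons_append, totalWeight, hc, totalWeight, hr,
      size, stepWeight, h1, stepWeight]
    ring

theorem BaseWord.totalWeight_eq {w k T} (h : BaseWord w k T) :
    totalWeight w = w.count D + (k + 1) / 2 := by
  induction h with
  | nil => rfl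
  | @edge w k c r hc hr ih =>
    have h1 : dotWeight (word c ++ D :: w) = 0 := by
      rw [dotWeight, if_neg]
      exact fun h => (parse_word_append c _).1 (List.length_eq_zero_iff.1 h.1)
    rw [totalWeight, totalWeight_word_append, totalWeight, stepWeight, stepWeight, h1, ih]
    simp [count_word]
    ring
  | @dot w k r hk hr ih =>
    have h1 : dotWeight w = 1 := by
      rw [dotWeight, if_pos]
      exact ⟨by rw [hr.parse_eq.1]; rfl, by rwa [hr.parse_eq.2]⟩
    rw [totalWeight, stepWeight, h1, ih]
    obtain ⟨m, rfl⟩ := hk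
    simp
    omega
  | @up w k r hk hr ih =>
    have h1 : dotWeight w = 0 := by
      rw [dotWeight, if_neg]
      rw [hr.parse_eq.2]
      exact fun h => (Nat.not_even_iff_odd.2 hk) h.2
    rw [totalWeight, stepWeight, h1, ih]
    obtain ⟨m, rfl⟩ := hk
    simp
    omega

theorem BaseWord.eq_word {w k T} (h : BaseWord w k T) (hk : k = 0) : w = word T := by
  induction h with
  | nil => rfl
  | edge hc hr ih => rw [word, ← ih hk]
  | dot _ _ _ => omega
  | up _ _ _ => omega

theorem art_add_totalWeight {v w : List DyckStep} (hv : IsBallot v)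
    (h : v.count U = v.count D ∨ w = [] ∧ Odd (v.count U - v.count D)) (x : ℕ) (y : ℤ) :
    (Tile.mk x y v).art + totalWeight (v ++ w) = v.length + 1 + totalWeight w := by
  have hb := baseWord_of_isBallot hv
  have h1 := hb.count
  have h2 := count_add_count v
  rw [Tile.art, Tile.area, Tile.tiles]
  dsimp only
  rcases h with h | ⟨rfl, ho⟩
  · have h3 := hb.eq_word (by omega)
    have h4 := (count_word (tree v)).1
    rw [← h3] at h4
    have h5 := totalWeight_word_append (tree v) w
    rw [← h3] at h5
    rw [h5, if_pos h]
    omega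
  · rw [List.append_nil, hb.totalWeight_eq, if_neg (by have := ho.pos; omega), totalWeight]
    obtain ⟨m, hm⟩ := ho
    omega

section Weight

variable {lam : List DyckStep} {h j M : ℕ → ℕ}

theorem art_add_sum (hl : Levels lam.length h j)
    (hr : RunsOK lam j) (hM : ∀ x ≤ lam.length,
      ∀ k, k < M x ↔ k < h lam.length ∧ ∀ s, x ≤ s → s < lam.length → k < j s)
    (hP : ∀ x ≤ lam.length, Par (lam.drop x) (prevFun 0 j x) (M x)) {a e k : ℕ}
    (he : e ≤ lam.length) (hk : k < h a) (hr1 : IsRun j a e k) :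
    (tile lam a e k).art + ∑ x ∈ Finset.Ico a e, weightAt lam x = e - a + 1 := by
  have hsum := sum_weightAt lam hr1.le
  have hcnt := count_sub_count lam a k hr1.le he
  have hbal := hr.ballot a e k he hr1 e hr1.le le_rfl
  have happ : (tile lam a e k).word ++ lam.drop e = lam.drop a := by
    have := List.take_append_drop (e - a) (lam.drop a)
    rwa [List.drop_drop, Nat.add_sub_cancel' hr1.le] at this
  have hbw : IsBallot (tile lam a e k).word := by
    intro x
    have key : ∀ x ≤ e - a, 0 ≤ height ((lam.drop a).take (e - a)) x := by
      intro x hx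
      rw [height_infix lam hx]
      have := hr.ballot a e k he hr1 (a + x) (by omega) (by have := hr1.le; omega)
      omega
    rcases le_total x (e - a) with hx | hx
    · exact key x hx
    · rw [tile, height_of_length_le ((length_infix lam he).trans_le hx), length_infix lam he]
      exact key _ le_rfl
  have h1 := art_add_totalWeight (w := lam.drop e) hbw (by
    rcases he.lt_or_eq with hlt | rfl
    · have := hr.closed a e k hlt hr1
      left
      omega
    · by_cases heq : (tile lam a lam.length k).word.count U = (tile lam a lam.length k).word.count D
      · exact .inl heq
      · refine .inr ⟨List.drop_length, ?_⟩
        rw [List.drop_length, List.append_nil] at happ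
        rw [happ] at hcnt heq ⊢
        have hp := hP a hr1.le (by omega)
        by_contra ho
        rw [if_neg ho] at hp
        have := ((isRun_length hl hM hr1.le).1 ⟨hk, hr1⟩)
        omega) a (height lam a + 2 * k + 1)
  rw [happ] at h1
  have h2 : Tile.mk a (height lam a + 2 * k + 1) (tile lam a e k).word = tile lam a e k := rfl
  have h3 : (tile lam a e k).word.length = e - a := length_infix lam he
  rw [h2, h3] at h1
  omega

theorem card_filter_level {p : Tile → Prop} [DecidablePred p] {n x : ℕ}
    (hp : ∀ t ∈ tilesOf lam h j, p t → t.x ≤ x ∧ x ≤ t.x + t.word.length)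
    (hn : ∀ k, k < n ↔ ∃ t ∈ tilesOf lam h j, p t ∧ t.y = height lam t.x + 2 * k + 1) :
    ((tilesOf lam h j).filter p).card = n := by
  have key : ∀ t ∈ (tilesOf lam h j).filter p, ∃ a e k, e ≤ lam.length ∧ IsRun j a e k ∧
      t = tile lam a e k ∧ (a ≤ x ∧ x ≤ e) ∧ p t ∧ tile lam a e k ∈ tilesOf lam h j := by
    intro t ht
    rw [Finset.mem_filter] at ht
    obtain ⟨a, e, k, he, hk, hr1, rfl⟩ := mem_tilesOf.1 ht.1
    have := hp _ ht.1 ht.2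
    have h3 : (tile lam a e k).word.length = e - a := length_infix lam he
    have h4 : (tile lam a e k).x = a := rfl
    have := hr1.le
    exact ⟨a, e, k, he, hr1, rfl, by omega, ht.2, ht.1⟩
  have hlev : ∀ a e k, ((tile lam a e k).y - height lam (tile lam a e k).x - 1).toNat / 2 = k := by
    intro a e k
    simp only [tile]
    omega
  rw [← Finset.card_range n]
  refine Finset.card_nbij (fun t => (t.y - height lam t.x - 1).toNat / 2) ?_ ?_ ?_
  · intro t ht
    obtain ⟨a, e, k, he, hr1, rfl, hx, hpt, ht'⟩ := key t ht
    rw [Finset.mem_coe, Finset.mem_range]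
    dsimp only
    rw [hlev, hn]
    exact ⟨_, ht', hpt, rfl⟩
  · intro t ht t' ht' htt
    obtain ⟨a, e, k, he, hr1, rfl, hx, -⟩ := key t ht
    obtain ⟨a', e', k', he', hr1', rfl, hx', -⟩ := key t' ht'
    dsimp only at htt
    rw [hlev, hlev] at htt
    subst htt
    obtain ⟨rfl, rfl⟩ := hr1.unique hr1' hx hx'
    rfl
  · intro k hk
    obtain ⟨t, ht, hpt, hy⟩ := (hn k).1 (Finset.mem_range.1 hk)
    refine ⟨t, Finset.mem_filter.2 ⟨ht, hpt⟩, ?_⟩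
    dsimp only
    omega

theorem sum_art (hl : Levels lam.length h j)
    (hr : RunsOK lam j) (hM : ∀ x ≤ lam.length,
      ∀ k, k < M x ↔ k < h lam.length ∧ ∀ s, x ≤ s → s < lam.length → k < j s)
    (hP : ∀ x ≤ lam.length, Par (lam.drop x) (prevFun 0 j x) (M x)) :
    ∑ t ∈ tilesOf lam h j, t.art + ∑ x ∈ Finset.range lam.length, weightAt lam x * j x =
      ∑ x ∈ Finset.range (lam.length + 1), h x := by
  have h1 : ∀ x ∈ Finset.range lam.length, weightAt lam x * j x = ∑ t ∈ tilesOf lam h j,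
      if t.x ≤ x ∧ x < t.x + t.word.length then weightAt lam x else 0 := by
    intro x hx
    rw [← Finset.sum_filter, Finset.sum_const, smul_eq_mul, mul_comm,
      card_filter_level (n := j x) (x := x)]
    · rintro t - ⟨h1, h2⟩
      exact ⟨h1, h2.le⟩
    · intro k
      rw [hl.joined_iff]
      constructor
      · rintro ⟨a, e, ⟨h1, h2, h3⟩, ht⟩
        have h4 : (tile lam a e k).word.length = e - a := length_infix lam h3
        have h5 : (tile lam a e k).x = a := rfl
        exact ⟨_, ht, by omega, rfl⟩
      · rintro ⟨t, ht, hx, hy⟩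
        obtain ⟨a, e, k', he, hk, hr1, rfl⟩ := mem_tilesOf.1 ht
        have h4 : (tile lam a e k').word.length = e - a := length_infix lam he
        have h5 : (tile lam a e k').x = a := rfl
        obtain rfl : k = k' := by simp only [tile] at hy; omega
        exact ⟨a, e, by omega, ht⟩
  have h2 : ∀ x ∈ Finset.range (lam.length + 1), h x = ∑ t ∈ tilesOf lam h j,
      if t.x ≤ x ∧ x ≤ t.x + t.word.length then 1 else 0 := by
    intro x hx
    rw [← Finset.card_filter, card_filter_level (n := h x) (x := x)]
    · rintro t - h1
      exact h1
    · intro k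
      constructor
      · intro hk
        obtain ⟨a, e, hr1, hxa, he⟩ := hl.exists_isRun (Nat.lt_succ_iff.1 (Finset.mem_range.1 hx)) k
        have h4 : (tile lam a e k).word.length = e - a := length_infix lam he
        have h5 : (tile lam a e k).x = a := rfl
        exact ⟨tile lam a e k, (tile_mem_tilesOf hr1.le he).2
          ⟨hl.lt_of_isRun hr1 he hxa hk ⟨le_rfl, hr1.le⟩, hr1⟩, by omega, rfl⟩
      · rintro ⟨t, ht, hx, hy⟩
        obtain ⟨a, e, k', he, hk, hr1, rfl⟩ := mem_tilesOf.1 ht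
        have h4 : (tile lam a e k').word.length = e - a := length_infix lam he
        have h5 : (tile lam a e k').x = a := rfl
        obtain rfl : k = k' := by simp only [tile] at hy; omega
        have := hr1.le
        exact hl.lt_of_isRun hr1 he ⟨le_rfl, hr1.le⟩ hk (by omega)
  rw [Finset.sum_congr rfl h1, Finset.sum_congr rfl h2, Finset.sum_comm, Finset.sum_comm
    (s := Finset.range (lam.length + 1)), ← Finset.sum_add_distrib]
  refine Finset.sum_congr rfl fun t ht => ?_
  obtain ⟨a, e, k, he, hk, hr1, rfl⟩ := mem_tilesOf.1 ht
  have h4 : (tile lam a e k).word.length = e - a := length_infix lam he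
  have h5 : (tile lam a e k).x = a := rfl
  have hae := hr1.le
  rw [h4, h5, Nat.add_sub_cancel' hae, ← Finset.sum_filter, ← Finset.card_filter]
  have e1 : (Finset.range lam.length).filter (fun x => a ≤ x ∧ x < e) = Finset.Ico a e := by
    ext x; simp; omega
  have e2 : (Finset.range (lam.length + 1)).filter (fun x => a ≤ x ∧ x ≤ e) = Finset.Icc a e := by
    ext x; simp; omega
  rw [e1, e2, Nat.card_Icc, art_add_sum hl hr hM hP he hk hr1]
  omega

end Weight

/-! ### The correspondence between configurations and tilings -/

/-- The path with the heights `g`. -/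
noncomputable def pathOf (g : ℕ → ℤ) : ℕ → List DyckStep
  | 0 => []
  | n + 1 => pathOf g n ++ [if g (n + 1) - g n = 1 then U else D]

theorem length_pathOf (g : ℕ → ℤ) (n : ℕ) : (pathOf g n).length = n := by
  induction n with
  | zero => rfl
  | succ n ih => simp [pathOf, ih]

theorem height_pathOf {g : ℕ → ℤ} {n : ℕ} (h0 : g 0 = 0)
    (hg : ∀ x < n, g (x + 1) - g x = 1 ∨ g (x + 1) - g x = -1) {x : ℕ} (hx : x ≤ n) :
    height (pathOf g n) x = g x := by
  induction n generalizing x with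
  | zero =>
    obtain rfl : x = 0 := by omega
    rw [height_zero, h0]
  | succ n ih =>
    have ih' := fun x hx => ih (x := x) (fun x hx => hg x (by omega)) hx
    rcases hx.lt_or_eq with hlt | rfl
    · rw [pathOf, height_append_left (by rw [length_pathOf]; omega), ih' x (by omega)]
    · have h1 := height_append (pathOf g n) [if g (n + 1) - g n = 1 then U else D] (0 + 1)
      rw [length_pathOf, ih' n le_rfl] at h1
      rw [pathOf, ← zero_add 1, ← add_assoc, add_zero, h1]
      have := hg n (by omega)
      split_ifs with h2
      · rw [height_cons_U, height_zero]; omega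
      · rw [height_cons_D, height_zero]; omega

theorem heightFun_drop {a x : ℕ} {c : List (ℕ × ℕ)} (hx : x ≤ c.length) (i : ℕ) :
    heightFun (heightFun a c x) (c.drop x) i = heightFun a c (x + i) := by
  induction x generalizing a c with
  | zero => rw [zero_add]; rfl
  | succ x ih =>
    cases c with
    | nil => simp at hx
    | cons p c =>
      have := ih (a := p.1) (c := c) (by simpa using hx)
      rw [show x + 1 + i = x + i + 1 by ring]
      exact this

theorem joinFun_drop (c : List (ℕ × ℕ)) (x i : ℕ) : joinFun (c.drop x) i = joinFun c (x + i) := by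
  simp [joinFun, List.getD_eq_getElem?_getD]

/-- The number of levels that are joined from `x` to the end. -/
def joinedFrom (c : List (ℕ × ℕ)) (x : ℕ) : ℕ := endJoined (heightFun 0 c x) (c.drop x)

theorem lt_joinedFrom_iff {c : List (ℕ × ℕ)} {x : ℕ} (hx : x ≤ c.length) (k : ℕ) :
    k < joinedFrom c x ↔ k < heightFun 0 c c.length ∧
      ∀ s, x ≤ s → s < c.length → k < joinFun c s := by
  rw [joinedFrom, lt_endJoined_iff, heightFun_drop hx, List.length_drop, Nat.add_sub_cancel' hx]
  refine and_congr_right fun _ => ⟨fun h s hs hs' => ?_, fun h i hi => ?_⟩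
  · have := h (s - x) (by omega)
    rwa [joinFun_drop, Nat.add_sub_cancel' hs] at this
  · rw [joinFun_drop]
    exact h _ (by omega) (by omega)

theorem joinFun_of_le {c : List (ℕ × ℕ)} {s : ℕ} (hs : c.length ≤ s) : joinFun c s = 0 := by
  simp [joinFun, List.getD_eq_getElem?_getD, List.getElem?_eq_none hs]

/-- The conditions for a configuration of the path `lam`. -/
structure IsConfig (lam : List DyckStep) (c : List (ℕ × ℕ)) : Prop where
  length_eq : c.length = lam.length
  levels : Levels lam.length (heightFun 0 c) (joinFun c)
  runsOK : RunsOK lam (joinFun c)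
  step : ∀ x < lam.length,
    height lam (x + 1) - height lam x + 2 * ((heightFun 0 c (x + 1) : ℤ) - heightFun 0 c x) = 1 ∨
    height lam (x + 1) - height lam x + 2 * ((heightFun 0 c (x + 1) : ℤ) - heightFun 0 c x) = -1
  par : ∀ x ≤ lam.length, Par (lam.drop x) (prevFun 0 (joinFun c) x) (joinedFrom c x)

theorem isConfig_iff {lam : List DyckStep} {c : List (ℕ × ℕ)} :
    IsConfig lam c ↔ c ∈ configs lam 0 0 ∧ ParAll lam 0 0 c := by
  have h0 : StackRel 0 0 := fun k => ⟨le_rfl, fun n => by simp⟩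
  rw [mem_configs h0]
  constructor
  · intro h
    refine ⟨⟨h.length_eq, ?_⟩, (parAll_iff h.length_eq).2 h.par⟩
    exact (localAt_iff h.levels.zero).2 ⟨h.levels, h.runsOK, h.step⟩
  · rintro ⟨⟨h1, h2⟩, h3⟩
    obtain ⟨h4, h5, h6⟩ := (localAt_iff fun s hs => joinFun_of_le (h1.trans_le hs)).1 h2
    exact ⟨h1, h4, h5, h6, (parAll_iff h1).1 h3⟩

namespace IsConfig

variable {lam : List DyckStep} {c : List (ℕ × ℕ)}

theorem lt_joinedFrom (hc : IsConfig lam c) : ∀ x ≤ lam.length, ∀ k,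
    k < joinedFrom c x ↔ k < heightFun 0 c lam.length ∧
      ∀ s, x ≤ s → s < lam.length → k < joinFun c s := by
  rw [← hc.length_eq]
  exact fun x hx => lt_joinedFrom_iff hx

theorem exponent_eq_sum_art (hc : IsConfig lam c) :
    exponent lam c = ∑ t ∈ tilesOf lam (heightFun 0 c) (joinFun c), t.art := by
  have h1 := sum_art hc.levels hc.runsOK hc.lt_joinedFrom hc.par
  have h2 : ∀ x ∈ Finset.range lam.length, weightAt lam x * joinFun c x ≤ heightFun 0 c (x + 1) := by
    intro x hx
    have h3 : weightAt lam x ≤ 1 := by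
      rw [weightAt]
      rcases lam.drop x with _ | ⟨_ | _, w⟩
      · exact Nat.zero_le _
      · exact dotWeight_le w
      · exact le_rfl
    exact (Nat.mul_le_mul_right _ h3).trans
      ((one_mul _).trans_le (hc.levels.le_right x (Finset.mem_range.1 hx)))
  have h3 : heightFun 0 c 0 = 0 := rfl
  rw [exponent_eq 0 hc.length_eq, Finset.sum_tsub_distrib _ h2]
  rw [Finset.sum_range_succ', h3] at h1
  omega

/-- The upper path of the tiling. -/
noncomputable def upper (lam : List DyckStep) (c : List (ℕ × ℕ)) : List DyckStep :=
  pathOf (fun x => height lam x + 2 * heightFun 0 c x) lam.length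

theorem height_upper (hc : IsConfig lam c) {x : ℕ} (hx : x ≤ lam.length) :
    height (upper lam c) x = height lam x + 2 * heightFun 0 c x := by
  refine height_pathOf ?_ (fun x hx => ?_) hx
  · rw [height_zero]; rfl
  · have := hc.step x hx
    omega

theorem isTiling (hc : IsConfig lam c) :
    IsTiling lam (upper lam c) (tilesOf lam (heightFun 0 c) (joinFun c)) :=
  isTiling_tilesOf (length_pathOf _ _) (fun _ hx => hc.height_upper hx) hc.levels hc.runsOK
    hc.lt_joinedFrom hc.par

theorem ext {c' : List (ℕ × ℕ)} (hc : IsConfig lam c) (hc' : IsConfig lam c')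
    (h1 : upper lam c = upper lam c') (h2 : tilesOf lam (heightFun 0 c) (joinFun c) =
      tilesOf lam (heightFun 0 c') (joinFun c')) : c = c' := by
  refine List.ext_getElem (hc.length_eq.trans hc'.length_eq.symm) fun x hx hx' => Prod.ext ?_ ?_
  · have h3 := hc.height_upper (x := x + 1) (by have := hc.length_eq; omega)
    rw [h1, hc'.height_upper (by have := hc.length_eq; omega)] at h3
    simp [heightFun, List.getD_eq_getElem?_getD, hx, hx'] at h3
    omega
  · have h3 : joinFun c x = joinFun c' x := by
      refine eq_of_forall_lt_iff fun k => ?_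
      rw [hc.levels.joined_iff, hc'.levels.joined_iff, h2]
    simpa [joinFun, List.getD_eq_getElem?_getD, hx, hx'] using h3

end IsConfig

theorem tilesOf_congr {lam : List DyckStep} {h h' j : ℕ → ℕ} (hh : ∀ x ≤ lam.length, h x = h' x) :
    tilesOf lam h j = tilesOf lam h' j := by
  ext t
  rw [mem_tilesOf, mem_tilesOf]
  constructor <;> rintro ⟨a, e, k, he, hk, hr, rfl⟩ <;> refine ⟨a, e, k, he, ?_, hr, rfl⟩
  · rwa [← hh a (hr.le.trans he)]
  · rwa [hh a (hr.le.trans he)]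

theorem IsTiling.exists_isConfig {lam mu : List DyckStep} {S : Finset Tile}
    (hT : IsTiling lam mu S) : ∃ c, IsConfig lam c ∧ IsConfig.upper lam c = mu ∧
      tilesOf lam (heightFun 0 c) (joinFun c) = S := by
  obtain ⟨h, j, hmu, hl, rfl⟩ := hT.exists_levels
  set c := (List.range lam.length).map fun x => (h (x + 1), j x) with hc
  have hlen : c.length = lam.length := by simp [hc]
  have hh : ∀ x ≤ lam.length, heightFun 0 c x = h x := by
    intro x hx
    rcases x with _ | x
    · have := hmu 0
      rw [height_zero, height_zero] at this
      change 0 = h 0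
      omega
    · simp only [heightFun, List.getD_eq_getElem?_getD, hc, List.getElem?_cons_succ]
      simp [List.getElem?_range (show x < lam.length by omega)]
  have hj : joinFun c = j := by
    funext x
    rcases lt_or_ge x lam.length with hx | hx
    · simp only [joinFun, List.getD_eq_getElem?_getD, hc]
      simp [List.getElem?_range hx]
    · rw [hl.zero x hx, joinFun_of_le (hlen.trans_le hx)]
  have hl' : Levels lam.length (heightFun 0 c) j :=
    ⟨fun s hs => by rw [hh s hs.le]; exact hl.le_left s hs,
      fun s hs => by rw [hh (s + 1) hs]; exact hl.le_right s hs, hl.zero⟩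
  rw [← tilesOf_congr hh] at hT ⊢
  have hM : ∀ x ≤ lam.length, ∀ k, k < joinedFrom c x ↔ k < heightFun 0 c lam.length ∧
      ∀ s, x ≤ s → s < lam.length → k < j s := by
    rw [← hlen, ← hj]
    exact fun x hx => lt_joinedFrom_iff hx
  have hconf : IsConfig lam c := by
    refine ⟨hlen, by rwa [hj], by rw [hj]; exact runsOK_of_isTiling hl' hT, fun x hx => ?_, ?_⟩
    · rw [hh (x + 1) hx, hh x hx.le]
      have h1 := height_succ mu (x := x) (by rw [hT.length_eq]; exact hx)
      rw [hmu, hmu] at h1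
      omega
    · rw [hj]
      exact par_of_isTiling hl' hT hM
  refine ⟨c, hconf, ?_, by rw [hj]⟩
  refine eq_of_height_eq ((length_pathOf _ _).trans hT.length_eq.symm) fun x hx => ?_
  have hx' : x ≤ lam.length := by rwa [IsConfig.upper, length_pathOf] at hx
  rw [hconf.height_upper hx', hmu, hh x hx']

theorem genFunLower_eq_transfer (lam : List DyckStep) :
    genFunLower lam = transfer Polynomial.X lam (twist lam 0 1) 0 0 := by
  classical
  rw [transfer_eq_sum]
  simp only [genFunLower, genFun, Pi.one_apply, mul_ite, mul_one, mul_zero]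
  rw [← Finset.sum_filter, Finset.sum_sigma']
  symm
  refine Finset.sum_bij (fun c _ => ⟨IsConfig.upper lam c, tilesOf lam (heightFun 0 c) (joinFun c)⟩)
    ?_ ?_ ?_ ?_
  · intro c hc
    have hc := isConfig_iff.2 (Finset.mem_filter.1 hc)
    simp only [Finset.mem_sigma, Set.Finite.mem_toFinset]
    exact ⟨length_pathOf _ _, hc.isTiling⟩
  · intro c hc c' hc' h
    rw [Sigma.mk.injEq] at h
    exact (isConfig_iff.2 (Finset.mem_filter.1 hc)).ext (isConfig_iff.2 (Finset.mem_filter.1 hc')) h.1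
      (eq_of_heq h.2)
  · rintro ⟨mu, S⟩ hS
    rw [Finset.mem_sigma, Set.Finite.mem_toFinset, Set.Finite.mem_toFinset] at hS
    obtain ⟨c, hc, rfl, rfl⟩ := IsTiling.exists_isConfig hS.2
    exact ⟨c, Finset.mem_filter.2 (isConfig_iff.1 hc), rfl⟩
  · intro c hc
    rw [(isConfig_iff.2 (Finset.mem_filter.1 hc)).exponent_eq_sum_art]

/-! ### The main theorem -/

theorem qInt_X_ne_zero (n : ℕ) : qInt (Polynomial.X : Polynomial ℤ) (n + 1) ≠ 0 := by
  intro h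
  have h1 := congrArg (Polynomial.eval 1) h
  simp [qInt, Polynomial.eval_finsetSum] at h1
  omega

end BallotBI

theorem mainTheorem12 (lam : List DyckStep) (hlam : BallotBI.IsBallot lam) :
    BallotBI.genFunLower lam =
      (∑ L ∈ BallotBI.naturalLabellings (BallotBI.tree lam),
        Polynomial.X ^ BallotBI.deg7 L *
          ∏ e ∈ BallotBI.setB (BallotBI.tree lam) ∩ BallotBI.circledEdges L,
            (1 + Polynomial.X ^ (BallotBI.Edge.S e - 1))) *
        ∏ e ∈ BallotBI.setA (BallotBI.tree lam), (1 + Polynomial.X ^ BallotBI.Edge.S e) := by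
  rw [BallotBI.sum_labelWeight, (BallotBI.baseWord_of_isBallot hlam).sum_labelWeight,
    BallotBI.genFunLower_eq_transfer lam,
    BallotBI.transfer_of_isBallot _ BallotBI.qInt_X_ne_zero hlam]
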